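/- Let $\mathcal X$ be an arithmetic variety, i.e. an integral scheme, flat and projective over $\mathbb Z$, with smooth generic fibre $\mathcal X_{\mathbb Q}$; let $\mathcal L$ be a line bundle on $\mathcal X$, and put $X=\mathcal X(\mathbb C)$ (with the analytic topology) and $L=\mathcal L(\mathbb C)$. Let $\mu$ be a Borel probability measure on $X$ with non-pluripolar support; if $X$ is not connected, this means that the support of $\mu$ meets every connected component of $X$ in a non-pluripolar set. A continuous weight on $\mathcal L$ is a continuous function $\phi:L^\ast\setminus 0\to\mathbb R$ on the complement of the zero section of the total space of the dual bundle with $\phi(\lambda v)=\log|\lambda|+\phi(v)$ for $\lambda\in\mathbb C^\ast$. For $k\in\mathbb N$ and a section $s$ of $k\mathcal L=\mathcal L^{\otimes k}$ put $\|s(x)\|_{k\phi}=|\langle v^{\otimes k},s(x)\rangle|\,e^{-k\phi(v)}$ for any non-zero $v\in L_x^\ast$, and $\|s\|_{(\mu,k\phi)}^2=\int_X\|s(x)\|_{k\phi}^2\,d\mu(x)$. Put $$h^0_\theta(\mu,k\phi)=\log\sum_{s\in H^0(\mathcal X,k\mathcal L)}e^{-\pi\|s\|^2_{(\mu,k\phi)}},\qquad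 \Theta(\mu,k\phi)(x)=2\pi\sum_{s\in H^0(\mathcal X,k\mathcal L)}\|s(x)\|_{k\phi}^2\,\frac{e^{-\pi\|s\|^2_{(\mu,k\phi)}}}{\sum_{u\in H^0(\mathcal X,k\mathcal L)}e^{-\pi\|u\|^2_{(\mu,k\phi)}}}.$$ Let $\phi,\psi$ be two continuous weights on $\mathcal L$, and for $t\in[0,1]$ let $\phi_t=t\phi+(1-t)\psi$. Then for every $k\in\mathbb N$ $$h^0_\theta(\mu,k\phi)-h^0_\theta(\mu,k\psi)=k\int_X(\phi-\psi)(x)\left(\int_0^1\Theta(\mu,k\phi_t)(x)\,dt\right)d\mu(x),$$ where $\phi-\psi$ is regarded as a function on $X$; here all series (for all weights $\phi_t$, $t\in[0,1]$) and all integrals converge. -/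

import Mathlib

open AlgebraicGeometry CategoryTheory MeasureTheory TopologicalSpace
open scoped TensorProduct

noncomputable section

namespace ArithTheta

/-! ## Arithmetic varieties -/

/-- The projective space `ℙⁿ` over `ℤ`. -/
def ProjectiveSpaceZ (n : ℕ) : Scheme.{0} :=
  letI := MvPolynomial.gradedAlgebra (σ := Fin (n + 1)) (R := ℤ)
  Proj (MvPolynomial.homogeneousSubmodule (Fin (n + 1)) ℤ)

/-- An arithmetic variety: an integral scheme, flat and projective over `Spec ℤ`, whose generic
fibre is smooth over `ℚ`. (Every morphism of schemes is a morphism over the terminal scheme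
`Spec ℤ`.) -/
structure IsArithmeticVariety (X : Scheme.{0}) : Prop where
  isIntegral : IsIntegral X
  flat : Flat (specZIsTerminal.from X)
  projective : ∃ (n : ℕ) (i : X ⟶ ProjectiveSpaceZ n), IsClosedImmersion i
  smooth_generic : Smooth (Limits.pullback.snd (specZIsTerminal.from X)
    (Spec.map (CommRingCat.ofHom (Int.castRingHom ℚ))))

/-! ## Complex points and their analytic topology -/

/-- The set `X(ℂ)` of complex points. -/
def ComplexPoints (X : Scheme.{0}) : Type := Spec (.of ℂ) ⟶ X

namespace ComplexPoints

variable {X : Scheme.{0}}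

/-- The point of the scheme `X` underlying a complex point. -/
def pt (x : ComplexPoints X) : X :=
  (show Spec (.of ℂ) ⟶ X from x) (IsLocalRing.closedPoint ℂ)

/-- Evaluation `𝒪_{X,x} → ℂ` of germs of regular functions at a complex point. -/
def ev (x : ComplexPoints X) : X.presheaf.stalk x.pt →+* ℂ :=
  (Scheme.stalkClosedPointTo (R := .of ℂ) (show Spec (.of ℂ) ⟶ X from x)).hom

open Classical in
/-- The value at `x` of a regular function `f` on `U` (and `0` for `x` outside `U`). -/
def value {U : X.Opens} (f : Γ(X, U)) (x : ComplexPoints X) : ℂ :=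
  if h : x.pt ∈ U then x.ev (X.presheaf.germ U x.pt h f) else 0

/-- The analytic topology on `X(ℂ)`: the coarsest one for which `U(ℂ)` is open and regular
functions on `U` are continuous on `U(ℂ)`, for every Zariski open `U`. -/
instance : TopologicalSpace (ComplexPoints X) :=
  TopologicalSpace.generateFrom
    {S | ∃ (U : X.Opens) (f : Γ(X, U)) (W : Set ℂ), IsOpen W ∧
      S = {x | x.pt ∈ U ∧ value f x ∈ W}}

instance : MeasurableSpace (ComplexPoints X) := borel _

instance : BorelSpace (ComplexPoints X) := ⟨rfl⟩

end ComplexPoints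

/-! ## Plurisubharmonic functions and pluripolar sets -/

section Pluripolar

variable {X : Scheme.{0}}

/-- `γ` is a holomorphic map from the open set `D ⊆ ℂ` to `X(ℂ)`: it is continuous and pulls
regular functions back to holomorphic functions. -/
def IsHolomorphicMap (γ : ℂ → ComplexPoints X) (D : Set ℂ) : Prop :=
  ContinuousOn γ D ∧
    ∀ (U : X.Opens) (f : Γ(X, U)),
      DifferentiableOn ℂ (fun z => (γ z).value f) (D ∩ {z | (γ z).pt ∈ U})

/-- `u : W → [-∞, ∞)` is plurisubharmonic (possibly `≡ -∞`) on the open set `W`: it is upper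
semicontinuous and satisfies the sub-mean value inequality along every closed holomorphic disc in
`W`. As `u ∘ γ` is upper semicontinuous, its mean over the circle is the infimum of the means of
its continuous majorants. -/
structure IsPSH (W : Set (ComplexPoints X)) (u : ComplexPoints X → EReal) : Prop where
  usc : UpperSemicontinuousOn u W
  lt_top : ∀ x ∈ W, u x < ⊤
  submean : ∀ (γ : ℂ → ComplexPoints X) (D : Set ℂ), IsOpen D → Metric.closedBall 0 1 ⊆ D →
    IsHolomorphicMap γ D → (∀ z ∈ Metric.closedBall (0 : ℂ) 1, γ z ∈ W) →
    ∀ h : ℂ → ℝ, Continuous h → (∀ z ∈ Metric.sphere (0 : ℂ) 1, u (γ z) ≤ (h z : EReal)) →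
      u (γ 0) ≤ ((Real.circleAverage h 0 1 : ℝ) : EReal)

/-- `E` is pluripolar: locally, it is contained in the `-∞`-locus of a plurisubharmonic function
that is not identically `-∞` on any connected component, equivalently on any non-empty open set,
of its domain. -/
def IsPluripolar (E : Set (ComplexPoints X)) : Prop :=
  ∀ x ∈ E, ∃ W : Set (ComplexPoints X), IsOpen W ∧ x ∈ W ∧
    ∃ u : ComplexPoints X → EReal, IsPSH W u ∧
      (∀ V : Set (ComplexPoints X), IsOpen V → V ⊆ W → V.Nonempty → ∃ y ∈ V, u y ≠ ⊥) ∧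
      ∀ y ∈ E ∩ W, u y = ⊥

end Pluripolar

/-! ## Line bundles -/

/-- The stalk at `p` of a presheaf of `𝒪_X`-modules is a module over the local ring `𝒪_{X,p}`. -/
abbrev presheafStalkModule {X : Scheme.{0}}
    (N : PresheafOfModules.{0} (X.presheaf ⋙ forget₂ CommRingCat RingCat)) (p : X) :
    Module (X.presheaf.stalk p) (TopCat.Presheaf.stalk (C := Ab) N.presheaf p) :=
  inferInstance

/-- The stalk at `p` of an `𝒪_X`-module is a module over the local ring `𝒪_{X,p}`. -/
instance stalkModule {X : Scheme.{0}} (M : X.Modules) (p : X) :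
    Module (X.presheaf.stalk p) (M.presheaf.stalk p) :=
  presheafStalkModule M.val p

lemma germ_smul {X : Scheme.{0}} (M : X.Modules) {U : X.Opens} (p : X) (hp : p ∈ U)
    (r : Γ(X, U)) (m : Γ(M, U)) :
    M.presheaf.germ U p hp (r • m) = X.presheaf.germ U p hp r • M.presheaf.germ U p hp m :=
  PresheafOfModules.germ_smul (R := X.presheaf) M.val p U hp r m

/-- A local frame of an `𝒪_X`-module: a section `e` over an open set `U` which freely generates the
module over `U`. -/
structure LocalFrame {X : Scheme.{0}} (M : X.Modules) where
  U : X.Opens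
  e : Γ(M, U)
  bijective : ∀ (V : X.Opens) (h : V ≤ U),
    Function.Bijective (fun r : Γ(X, V) => r • M.presheaf.map (homOfLE h).op e)

/-- A line bundle: an `𝒪_X`-module which is locally free of rank one. -/
structure LineBundle (X : Scheme.{0}) where
  sheaf : X.Modules
  exists_frame : ∀ p : X, ∃ F : LocalFrame sheaf, p ∈ F.U

namespace LineBundle

variable {X : Scheme.{0}}

/-- The stalk `ℒ_p`. -/
abbrev stalk (L : LineBundle X) (p : X) : Ab := L.sheaf.presheaf.stalk p

end LineBundle

/-- The germ of a local frame at `p` is a basis of the stalk. -/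
lemma LocalFrame.stalk_bijective {X : Scheme.{0}} {M : X.Modules} (F : LocalFrame M) (p : X)
    (hp : p ∈ F.U) :
    Function.Bijective
      (fun r : X.presheaf.stalk p => r • M.presheaf.germ F.U p hp F.e) := by
  have key : ∀ (V : X.Opens) (hV : p ∈ V) (h : V ≤ F.U) (r : Γ(X, V)),
      X.presheaf.germ V p hV r • M.presheaf.germ F.U p hp F.e =
        M.presheaf.germ V p hV (r • M.presheaf.map (homOfLE h).op F.e) := by
    intro V hV h r
    rw [germ_smul, TopCat.Presheaf.germ_res_apply]
  constructor
  · intro a b hab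
    obtain ⟨V, hVU, hV, r, rfl⟩ := X.presheaf.exists_le_germ_eq a hp
    obtain ⟨V', hVU', hV', r', rfl⟩ := X.presheaf.exists_le_germ_eq b hp
    simp only [key V hV hVU, key V' hV' hVU'] at hab
    obtain ⟨W, hW, i, i', e⟩ := M.presheaf.germ_eq p hV hV' _ _ hab
    rw [Scheme.Modules.map_smul, Scheme.Modules.map_smul, ← ConcreteCategory.comp_apply,
      ← ConcreteCategory.comp_apply, ← Functor.map_comp, ← Functor.map_comp] at e
    have := (F.bijective W (i.le.trans hVU)).1 e
    rw [← X.presheaf.germ_res_apply i p hW, ← X.presheaf.germ_res_apply i' p hW]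
    exact congrArg _ this
  · intro t
    obtain ⟨V, hVU, hV, s, rfl⟩ := M.presheaf.exists_le_germ_eq t hp
    obtain ⟨r, hr⟩ := (F.bijective V hVU).2 s
    exact ⟨X.presheaf.germ V p hV r, by rw [← hr]; exact key V hV hVU r⟩


/-! ## Weights on a line bundle -/

/-- A point of the total space of the dual line bundle `L*` over `X(ℂ)`, outside the zero section:
a complex point `x` and a non-zero linear form `v` on the fibre of `ℒ` at `x`, that is, a non-zero
additive map `v : ℒ_x → ℂ` with `v (r • s) = r(x) v(s)` for `r ∈ 𝒪_{X,x}`. -/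
structure DualPoint {X : Scheme.{0}} (L : LineBundle X) where
  x : ComplexPoints X
  v : L.stalk x.pt →ₛₗ[x.ev] ℂ
  ne_zero : v ≠ 0

namespace DualPoint

variable {X : Scheme.{0}} {L : LineBundle X}

/-- The pairing of a point `v ∈ L*_x` with the value at `x` of a section `s` over `U`. -/
def pair (w : DualPoint L) {U : X.Opens} (hU : w.x.pt ∈ U) (s : Γ(L.sheaf, U)) : ℂ :=
  w.v (L.sheaf.presheaf.germ U w.x.pt hU s)

/-- Multiplication by a non-zero scalar in the fibres of `L*`. -/
def scale (c : ℂ) (hc : c ≠ 0) (w : DualPoint L) : DualPoint L where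
  x := w.x
  v := c • w.v
  ne_zero := smul_ne_zero hc w.ne_zero

/-- The usual topology on the total space of `L*` minus the zero section: the coarsest one for
which the projection to `X(ℂ)` and the pairings with local sections of `ℒ` are continuous. -/
instance : TopologicalSpace (DualPoint L) :=
  TopologicalSpace.generateFrom
    ({S | ∃ O : Set (ComplexPoints X), IsOpen O ∧ S = {w | w.x ∈ O}} ∪
      {S | ∃ (U : X.Opens) (s : Γ(L.sheaf, U)) (W : Set ℂ), IsOpen W ∧
        S = {w | ∃ h : w.x.pt ∈ U, w.pair h s ∈ W}})

lemma exists_above (L : LineBundle X) (x : ComplexPoints X) : ∃ w : DualPoint L, w.x = x := by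
  obtain ⟨F, hF⟩ := L.exists_frame x.pt
  let b := LinearEquiv.ofBijective
    (LinearMap.toSpanSingleton (X.presheaf.stalk x.pt) (L.stalk x.pt)
      (L.sheaf.presheaf.germ F.U x.pt hF F.e)) (F.stalk_bijective x.pt hF)
  let v : L.stalk x.pt →ₛₗ[x.ev] ℂ :=
    { toFun := fun s => x.ev (b.symm s)
      map_add' := fun s t => by simp
      map_smul' := fun r s => by simp }
  refine ⟨⟨x, v, fun h => ?_⟩, rfl⟩
  have h1 : v (b 1) = 0 := by rw [h]; rfl
  have h2 : v (b 1) = 1 := by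
    change x.ev (b.symm (b 1)) = 1
    simp
  exact one_ne_zero (h2.symm.trans h1)

/-- A chosen non-zero vector of the fibre `L*_x`. -/
def above (L : LineBundle X) (x : ComplexPoints X) : DualPoint L := (exists_above L x).choose

lemma above_x (L : LineBundle X) (x : ComplexPoints X) : (above L x).x = x :=
  (exists_above L x).choose_spec

end DualPoint

/-- A weight on `ℒ`: a log-homogeneous real function on the complement of the zero section in the
total space of `L*`. (Only continuous weights are used below; for these local integrability is
automatic.) -/
structure Weight {X : Scheme.{0}} (L : LineBundle X) where
  toFun : DualPoint L → ℝ
  log_homogeneous : ∀ (c : ℂ) (hc : c ≠ 0) (w : DualPoint L),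
    toFun (w.scale c hc) = Real.log ‖c‖ + toFun w

namespace Weight

variable {X : Scheme.{0}} {L : LineBundle X}

/-- The weight `t φ + (1 - t) ψ`. -/
def segment (φ ψ : Weight L) (t : ℝ) : Weight L where
  toFun w := t * φ.toFun w + (1 - t) * ψ.toFun w
  log_homogeneous c hc w := by
    rw [φ.log_homogeneous, ψ.log_homogeneous]; ring

/-- The difference `φ - ψ` as a function on `X(ℂ)`: the value `φ(v) - ψ(v)` does not depend on the
choice of a non-zero `v ∈ L*_x`. -/
def diff (φ ψ : Weight L) (x : ComplexPoints X) : ℝ :=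
  φ.toFun (DualPoint.above L x) - ψ.toFun (DualPoint.above L x)

end Weight

/-! ## Global sections of tensor powers -/

section Powers

variable {X : Scheme.{0}}

/-- The group `H⁰(X, kℒ)` of global sections of `ℒ^{⊗k}`: families of elements
`s_p ∈ (ℒ_p)^{⊗k}` of the stalks of `ℒ^{⊗k}` such that for every local frame `e` of `ℒ` over `U`
one has `s = f e^{⊗k}` over `U` with a regular function `f` on `U`. -/
def H0 (L : LineBundle X) (k : ℕ) :
    AddSubgroup (∀ p : X, ⨂[X.presheaf.stalk p]^k (L.stalk p)) where
  carrier := {s | ∀ F : LocalFrame L.sheaf, ∃ f : Γ(X, F.U), ∀ (p : X) (hp : p ∈ F.U),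
    s p = X.presheaf.germ F.U p hp f •
      PiTensorProduct.tprod (X.presheaf.stalk p)
        (fun _ : Fin k => (L.sheaf.presheaf.germ F.U p hp F.e : L.stalk p))}
  zero_mem' F := ⟨0, fun p hp => by simp⟩
  add_mem' {s s'} hs hs' F := by
    obtain ⟨f, hf⟩ := hs F
    obtain ⟨f', hf'⟩ := hs' F
    exact ⟨f + f', fun p hp => by rw [Pi.add_apply, hf p hp, hf' p hp, map_add, add_smul]⟩
  neg_mem' {s} hs F := by
    obtain ⟨f, hf⟩ := hs F
    exact ⟨-f, fun p hp => by rw [Pi.neg_apply, hf p hp, map_neg, neg_smul]⟩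

/-- For `v ∈ L*_x`, the linear form `v^{⊗k}` on the fibre of `ℒ^{⊗k}` at `x`; it sends
`s₁ ⊗ ⋯ ⊗ s_k` to `v(s₁) ⋯ v(s_k)`. -/
def DualPoint.pow {L : LineBundle X} (w : DualPoint L) (k : ℕ) :
    (⨂[X.presheaf.stalk w.x.pt]^k (L.stalk w.x.pt)) → ℂ :=
  letI : Algebra (X.presheaf.stalk w.x.pt) ℂ := w.x.ev.toAlgebra
  let v : L.stalk w.x.pt →ₗ[X.presheaf.stalk w.x.pt] ℂ :=
    { toFun := w.v
      map_add' := w.v.map_add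
      map_smul' := w.v.map_smulₛₗ }
  PiTensorProduct.lift
    ((MultilinearMap.mkPiAlgebra (X.presheaf.stalk w.x.pt) (Fin k) ℂ).compLinearMap fun _ => v)

/-- The norm `‖s(x)‖_{kφ} = |⟨v^{⊗k}, s(x)⟩| e^{-k φ(v)}` of a section of `kℒ` at a complex point
`x`, where `v ∈ L*_x` is non-zero; by log-homogeneity it does not depend on `v`. -/
def pointNorm {L : LineBundle X} (φ : Weight L) {k : ℕ} (s : H0 L k) (x : ComplexPoints X) : ℝ :=
  ‖(DualPoint.above L x).pow k (s.1 (DualPoint.above L x).x.pt)‖ *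
    Real.exp (-(k * φ.toFun (DualPoint.above L x)))

/-- The square `‖s‖²_{(μ,kφ)} = ∫ ‖s(x)‖²_{kφ} dμ` of the `L²`-norm. -/
def normSq {L : LineBundle X} (μ : Measure (ComplexPoints X)) (φ : Weight L) {k : ℕ}
    (s : H0 L k) : ℝ :=
  ∫ x, pointNorm φ s x ^ 2 ∂μ

/-- The theta invariant `h⁰_θ` of `H⁰(X, kℒ)` with the norm `‖·‖_{(μ,kφ)}`. -/
def hTheta {L : LineBundle X} (μ : Measure (ComplexPoints X)) (φ : Weight L) (k : ℕ) : ℝ :=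
  Real.log (∑' s : H0 L k, Real.exp (-Real.pi * normSq μ φ s))

/-- The function `Θ(μ, kφ)(t; x)`. -/
def Theta {L : LineBundle X} (μ : Measure (ComplexPoints X)) (φ : Weight L) (k : ℕ) (t : ℝ)
    (x : ComplexPoints X) : ℝ :=
  2 * Real.pi * ∑' s : H0 L k, pointNorm φ s x ^ 2 *
    (Real.exp (-Real.pi * t * normSq μ φ s) / ∑' u : H0 L k, Real.exp (-Real.pi * t * normSq μ φ u))

end Powers

end ArithTheta

end

/-! The formula is the fundamental theorem of calculus for the logarithm of the theta sum along the
segment of weights. Since `φ_t = ψ + t (φ - ψ)`, one has `‖s‖²_{kφ_t} = ‖s‖²_{kψ} exp(-2kt(φ - ψ))`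
pointwise. Differentiating `log ∑ exp(-π ‖s‖²_{(μ,kφ_t)})` term by term brings down `2πk ∫ (φ - ψ)
‖s‖²_{kφ_t} dμ`. After the exchange of sum and integral, the derivative is `k ∫ (φ - ψ) Θ(μ, kφ_t)
dμ`. Integration over `t` and Fubini give the claim. This analytic half is
`GaussianFamily.log_tsum_gauss_sub`; it needs countably many sections and Gaussian sums that
converge, with sup-norm factors and with an arbitrary positive constant in the exponent.

Convergence is where geometry enters (`exists_gaussianFamily`). A Gaussian sum over a lattice of
finite rank converges if the squared norm extends to a continuous positive definite
quadratic-homogeneous function on the real span (`summable_gauss_of_pos_def`). Two things are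
required.

The sections form a free group of finite rank (`finite_H0`, `isTorsionFree_H0`). Inside the function
field, one common multiplier turns every section into a fraction that becomes a form after
multiplication by high powers of each coordinate; a Noetherian argument bounds the degree of such
elements (`exists_formValues_bound`). Flatness over `ℤ` excludes torsion.

The norm is definite (`integral_combinationNorm_sq_pos`). If it vanishes on a real combination of
sections, that combination vanishes on the support of `μ`. Smoothness of the generic fibre gives an
identity principle (`eventually_eq_zero_of_smooth_genericFibre`), so the interior of the zero set is
open and closed. On a component avoiding this interior, the logarithm of the absolute value of the
combination would show that the support is pluripolar there, by Jensen's formula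
(`log_enorm_le_circleAverage`). So the combination vanishes at all complex points. Finally,
`eq_zero_of_forall_algHom_complex` says that functions independent over `ℚ` remain independent over
`ℂ` on complex points, and all coefficients are zero. -/

noncomputable section

namespace ArithTheta

/-! ### Bounding the degree of forms: finiteness of twisted sections by hand -/

section

section HomogeneousValues

open MvPolynomial

variable {ι F : Type*} [CommRing F]

/-- The values at the point `y` of the integral forms of degree `d`. -/
def formValues (y : ι → F) (d : ℕ) : Submodule ℤ F :=
  (homogeneousSubmodule ι ℤ d).map (aeval y).toLinearMap

lemma mem_formValues {y : ι → F} {d : ℕ} {a : F} :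
    a ∈ formValues y d ↔ ∃ p : MvPolynomial ι ℤ, p.IsHomogeneous d ∧ aeval y p = a := by
  simp [formValues]

lemma formValues_mul_mem {y : ι → F} {d e : ℕ} {a b : F} (ha : a ∈ formValues y d)
    (hb : b ∈ formValues y e) : a * b ∈ formValues y (d + e) := by
  obtain ⟨p, hp, rfl⟩ := mem_formValues.1 ha
  obtain ⟨q, hq, rfl⟩ := mem_formValues.1 hb
  exact mem_formValues.2 ⟨p * q, hp.mul hq, map_mul _ _ _⟩

lemma coord_pow_mem_formValues (y : ι → F) (j : ι) (n : ℕ) : y j ^ n ∈ formValues y n :=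
  mem_formValues.2 ⟨X j ^ n, isHomogeneous_X_pow j n, by simp⟩

lemma formValues_fg [Finite ι] (y : ι → F) (d : ℕ) : (formValues y d).FG :=
  (homogeneousSubmodule_fg ι ℤ d).map _

/-- Multiplying a form by a power of the coordinate with value 1 raises its degree and keeps its
value. -/
lemma formValues_mono {y : ι → F} {i₀ : ι} (h₀ : y i₀ = 1) {d e : ℕ} (hde : d ≤ e) :
    formValues y d ≤ formValues y e := by
  intro a ha
  have := formValues_mul_mem ha (coord_pow_mem_formValues y i₀ (e - d))
  rwa [h₀, one_pow, mul_one, Nat.add_sub_cancel' hde] at this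

/-- A form of degree `q` shifts the grading by `q`, so a single component of the other factor
contributes. This makes the coefficients of an ideal relation homogeneous. -/
lemma homogeneousComponent_mul_of_isHomogeneous {c g : MvPolynomial ι ℤ} {d q : ℕ}
    (hg : g.IsHomogeneous q) (hqd : q ≤ d) :
    homogeneousComponent d (c * g) = homogeneousComponent (d - q) c * g := by
  conv_lhs => rw [← sum_homogeneousComponent c, Finset.sum_mul, map_sum]
  have h : ∀ i, homogeneousComponent d (homogeneousComponent i c * g) =
      if i = d - q then homogeneousComponent i c * g else 0 := by
    intro i
    rw [homogeneousComponent_of_mem ((homogeneousComponent_isHomogeneous i c).mul hg)]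
    congr 1
    simp only [eq_iff_iff]
    omega
  simp only [h, Finset.sum_ite_eq', Finset.mem_range]
  split_ifs with h1
  · rfl
  · rw [homogeneousComponent_eq_zero _ _ (by omega), zero_mul]

/-- A form of large degree maps an element multiplied into lower degree by high powers of all the
coordinates to lower degree. -/
lemma formValues_mul_mem_of_large [Fintype ι] {y : ι → F} {q N p : ℕ} {a b : F}
    (hp : Fintype.card ι * (N + 1) < p) (ha : a ∈ formValues y p)
    (hb : ∀ j, y j ^ (N + 1) * b ∈ formValues y (q + N)) :
    a * b ∈ formValues y (p + q - 1) := by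
  classical
  obtain ⟨P, hP, rfl⟩ := mem_formValues.1 ha
  rw [P.as_sum, map_sum, Finset.sum_mul]
  refine Submodule.sum_mem _ fun m hm => ?_
  have hdeg : m.degree = p := by
    rw [Finsupp.degree_eq_weight_one]; exact hP (mem_support_iff.1 hm)
  -- Pigeonhole: a monomial of degree above `card ι * (N + 1)` contains some variable to the power
  -- `N + 1`, which can be spent on `b`.
  obtain ⟨j, hj⟩ : ∃ j, N + 1 ≤ m j := by
    by_contra! h
    have : m.degree ≤ Fintype.card ι * (N + 1) := by
      rw [Finsupp.degree_eq_sum]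
      calc ∑ i, m i ≤ ∑ _i : ι, (N + 1) := Finset.sum_le_sum fun i _ => (h i).le
        _ = _ := by simp
    omega
  set m' := m - Finsupp.single j (N + 1) with hm'
  have hsplit : m = m' + Finsupp.single j (N + 1) := by
    rw [hm', tsub_add_cancel_of_le]; rwa [Finsupp.single_le_iff]
  have hdeg' : m'.degree = p - (N + 1) := by
    have := congrArg Finsupp.degree hsplit
    rw [map_add, Finsupp.degree_single, hdeg] at this
    omega
  have hNp : N + 1 ≤ p := by
    have := congrArg Finsupp.degree hsplit
    rw [map_add, Finsupp.degree_single, hdeg] at this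
    omega
  have h1 : aeval y (monomial m' (coeff m P)) ∈ formValues y (p - (N + 1)) :=
    mem_formValues.2 ⟨_, isHomogeneous_monomial _ hdeg', rfl⟩
  have h2 := formValues_mul_mem h1 (hb j)
  have h3 : aeval y (monomial m (coeff m P)) * b =
      aeval y (monomial m' (coeff m P)) * (y j ^ (N + 1) * b) := by
    rw [← mul_assoc]
    have : monomial m (coeff m P) = monomial m' (coeff m P) * X j ^ (N + 1) := by
      rw [X_pow_eq_monomial, monomial_mul, mul_one, ← hsplit]
    rw [this, map_mul, map_pow, aeval_X]
  rw [h3]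
  convert h2 using 2
  omega

/-- Finiteness of the sections of twisting sheaves: the elements which all powers of coordinates of
high order multiply into forms have bounded degree. -/
theorem exists_formValues_bound [Fintype ι] (y : ι → F) {i₀ : ι} (h₀ : y i₀ = 1) (e : ℕ) :
    ∃ D, ∀ f : F, (∀ j, ∃ N, y j ^ N * f ∈ formValues y (N + e)) → f ∈ formValues y D := by
  classical
  -- The forms whose value drops by one degree, relative to the expected one, after multiplication
  -- by a high power of any coordinate. The ideal they span is finitely generated.
  let G : Set (MvPolynomial ι ℤ) :=
    {p | ∃ q, p.IsHomogeneous q ∧ ∃ N, ∀ j, y j ^ (N + 1) * aeval y p ∈ formValues y (q + N)}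
  obtain ⟨t, htG, ht⟩ := (Submodule.fg_span_iff_fg_span_finset_subset (R := MvPolynomial ι ℤ) G).1
    (IsNoetherian.noetherian _)
  choose! q hq N hN using fun p (hp : p ∈ G) => hp
  -- Beyond this degree, the cofactor of each generator is long enough for
  -- `formValues_mul_mem_of_large`.
  let E := ∑ g ∈ t, (q g + Fintype.card ι * (N g + 1) + 1)
  have hE : ∀ g ∈ t, q g + Fintype.card ι * (N g + 1) + 1 ≤ E := fun g hg =>
    Finset.single_le_sum (f := fun g => q g + Fintype.card ι * (N g + 1) + 1)
      (fun _ _ => Nat.zero_le _) hg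
  have key : ∀ d, E ≤ d → ∀ a ∈ formValues y d,
      (∀ j, ∃ M, y j ^ (M + 1) * a ∈ formValues y (d + M)) → a ∈ formValues y (d - 1) := by
    intro d hd a ha h
    obtain ⟨p, hp, rfl⟩ := mem_formValues.1 ha
    choose M hM using h
    have hpG : p ∈ G := by
      obtain ⟨K, hK⟩ : ∃ K, ∀ j, M j ≤ K :=
        ⟨∑ j, M j, fun j => Finset.single_le_sum (fun _ _ => Nat.zero_le _) (Finset.mem_univ j)⟩
      refine ⟨d, hp, K, fun j => ?_⟩
      have := formValues_mul_mem (coord_pow_mem_formValues y j (K - M j)) (hM j)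
      have e1 : K - M j + (M j + 1) = K + 1 := by have := hK j; omega
      have e2 : K - M j + (d + M j) = d + K := by have := hK j; omega
      rwa [← mul_assoc, ← pow_add, e1, e2] at this
    have hps : p ∈ Submodule.span (MvPolynomial ι ℤ) (t : Set (MvPolynomial ι ℤ)) := by
      rw [← ht]; exact Submodule.subset_span hpG
    obtain ⟨c, hc⟩ := (Submodule.mem_span_finset' (R := MvPolynomial ι ℤ)).1 hps
    -- Taking the component of degree `d` replaces each coefficient by a form of degree `d - q g`.
    have hp' : p = ∑ g : t, homogeneousComponent (d - q g) (c g) * g := by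
      have h1 : homogeneousComponent d p = p := homogeneousComponent_eq_self hp
      conv_lhs => rw [← h1, ← hc, map_sum]
      refine Finset.sum_congr rfl fun g _ => ?_
      exact homogeneousComponent_mul_of_isHomogeneous (hq g (htG g.2))
        (by have := hE g g.2; omega)
    rw [hp', map_sum]
    refine Submodule.sum_mem _ fun g _ => ?_
    have hg := hE g g.2
    rw [map_mul]
    have := formValues_mul_mem_of_large (p := d - q g) (N := N g) (q := q g) (by omega)
      (mem_formValues.2 ⟨_, homogeneousComponent_isHomogeneous _ (c g), rfl⟩) (hN g (htG g.2))
    convert this using 2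
    omega
  refine ⟨E + e, fun f hf => ?_⟩
  -- The hypothesis at `i₀` places `f` in some degree; `key` then lowers that degree one step at a
  -- time.
  have hdesc : ∀ n, f ∈ formValues y (E + e + n) → f ∈ formValues y (E + e) := by
    intro n
    induction n with
    | zero => exact id
    | succ n ih =>
      intro hn
      refine ih (key (E + e + (n + 1)) (by omega) f hn fun j => ?_)
      obtain ⟨M, hM⟩ := hf j
      refine ⟨M, formValues_mono h₀ (by omega : 1 + (M + e) ≤ _) ?_⟩
      have := formValues_mul_mem (coord_pow_mem_formValues y j 1) hM
      rwa [← mul_assoc, ← pow_add, add_comm 1 M] at this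
  obtain ⟨M, hM⟩ := hf i₀
  rw [h₀, one_pow, one_mul] at hM
  exact hdesc M (formValues_mono h₀ (by omega) hM)

end HomogeneousValues

end

section

/-! ### Rational independence implies complex independence on complex points -/

section LinearDisjointness

/-- Elements of a finitely generated `ℚ`-domain which are linearly independent over `ℚ` satisfy no
common complex linear relation at all complex points. -/
theorem eq_zero_of_forall_algHom_complex {B : Type*} [CommRing B] [IsDomain B] [Algebra ℚ B]
    [Algebra.FiniteType ℚ B] {r : Type*} [Fintype r] {s : r → B} (hs : LinearIndependent ℚ s)
    {a : r → ℂ} (ha : ∀ σ : B →ₐ[ℚ] ℂ, ∑ i, a i * σ (s i) = 0) : a = 0 := by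
  classical
  -- The `ℚ`-relations among the `a i` form `ker T`. If `T ≠ 0`, a nonzero rational functional `f`
  -- kills this kernel, and the corresponding combination `b` of the `s i` is nonzero.
  let T : (r → ℚ) →ₗ[ℚ] ℂ := Fintype.linearCombination ℚ a
  suffices h : LinearMap.ker T = ⊤ by
    funext i
    have : T (Pi.single i 1) = 0 := by
      rw [← LinearMap.mem_ker, h]; trivial
    simpa [T, Fintype.linearCombination_apply_single] using this
  by_contra hne
  obtain ⟨f, hf0, hf⟩ := Submodule.exists_le_ker_of_lt_top _ (lt_top_iff_ne_top.2 hne)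
  set b : B := ∑ i, f (Pi.single i 1) • s i with hb
  have hb0 : b ≠ 0 := by
    intro h0
    refine hf0 (LinearMap.pi_ext' fun i => LinearMap.ext_ring ?_)
    simpa using Fintype.linearIndependent_iff.1 hs _ h0 i
  have hJ : IsJacobsonRing B := isJacobsonRing_of_finiteType (A := ℚ)
  have hbot : (⊥ : Ideal B).jacobson = ⊥ := by
    rw [← Ideal.radical_eq_jacobson]
    exact (Ideal.isPrime_bot (α := B)).isRadical.radical
  -- The Jacobson property yields a maximal ideal avoiding `b`; its residue field is a number field
  -- by the Nullstellensatz.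
  have : ∃ m : Ideal B, m.IsMaximal ∧ b ∉ m := by
    by_contra! h
    apply hb0
    rw [← Ideal.mem_bot, ← hbot, Ideal.mem_jacobson_bot] 
    have : b ∈ (⊥ : Ideal B).jacobson := by
      rw [Ideal.jacobson, Submodule.mem_sInf]
      exact fun m hm => h m hm.2
    exact Ideal.mem_jacobson_bot.1 this
  obtain ⟨m, hm, hbm⟩ := this
  let K := B ⧸ m
  let _ : Field K := Ideal.Quotient.field m
  have : Algebra.FiniteType ℚ K := inferInstance
  have hfin : Module.Finite ℚ K := finite_of_finite_type_of_isJacobsonRing ℚ K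
  have hcard : Fintype.card (K →ₐ[ℚ] ℂ) = Module.finrank ℚ K := AlgHom.card ℚ K ℂ
  let e : Fin (Module.finrank ℚ K) ≃ (K →ₐ[ℚ] ℂ) := Fintype.equivOfCardEq (by simp [hcard])
  let β : Module.Basis (Fin (Module.finrank ℚ K)) ℚ K := Module.finBasis ℚ K
  -- The square of this determinant is the discriminant of the basis, nonzero in characteristic
  -- zero.
  have hdet : (Algebra.embeddingsMatrixReindex ℚ ℂ β e).det ≠ 0 := by
    intro h0
    have := Algebra.discr_eq_det_embeddingsMatrixReindex_pow_two ℚ ℂ β e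
    rw [h0] at this
    exact Algebra.discr_not_zero_of_basis ℚ β (by simpa using this)
  let π : B →ₐ[ℚ] K := Ideal.Quotient.mkₐ ℚ m
  let c : Fin (Module.finrank ℚ K) → ℂ := fun l => ∑ i, a i * (β.repr (π (s i)) l : ℂ)
  -- The relations for all embeddings of `K` say that `c` is killed by the embeddings matrix. Hence
  -- `c = 0`: the coordinate vectors of the residues lie in `ker T`, so `f` kills them and `π b =
  -- 0`.
  have hc : Matrix.vecMul c (Algebra.embeddingsMatrixReindex ℚ ℂ β e) = 0 := by
    funext j
    have h1 := ha ((e j).comp π)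
    have h2 : ∀ i, e j (π (s i)) = ∑ l, (β.repr (π (s i)) l : ℂ) * e j (β l) := by
      intro i
      conv_lhs => rw [← β.sum_repr (π (s i))]
      rw [map_sum]
      refine Finset.sum_congr rfl fun l _ => ?_
      rw [map_smul, Algebra.smul_def]
      rfl
    simp only [Matrix.vecMul, dotProduct, c, Pi.zero_apply]
    simp only [AlgHom.comp_apply, h2, Finset.mul_sum] at h1
    rw [Finset.sum_comm] at h1
    rw [← h1]
    refine Finset.sum_congr rfl fun l _ => ?_
    rw [Finset.sum_mul]
    refine Finset.sum_congr rfl fun i _ => ?_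
    simp only [Algebra.embeddingsMatrixReindex, Matrix.reindex_apply, Matrix.submatrix_apply,
      Algebra.embeddingsMatrix_apply]
    simp [mul_assoc]
  have hc0 := Matrix.eq_zero_of_vecMul_eq_zero hdet hc
  have hπb : π b = 0 := by
    apply β.ext_elem
    intro l
    have hl : (fun i => β.repr (π (s i)) l) ∈ LinearMap.ker T := by
      rw [LinearMap.mem_ker]
      have := congrFun hc0 l
      simp only [c, Pi.zero_apply] at this
      rw [← this]
      simp only [T, Fintype.linearCombination_apply]
      refine Finset.sum_congr rfl fun i _ => ?_
      rw [Algebra.smul_def, mul_comm]; rfl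
    have h3 : f (fun i => β.repr (π (s i)) l) = 0 := hf hl
    rw [LinearMap.pi_apply_eq_sum_univ] at h3
    have h4 : (fun i => f (Pi.single i (1 : ℚ))) = fun i => f (fun j => if i = j then 1 else 0) := by
      funext i; congr 1; funext j; simp [Pi.single_apply, eq_comm]
    simp only [hb, map_sum, map_smul, Finsupp.coe_finsetSum, Finset.sum_apply, Finsupp.smul_apply,
      map_zero, Finsupp.zero_apply]
    rw [← h3]
    refine Finset.sum_congr rfl fun i _ => ?_
    rw [congrFun h4 i, smul_eq_mul, smul_eq_mul, mul_comm]
  exact hbm (Ideal.Quotient.eq_zero_iff_mem.1 hπb)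

end LinearDisjointness

/-! ### Identity principle on a smooth zero locus -/

section ImplicitFunction

open Filter Topology

/-- On the zero locus of a holomorphic submersion, a holomorphic function which vanishes on an open
subset of the locus vanishes near every point of the closure of that subset at which the map is
submersive. -/
theorem eventually_eq_zero_of_mem_closure {E G : Type*} [NormedAddCommGroup E] [NormedSpace ℂ E]
    [FiniteDimensional ℂ E] [NormedAddCommGroup G] [NormedSpace ℂ G] [FiniteDimensional ℂ G]
    {f : E → G} {a : E} (hf : ContDiffAt ℂ 1 f a) {f' : E →L[ℂ] G} (hf' : HasFDerivAt f f' a)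
    (hsurj : Function.Surjective f') {g : E → ℂ} (hg : Differentiable ℂ g) {O : Set E}
    (hO : IsOpen O) (hgO : ∀ z ∈ O, f z = 0 → g z = 0) (ha : a ∈ closure (O ∩ {z | f z = 0})) :
    ∀ᶠ z in 𝓝 a, f z = 0 → g z = 0 := by
  have : CompleteSpace E := FiniteDimensional.complete ℂ E
  -- A projection onto the kernel of the derivative completes `f` to a local chart `(f, p)`, in
  -- which the zero locus is a linear slice.
  obtain ⟨p, hp⟩ := (LinearMap.ker f'.toLinearMap).subtype.exists_leftInverse_of_injective
    (LinearMap.ker_eq_bot.2 (Submodule.subtype_injective _))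
  have hp' : ∀ v, f' v = 0 → ((p v : LinearMap.ker f'.toLinearMap) : E) = v := fun v hv =>
    congrArg Subtype.val (LinearMap.congr_fun hp ⟨v, hv⟩)
  let Lm : E →ₗ[ℂ] G × LinearMap.ker f'.toLinearMap := f'.toLinearMap.prod p
  have hbij : Function.Bijective Lm := by
    constructor
    · rw [← LinearMap.ker_eq_bot, LinearMap.ker_eq_bot']
      intro v hv
      have h1 : f' v = 0 := congrArg Prod.fst hv
      have h2 : p v = 0 := congrArg Prod.snd hv
      rw [← hp' v h1, h2]; rfl
    · rintro ⟨x, k⟩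
      obtain ⟨v, hv⟩ := hsurj x
      refine ⟨v + (k - p v : LinearMap.ker f'.toLinearMap), Prod.ext ?_ ?_⟩
      · have : f' ((k - p v : LinearMap.ker f'.toLinearMap) : E) = 0 := (k - p v).2
        change f' (v + _) = x
        rw [map_add, this, add_zero, hv]
      · change p (v + _) = k
        rw [map_add]
        have : p ((k - p v : LinearMap.ker f'.toLinearMap) : E) = k - p v :=
          LinearMap.congr_fun hp (k - p v)
        rw [this]; abel
  let Le : E ≃L[ℂ] G × LinearMap.ker f'.toLinearMap :=
    (LinearEquiv.ofBijective Lm hbij).toContinuousLinearEquiv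
  let pc : E →L[ℂ] LinearMap.ker f'.toLinearMap := LinearMap.toContinuousLinearMap p
  let H : E → G × LinearMap.ker f'.toLinearMap := fun z => (f z, pc z)
  have hH : ContDiffAt ℂ 1 H a := hf.prodMk pc.contDiff.contDiffAt
  have hH' : HasFDerivAt H (Le : E →L[ℂ] _) a := by
    have : HasFDerivAt H (f'.prod pc) a := hf'.prodMk pc.hasFDerivAt
    convert this using 1
    ext x <;> rfl
  let Φ := hH.toOpenPartialHomeomorph H hH' one_ne_zero
  have hΦ : ∀ z, Φ z = (f z, pc z) := fun z => rfl
  have haS : a ∈ Φ.source := hH.mem_toOpenPartialHomeomorph_source hH' one_ne_zero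
  have hinv : ContDiffAt ℂ 1 Φ.symm (Φ a) := hH.to_localInverse hH' one_ne_zero
  have hdiff : ∀ᶠ w in 𝓝 (Φ a), DifferentiableAt ℂ Φ.symm w :=
    (hinv.eventually (by simp)).mono fun w hw => hw.differentiableAt one_ne_zero
  obtain ⟨ρ, hρ, hball⟩ := Metric.mem_nhds_iff.1
    (hdiff.and (Φ.open_target.mem_nhds (Φ.map_source haS)))
  have hN : ∀ᶠ z in 𝓝 a, z ∈ Φ.source ∧ Φ z ∈ Metric.ball (Φ a) ρ :=
    Filter.Eventually.and (Φ.open_source.mem_nhds haS)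
      ((Φ.continuousAt haS).preimage_mem_nhds (Metric.ball_mem_nhds _ hρ))
  obtain ⟨z₁, ⟨hz₁S, hz₁B⟩, hz₁O, hz₁f⟩ := mem_closure_iff_nhds.1 ha _ hN
  filter_upwards [hN] with z ⟨hzS, hzB⟩ hzf
  -- The complex line through `Φ z₁` and `Φ z` stays in the slice. Restricting `g` to it reduces the
  -- claim to the identity theorem in one variable, on a convex set containing 0 and 1.
  let ℓ : ℂ → G × LinearMap.ker f'.toLinearMap := fun t => AffineMap.lineMap (Φ z₁) (Φ z) t
  have hℓ : Differentiable ℂ ℓ := by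
    have : ℓ = fun t => t • (Φ z - Φ z₁) + Φ z₁ := by
      funext t; simp [ℓ, AffineMap.lineMap_apply]
    rw [this]; fun_prop
  have hℓ1 : ∀ t, (ℓ t).1 = 0 := by
    intro t
    have h1 : f z₁ = 0 := hz₁f
    simp [ℓ, AffineMap.lineMap_apply, hΦ, h1, hzf]
  let U : Set ℂ := ℓ ⁻¹' Metric.ball (Φ a) ρ
  have hUo : IsOpen U := Metric.isOpen_ball.preimage hℓ.continuous
  have hUc : Convex ℝ U := by
    intro x hx y hy b c hb hc hbc
    have hbc' : (b : ℂ) + c = 1 := by exact_mod_cast hbc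
    have : ℓ (b • x + c • y) = b • ℓ x + c • ℓ y := by
      have h1 : ∀ t, ℓ t = t • (Φ z - Φ z₁) + Φ z₁ := fun t => by
        simp [ℓ, AffineMap.lineMap_apply]
      have h2 : Φ z₁ = b • Φ z₁ + c • Φ z₁ := by rw [← add_smul, hbc, one_smul]
      rw [h1, h1, h1, add_smul, smul_add, smul_add, smul_assoc, smul_assoc,
        add_add_add_comm, ← h2]
    change ℓ _ ∈ Metric.ball (Φ a) ρ
    rw [this]
    exact convex_ball _ _ hx hy hb hc hbc
  have hU0 : (0 : ℂ) ∈ U := by simpa [U, ℓ] using hz₁B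
  have hU1 : (1 : ℂ) ∈ U := by simpa [U, ℓ] using hzB
  have hd : DifferentiableOn ℂ (fun t => g (Φ.symm (ℓ t))) U := fun t ht =>
    (hg.differentiableAt.comp t ((hball ht).1.comp t hℓ.differentiableAt)).differentiableWithinAt
  have hz : (fun t => g (Φ.symm (ℓ t))) =ᶠ[𝓝 0] 0 := by
    have hc : ContinuousAt (fun t => Φ.symm (ℓ t)) 0 :=
      ((hball hU0).1.comp 0 hℓ.differentiableAt).continuousAt
    have h0 : Φ.symm (ℓ 0) = z₁ := by simp [ℓ, Φ.left_inv hz₁S]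
    filter_upwards [hc.preimage_mem_nhds (hO.mem_nhds (by simpa [h0] using hz₁O)),
      hUo.mem_nhds hU0] with t ht htU
    refine hgO _ ht ?_
    have := Φ.right_inv (hball htU).2
    rw [hΦ] at this
    exact (congrArg Prod.fst this).trans (hℓ1 t)
  have := (hd.analyticOnNhd hUo).eqOn_zero_of_preconnected_of_eventuallyEq_zero
    hUc.isPreconnected hU0 hz hU1
  simpa [ℓ, Φ.left_inv hzS] using this

end ImplicitFunction

end

/-! ### Jensen's inequality for the logarithm of a holomorphic function -/

section

section Jensen

open Filter Topology Real Metric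

/-- The sub-mean value inequality for `log |g|`, `g` holomorphic, against continuous majorants. -/
theorem log_enorm_le_circleAverage {g : ℂ → ℂ} {D : Set ℂ} (hD : IsOpen D)
    (hDb : closedBall 0 1 ⊆ D) (hg : DifferentiableOn ℂ g D) {h : ℂ → ℝ} (hh : Continuous h)
    (hgh : ∀ z ∈ sphere (0 : ℂ) 1, ENNReal.log ‖g z‖ₑ ≤ (h z : EReal)) :
    ENNReal.log ‖g 0‖ₑ ≤ ((circleAverage h 0 1 : ℝ) : EReal) := by
  have hlog : ∀ w : ℂ, w ≠ 0 → ENNReal.log ‖w‖ₑ = ((Real.log ‖w‖ : ℝ) : EReal) := by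
    intro w hw
    rw [ENNReal.log_pos_real (by simpa using hw) (by simp)]
    simp
  by_cases h0 : g 0 = 0
  · simp [h0]
  rw [hlog _ h0, EReal.coe_le_coe_iff]
  have han : AnalyticOnNhd ℂ g (closedBall 0 |1|) := by
    rw [abs_one]; exact (hg.analyticOnNhd hD).mono hDb
  have hJ := han.circleAverage_log_norm one_ne_zero h0
  -- The correction term of Jensen's formula: zeros in the unit disc have nonnegative multiplicity
  -- and `log (1/|u|) ≥ 0`. The convention `log 0 = 0` settles `u = 0`.
  have hnn : 0 ≤ ∑ᶠ u, MeromorphicOn.divisor g (closedBall 0 |1|) u * Real.log (1 * ‖0 - u‖⁻¹) := by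
    refine finsum_nonneg fun u => ?_
    by_cases hu : u ∈ closedBall (0 : ℂ) |1|
    · refine mul_nonneg (by exact_mod_cast MeromorphicOn.AnalyticOnNhd.divisor_nonneg han u) ?_
      rw [one_mul, zero_sub, norm_neg]
      rw [abs_one, mem_closedBall_zero_iff] at hu
      by_cases hu0 : u = 0
      · simp [hu0]
      · exact Real.log_nonneg (one_le_inv₀ (norm_pos_iff.2 hu0) |>.2 hu)
    · rw [Function.locallyFinsuppWithin.apply_eq_zero_of_notMem _ hu]; simp
  -- Real `log 0` is 0 instead of `-∞`, so `log ‖g‖` need not lie below `h` at zeros on the circle.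
  -- Changing it to `h` there affects a discrete set only and leaves the average alone.
  let l : ℂ → ℝ := fun z => if g z = 0 then h z else Real.log ‖g z‖
  have hcod : l =ᶠ[codiscreteWithin (sphere 0 |1|)] (Real.log ‖g ·‖) := by
    have := han.preimage_zero_mem_codiscreteWithin h0 (by simp)
      (isConnected_closedBall (by simp))
    filter_upwards [codiscreteWithin_mono sphere_subset_closedBall this] with z hz
    have : g z ≠ 0 := hz
    simp [l, this]
  have hl : circleAverage l 0 1 = circleAverage (Real.log ‖g ·‖) 0 1 :=
    circleAverage_congr_codiscreteWithin hcod one_ne_zero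
  have hmer : MeromorphicOn g (sphere 0 |1|) :=
    fun z hz => (han z (sphere_subset_closedBall hz)).meromorphicAt
  have hint : CircleIntegrable (Real.log ‖g ·‖) 0 1 := hmer.circleIntegrable_log_norm
  have hlint : CircleIntegrable l 0 1 := hint.congr_codiscreteWithin hcod.symm
  have hle : circleAverage l 0 1 ≤ circleAverage h 0 1 := by
    refine circleAverage_mono hlint hh.continuousOn.circleIntegrable' fun z hz => ?_
    by_cases hz0 : g z = 0
    · simp [l, hz0]
    · rw [abs_one] at hz
      have := hgh z hz
      rw [hlog _ hz0, EReal.coe_le_coe_iff] at this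
      simpa [l, hz0] using this
  linarith

end Jensen

end

/-! ### Differentiating Gaussian sums under exponential deformation -/

section

section GaussianFamilies

open Filter Topology Real

lemma measurable_tsum_of_summable {α H : Type*} [MeasurableSpace α] [Countable H] {f : H → α → ℝ}
    (hf : ∀ s, Measurable (f s)) (hs : ∀ a, Summable fun s => f s a) :
    Measurable fun a => ∑' s, f s a := by
  refine measurable_of_tendsto_metrizable' (f := fun (S : Finset H) a => ∑ s ∈ S, f s a) atTop
    (fun S => Finset.measurable_sum _ fun s _ => hf s) ?_
  exact tendsto_pi_nhds.2 fun a => (hs a).hasSum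

/-- A countable family of squared norms `p s`, on a probability space, together with a weight `u`
by which they are going to be deformed exponentially, all of whose Gaussian sums converge. -/
structure GaussianFamily {Ω H : Type*} [MeasurableSpace Ω] (μ : Measure Ω) (p : H → Ω → ℝ)
    (u : Ω → ℝ) (M : H → ℝ) (C : ℝ) : Prop where
  nonneg : ∀ s x, 0 ≤ p s x
  measurable : ∀ s, Measurable (p s)
  le_bound : ∀ s x, p s x ≤ M s
  measurable_weight : Measurable u
  weight_le : ∀ x, |u x| ≤ C
  bound_nonneg : ∀ s, 0 ≤ M s
  weight_bound_nonneg : 0 ≤ C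
  exists_zero : ∃ s, p s = 0
  summable : ∀ c > 0, Summable fun s => (1 + M s) * exp (-(c * ∫ x, p s x ∂μ))

namespace GaussianFamily

variable {Ω H : Type*}

/-- The deformed squared norms. -/
def deform (p : H → Ω → ℝ) (u : Ω → ℝ) (κ t : ℝ) (s : H) (x : Ω) : ℝ :=
  p s x * exp (-(κ * t * u x))

variable [MeasurableSpace Ω]

/-- The Gaussian weights of the deformed `L²`-norms. -/
def gauss (μ : Measure Ω) (p : H → Ω → ℝ) (u : Ω → ℝ) (κ t : ℝ) (s : H) : ℝ :=
  exp (-π * ∫ x, deform p u κ t s x ∂μ)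

/-- The theta function of the deformed `L²`-norms. -/
def theta (μ : Measure Ω) (p : H → Ω → ℝ) (u : Ω → ℝ) (κ t : ℝ) (x : Ω) : ℝ :=
  2 * π * ∑' s, deform p u κ t s x * (gauss μ p u κ t s / ∑' s', gauss μ p u κ t s')

variable {μ : Measure Ω} [IsProbabilityMeasure μ] {p : H → Ω → ℝ} {u : Ω → ℝ} {M : H → ℝ} {C : ℝ}
  (h : GaussianFamily μ p u M C) (κ : ℝ)

include h

lemma deform_nonneg (t : ℝ) (s : H) (x : Ω) : 0 ≤ deform p u κ t s x :=
  mul_nonneg (h.nonneg s x) (exp_pos _).le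

lemma measurable_deform (s : H) : Measurable fun z : ℝ × Ω => deform p u κ z.1 s z.2 := by
  have := h.measurable s
  have := h.measurable_weight
  unfold deform
  fun_prop

lemma measurable_deform_right (t : ℝ) (s : H) : Measurable (deform p u κ t s) :=
  (h.measurable_deform κ s).comp measurable_prodMk_left

lemma abs_exponent_le {R t : ℝ} (ht : |t| ≤ R) (x : Ω) : |κ * t * u x| ≤ |κ| * R * C := by
  rw [abs_mul, abs_mul]
  have := h.weight_le x
  have : 0 ≤ R := (abs_nonneg t).trans ht
  gcongr

lemma deform_le {R t : ℝ} (ht : |t| ≤ R) (s : H) (x : Ω) :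
    deform p u κ t s x ≤ M s * exp (|κ| * R * C) := by
  have := h.abs_exponent_le κ ht x
  exact mul_le_mul (h.le_bound s x) (exp_le_exp.2 (by linarith [neg_abs_le (κ * t * u x)]))
    (exp_pos _).le (h.bound_nonneg s)

lemma integrable_deform (t : ℝ) (s : H) : Integrable (deform p u κ t s) μ := by
  refine Integrable.of_bound (h.measurable_deform_right κ t s).aestronglyMeasurable
    (M s * exp (|κ| * |t| * C)) (ae_of_all _ fun x => ?_)
  rw [norm_eq_abs, abs_of_nonneg (h.deform_nonneg κ t s x)]
  exact h.deform_le κ le_rfl s x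

lemma integrable_weight_mul_deform (t : ℝ) (s : H) :
    Integrable (fun x => u x * deform p u κ t s x) μ :=
  (h.integrable_deform κ t s).bdd_mul h.measurable_weight.aestronglyMeasurable
    (ae_of_all _ fun x => by simpa using h.weight_le x)

lemma abs_weight_mul_deform_le {R t : ℝ} (ht : |t| ≤ R) (s : H) (x : Ω) :
    |u x * deform p u κ t s x| ≤ C * (M s * exp (|κ| * R * C)) := by
  rw [abs_mul, abs_of_nonneg (h.deform_nonneg κ t s x)]
  exact mul_le_mul (h.weight_le x) (h.deform_le κ ht s x) (h.deform_nonneg κ t s x)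
    h.weight_bound_nonneg

lemma abs_integral_weight_mul_deform_le {R t : ℝ} (ht : |t| ≤ R) (s : H) :
    |∫ x, u x * deform p u κ t s x ∂μ| ≤ C * (M s * exp (|κ| * R * C)) := by
  have := norm_integral_le_of_norm_le_const (μ := μ) (f := fun x => u x * deform p u κ t s x)
    (C := C * (M s * exp (|κ| * R * C))) (ae_of_all _ fun x => h.abs_weight_mul_deform_le κ ht s x)
  simpa using this

lemma integrable_base (s : H) : Integrable (p s) μ := by
  have := h.integrable_deform 0 0 s
  unfold deform at this
  simpa using this

/-- The factor `exp (-(κ t u))` is bounded below uniformly in `x` and `|t| ≤ R`. A deformation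
therefore only changes the constant in the Gaussian exponent, which is why summability is assumed
for every positive constant. -/
lemma integral_deform_ge {R t : ℝ} (ht : |t| ≤ R) (s : H) :
    exp (-(|κ| * R * C)) * ∫ x, p s x ∂μ ≤ ∫ x, deform p u κ t s x ∂μ := by
  rw [← integral_const_mul]
  refine integral_mono ((h.integrable_base s).const_mul _) (h.integrable_deform κ t s) fun x => ?_
  have := h.abs_exponent_le κ ht x
  simp only [deform]
  rw [mul_comm]
  exact mul_le_mul_of_nonneg_left
    (exp_le_exp.2 (by linarith [le_abs_self (κ * t * u x)])) (h.nonneg s x)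

/-- A summable majorant of the Gaussian weights. -/
lemma gauss_le {R t : ℝ} (ht : |t| ≤ R) (s : H) :
    gauss μ p u κ t s ≤ exp (-(π * exp (-(|κ| * R * C)) * ∫ x, p s x ∂μ)) := by
  refine exp_le_exp.2 ?_
  have := mul_le_mul_of_nonneg_left (h.integral_deform_ge κ ht s) pi_pos.le
  linarith

lemma summable_majorant (R : ℝ) : Summable fun s =>
    (1 + M s) * exp (-(π * exp (-(|κ| * R * C)) * ∫ x, p s x ∂μ)) :=
  h.summable _ (mul_pos pi_pos (exp_pos _))

omit h in
omit [IsProbabilityMeasure μ] in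
lemma gauss_pos (t : ℝ) (s : H) : 0 < gauss μ p u κ t s := exp_pos _

lemma mul_gauss_le {R t : ℝ} (ht : |t| ≤ R) (s : H) : (1 + M s) * gauss μ p u κ t s ≤
    (1 + M s) * exp (-(π * exp (-(|κ| * R * C)) * ∫ x, p s x ∂μ)) :=
  mul_le_mul_of_nonneg_left (h.gauss_le κ ht s) (by linarith [h.bound_nonneg s])

lemma summable_mul_gauss (t : ℝ) : Summable fun s => (1 + M s) * gauss μ p u κ t s :=
  .of_nonneg_of_le (fun s => mul_nonneg (by linarith [h.bound_nonneg s]) (gauss_pos κ t s).le)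
    (fun s => h.mul_gauss_le κ le_rfl s) (h.summable_majorant κ |t|)

lemma summable_gauss (t : ℝ) : Summable (gauss μ p u κ t) :=
  .of_nonneg_of_le (fun s => (gauss_pos κ t s).le)
    (fun s => le_mul_of_one_le_left (gauss_pos κ t s).le (by linarith [h.bound_nonneg s]))
    (h.summable_mul_gauss κ t)

/-- The zero element contributes 1. This allows dividing by the sum, taking its logarithm and
dropping it from denominators in upper bounds. -/
lemma one_le_tsum_gauss (t : ℝ) : 1 ≤ ∑' s, gauss μ p u κ t s := by
  obtain ⟨s, hs⟩ := h.exists_zero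
  have : gauss μ p u κ t s = 1 := by simp [gauss, deform, hs]
  rw [← this]
  exact (h.summable_gauss κ t).le_tsum s fun s' _ => (gauss_pos κ t s').le

lemma deform_mul_gauss_le {R t : ℝ} (ht : |t| ≤ R) (s : H) (x : Ω) :
    deform p u κ t s x * gauss μ p u κ t s ≤ exp (|κ| * R * C) *
      ((1 + M s) * exp (-(π * exp (-(|κ| * R * C)) * ∫ x, p s x ∂μ))) := by
  calc deform p u κ t s x * gauss μ p u κ t s
      ≤ (M s * exp (|κ| * R * C)) * exp (-(π * exp (-(|κ| * R * C)) * ∫ x, p s x ∂μ)) :=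
        mul_le_mul (h.deform_le κ ht s x) (h.gauss_le κ ht s) (gauss_pos κ t s).le
          (mul_nonneg (h.bound_nonneg s) (exp_pos _).le)
    _ ≤ _ := by
        rw [mul_comm (M s), mul_assoc]
        gcongr
        linarith

lemma summable_deform_mul_gauss (t : ℝ) (x : Ω) :
    Summable fun s => deform p u κ t s x * gauss μ p u κ t s :=
  .of_nonneg_of_le (fun s => mul_nonneg (h.deform_nonneg κ t s x) (gauss_pos κ t s).le)
    (fun s => h.deform_mul_gauss_le κ le_rfl s x) ((h.summable_majorant κ |t|).mul_left _)

lemma hasDerivAt_integral_deform (t : ℝ) (s : H) :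
    HasDerivAt (fun t => ∫ x, deform p u κ t s x ∂μ)
      (-(κ * ∫ x, u x * deform p u κ t s x ∂μ)) t := by
  -- On the unit ball around `t` one radius `R = |t| + 1` serves for all the bounds.
  have hball : ∀ t' ∈ Metric.ball t 1, |t'| ≤ |t| + 1 := fun t' ht' => by
    rw [Metric.mem_ball, dist_eq] at ht'
    have := abs_sub_abs_le_abs_sub t' t
    linarith
  have := (hasDerivAt_integral_of_dominated_loc_of_deriv_le (μ := μ)
    (F := fun t x => deform p u κ t s x) (F' := fun t x => -κ * (u x * deform p u κ t s x))
    (bound := fun _ => |κ| * (C * (M s * exp (|κ| * (|t| + 1) * C)))) (x₀ := t)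
    (Metric.ball_mem_nhds t one_pos)
    (Eventually.of_forall fun t => (h.measurable_deform_right κ t s).aestronglyMeasurable)
    (h.integrable_deform κ t s)
    ((h.integrable_weight_mul_deform κ t s).const_mul _).aestronglyMeasurable
    (ae_of_all _ fun x t' ht' => ?_) (integrable_const _) (ae_of_all _ fun x t' _ => ?_)).2
  · rwa [integral_const_mul, neg_mul] at this
  · rw [norm_mul, norm_neg, norm_eq_abs, norm_eq_abs]
    exact mul_le_mul_of_nonneg_left (h.abs_weight_mul_deform_le κ (hball t' ht') s x)
      (abs_nonneg _)
  · have h1 : HasDerivAt (fun t => -(κ * t * u x)) (-(κ * u x)) t' := by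
      have := (((hasDerivAt_id' t').const_mul κ).mul_const (u x)).fun_neg
      rwa [mul_one] at this
    have := (h1.exp).const_mul (p s x)
    have e : -κ * (u x * deform p u κ t' s x) =
        p s x * (exp (-(κ * t' * u x)) * -(κ * u x)) := by unfold deform; ring
    rw [e]
    exact this

lemma continuous_gauss (s : H) : Continuous fun t => gauss μ p u κ t s := by
  have : Continuous fun t => ∫ x, deform p u κ t s x ∂μ :=
    continuous_iff_continuousAt.2 fun t => (h.hasDerivAt_integral_deform κ t s).continuousAt
  unfold gauss
  fun_prop

/-- Termwise differentiation near `t`. The derivative costs a factor bounded by a multiple of `M s`,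
which the factor `1 + M s` of the summable majorant absorbs. -/
lemma hasDerivAt_tsum_gauss (t : ℝ) :
    HasDerivAt (fun t => ∑' s, gauss μ p u κ t s)
      (∑' s, gauss μ p u κ t s * (π * κ * ∫ x, u x * deform p u κ t s x ∂μ)) t := by
  have hball : ∀ t' ∈ Metric.ball t 1, |t'| ≤ |t| + 1 := fun t' ht' => by
    rw [Metric.mem_ball, dist_eq] at ht'
    have := abs_sub_abs_le_abs_sub t' t
    linarith
  refine hasDerivAt_tsum_of_isPreconnected (𝕜 := ℝ) (F := ℝ) (g := fun s t => gauss μ p u κ t s)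
    (g' := fun s t => gauss μ p u κ t s * (π * κ * ∫ x, u x * deform p u κ t s x ∂μ))
    (((h.summable_majorant κ (|t| + 1)).mul_left (π * |κ| * C * exp (|κ| * (|t| + 1) * C))))
    Metric.isOpen_ball (convex_ball t 1).isPreconnected (fun s t' _ => ?_) (fun s t' ht' => ?_)
    (Metric.mem_ball_self one_pos) (h.summable_gauss κ t) (Metric.mem_ball_self one_pos)
  · have := ((h.hasDerivAt_integral_deform κ t' s).const_mul (-π)).exp
    have e : gauss μ p u κ t' s * (π * κ * ∫ x, u x * deform p u κ t' s x ∂μ) =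
        exp (-π * ∫ x, deform p u κ t' s x ∂μ) *
          (-π * -(κ * ∫ x, u x * deform p u κ t' s x ∂μ)) := by unfold gauss; ring
    rw [e]
    exact this
  · have h1 := h.abs_integral_weight_mul_deform_le κ (hball t' ht') s
    have h2 := h.gauss_le κ (hball t' ht') s
    rw [norm_mul, norm_mul, norm_mul, norm_eq_abs, norm_eq_abs, norm_eq_abs, norm_eq_abs,
      abs_of_pos (gauss_pos κ t' s), abs_of_pos pi_pos]
    calc gauss μ p u κ t' s * (π * |κ| * |∫ x, u x * deform p u κ t' s x ∂μ|)
        ≤ exp (-(π * exp (-(|κ| * (|t| + 1) * C)) * ∫ x, p s x ∂μ)) *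
          (π * |κ| * (C * ((1 + M s) * exp (|κ| * (|t| + 1) * C)))) := by
          refine mul_le_mul h2 (mul_le_mul_of_nonneg_left (h1.trans ?_) (by positivity))
            (by positivity) (exp_pos _).le
          have := h.weight_bound_nonneg
          gcongr
          linarith
      _ = _ := by ring

lemma continuous_tsum_gauss : Continuous fun t => ∑' s, gauss μ p u κ t s :=
  continuous_iff_continuousAt.2 fun t => (h.hasDerivAt_tsum_gauss κ t).continuousAt

lemma theta_eq (t : ℝ) (x : Ω) : theta μ p u κ t x =
    2 * π * ((∑' s, deform p u κ t s x * gauss μ p u κ t s) / ∑' s, gauss μ p u κ t s) := by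
  rw [theta, ← tsum_div_const]
  simp only [mul_div_assoc]

lemma continuous_theta (x : Ω) : Continuous fun t => theta μ p u κ t x := by
  have h1 : Continuous fun t => ∑' s, deform p u κ t s x * gauss μ p u κ t s := by
    refine continuous_iff_continuousAt.2 fun t => ?_
    refine (continuousOn_tsum (s := Metric.ball t 1) (fun s => ?_)
      ((h.summable_majorant κ (|t| + 1)).mul_left (exp (|κ| * (|t| + 1) * C)))
      fun s t' ht' => ?_).continuousAt (Metric.ball_mem_nhds t one_pos)
    · have := h.continuous_gauss κ s
      unfold deform
      fun_prop
    · rw [Metric.mem_ball, dist_eq] at ht'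
      have := abs_sub_abs_le_abs_sub t' t
      rw [norm_eq_abs, abs_of_nonneg (mul_nonneg (h.deform_nonneg κ t' s x) (gauss_pos κ t' s).le)]
      exact h.deform_mul_gauss_le κ (by linarith) s x
  simp only [h.theta_eq κ]
  exact (h1.div (h.continuous_tsum_gauss κ) fun t =>
    (zero_lt_one.trans_le (h.one_le_tsum_gauss κ t)).ne').const_mul _

lemma measurable_theta [Countable H] : Measurable fun z : ℝ × Ω => theta μ p u κ z.1 z.2 := by
  simp only [h.theta_eq κ]
  have h1 : Measurable fun z : ℝ × Ω => ∑' s, deform p u κ z.1 s z.2 * gauss μ p u κ z.1 s :=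
    measurable_tsum_of_summable
      (fun s => (h.measurable_deform κ s).mul
        ((h.continuous_gauss κ s).measurable.comp measurable_fst))
      fun z => h.summable_deform_mul_gauss κ z.1 z.2
  have h2 : Measurable fun z : ℝ × Ω => ∑' s, gauss μ p u κ z.1 s :=
    (h.continuous_tsum_gauss κ).measurable.comp measurable_fst
  exact (h1.div h2).const_mul _

/-- The denominator is at least 1, and the numerator has a summable majorant independent of `x` and
of `|t| ≤ R`. -/
lemma exists_abs_theta_le (R : ℝ) : ∃ B, ∀ t, |t| ≤ R → ∀ x, |theta μ p u κ t x| ≤ B := by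
  refine ⟨2 * π * ∑' s, exp (|κ| * R * C) *
    ((1 + M s) * exp (-(π * exp (-(|κ| * R * C)) * ∫ x, p s x ∂μ))), fun t ht x => ?_⟩
  have hZ := h.one_le_tsum_gauss κ t
  have h0 : 0 ≤ ∑' s, deform p u κ t s x * gauss μ p u κ t s :=
    tsum_nonneg fun s => mul_nonneg (h.deform_nonneg κ t s x) (gauss_pos κ t s).le
  rw [h.theta_eq κ, abs_mul, abs_of_pos (by positivity), abs_of_nonneg (by positivity)]
  refine mul_le_mul_of_nonneg_left ?_ (by positivity)
  exact (div_le_self h0 hZ).trans ((h.summable_deform_mul_gauss κ t x).tsum_le_tsum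
    (fun s => h.deform_mul_gauss_le κ ht s x) ((h.summable_majorant κ R).mul_left _))

/-- Sum and integral may be exchanged because the `L¹`-norms of the terms are dominated by `(1 + M
s) * gauss`, which is summable. -/
lemma integral_weight_mul_theta [Countable H] (t : ℝ) : ∫ x, u x * theta μ p u κ t x ∂μ =
    2 * π * ((∑' s, gauss μ p u κ t s * ∫ x, u x * deform p u κ t s x ∂μ) /
      ∑' s, gauss μ p u κ t s) := by
  have h1 : ∀ x, u x * theta μ p u κ t x = 2 * π / (∑' s, gauss μ p u κ t s) *
      ∑' s, gauss μ p u κ t s * (u x * deform p u κ t s x) := by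
    intro x
    rw [h.theta_eq κ]
    have : ∀ s, gauss μ p u κ t s * (u x * deform p u κ t s x) =
      u x * (deform p u κ t s x * gauss μ p u κ t s) := fun s => by ring
    simp only [this, tsum_mul_left]
    ring
  simp only [h1]
  rw [integral_const_mul, ← integral_tsum_of_summable_integral_norm
    (fun s => (h.integrable_weight_mul_deform κ t s).const_mul _)]
  · simp only [integral_const_mul]
    ring
  · have hb : ∀ s, ∫ x, ‖gauss μ p u κ t s * (u x * deform p u κ t s x)‖ ∂μ ≤
        C * exp (|κ| * |t| * C) * ((1 + M s) * gauss μ p u κ t s) := by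
      intro s
      have hg := gauss_pos (μ := μ) (p := p) (u := u) κ t s
      have hM := h.bound_nonneg s
      have hC := h.weight_bound_nonneg
      have : ∀ x, ‖gauss μ p u κ t s * (u x * deform p u κ t s x)‖ ≤
          C * exp (|κ| * |t| * C) * ((1 + M s) * gauss μ p u κ t s) := by
        intro x
        rw [norm_mul, norm_eq_abs, norm_eq_abs, abs_of_pos hg]
        calc gauss μ p u κ t s * |u x * deform p u κ t s x|
            ≤ gauss μ p u κ t s * (C * ((1 + M s) * exp (|κ| * |t| * C))) := by
              refine mul_le_mul_of_nonneg_left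
                ((h.abs_weight_mul_deform_le κ le_rfl s x).trans ?_) hg.le
              gcongr
              linarith
          _ = _ := by ring
      refine (integral_mono ((h.integrable_weight_mul_deform κ t s).const_mul _).norm
        (integrable_const _) this).trans ?_
      simp
    exact .of_nonneg_of_le (fun s => integral_nonneg fun x => norm_nonneg _) hb
      ((h.summable_mul_gauss κ t).mul_left _)

/-- Each term contributes `π κ ∫ u * deform`, while `theta` is normalized by `2 π`; hence the factor
`κ / 2`. -/
lemma hasDerivAt_log_tsum_gauss [Countable H] (t : ℝ) :
    HasDerivAt (fun t => log (∑' s, gauss μ p u κ t s))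
      (κ / 2 * ∫ x, u x * theta μ p u κ t x ∂μ) t := by
  have hZ := h.one_le_tsum_gauss κ t
  have := (h.hasDerivAt_tsum_gauss κ t).log (by positivity)
  rw [h.integral_weight_mul_theta κ]
  have e : ∀ s, gauss μ p u κ t s * (π * κ * ∫ x, u x * deform p u κ t s x ∂μ) =
    (π * κ) * (gauss μ p u κ t s * ∫ x, u x * deform p u κ t s x ∂μ) := fun s => by ring
  simp only [e, tsum_mul_left] at this
  convert this using 1
  ring

/-- A bounded measurable function on a finite product measure, ready for Fubini. -/
lemma integrable_uncurry [Countable H] : Integrable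
    (Function.uncurry fun t x => u x * theta μ p u κ t x)
    ((volume.restrict (Set.uIoc (0 : ℝ) 1)).prod μ) := by
  obtain ⟨B, hB⟩ := h.exists_abs_theta_le κ 1
  have hm : Measurable (Function.uncurry fun t x => u x * theta μ p u κ t x) :=
    (h.measurable_weight.comp measurable_snd).mul (h.measurable_theta κ)
  have : IsFiniteMeasure (volume.restrict (Set.uIoc (0 : ℝ) 1)) :=
    ⟨by simp⟩
  refine Integrable.of_bound hm.aestronglyMeasurable (C * B) ?_
  have hae : ∀ᵐ t ∂(volume.restrict (Set.uIoc (0 : ℝ) 1)), |t| ≤ 1 := by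
    filter_upwards [ae_restrict_mem measurableSet_uIoc] with t ht
    rw [Set.uIoc_of_le zero_le_one] at ht
    rw [abs_of_pos ht.1]
    exact ht.2
  rw [Measure.ae_prod_iff_ae_ae (measurableSet_le hm.norm measurable_const)]
  filter_upwards [hae] with t ht
  refine ae_of_all _ fun x => ?_
  simp only [Function.uncurry, norm_mul, norm_eq_abs]
  exact mul_le_mul (h.weight_le x) (hB t ht x) (abs_nonneg _) h.weight_bound_nonneg

/-- The derivative of the logarithm of a Gaussian sum along a deformation, integrated. -/
theorem log_tsum_gauss_sub [Countable H] :
    Integrable (fun x => u x * ∫ t in (0 : ℝ)..1, theta μ p u κ t x) μ ∧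
    log (∑' s, gauss μ p u κ 1 s) - log (∑' s, gauss μ p u κ 0 s) =
      κ / 2 * ∫ x, u x * (∫ t in (0 : ℝ)..1, theta μ p u κ t x) ∂μ := by
  have hi := h.integrable_uncurry κ
  have e : ∀ x, u x * (∫ t in (0 : ℝ)..1, theta μ p u κ t x) =
      ∫ t in Set.uIoc (0 : ℝ) 1, u x * theta μ p u κ t x := by
    intro x
    rw [intervalIntegral.intervalIntegral_eq_integral_uIoc, if_pos zero_le_one, one_smul,
      integral_const_mul]
  refine ⟨?_, ?_⟩
  · simp only [e]
    exact hi.integral_prod_right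
  · have hint : IntervalIntegrable (fun t => ∫ x, u x * theta μ p u κ t x ∂μ) volume 0 1 := by
      rw [intervalIntegrable_iff]
      exact hi.integral_prod_left
    have := intervalIntegral.integral_eq_sub_of_hasDerivAt
      (fun t _ => h.hasDerivAt_log_tsum_gauss κ t) (hint.const_mul (κ / 2))
    rw [← this, intervalIntegral.integral_const_mul]
    congr 1
    simp only [e]
    rw [intervalIntegral.intervalIntegral_eq_integral_uIoc, if_pos zero_le_one, one_smul]
    exact integral_integral_swap hi

end GaussianFamily

end GaussianFamilies

end

/-! ### Convergence of Gaussian sums over lattices -/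

section

section LatticeSums

open Real

/-- A finite set of index functions lies in a finite box, on which the sum factors into
one-dimensional sums. -/
lemma summable_prod_of_nonneg {ι α : Type*} [Fintype ι] {g : α → ℝ} (hg : ∀ a, 0 ≤ g a)
    (hs : Summable g) : Summable fun n : ι → α => ∏ i, g (n i) := by
  classical
  refine summable_of_sum_le (c := ∏ _i : ι, ∑' a, g a) (fun n => Finset.prod_nonneg fun i _ => hg _)
    fun S => ?_
  let T : ι → Finset α := fun i => S.image fun n => n i
  have hST : S ⊆ Fintype.piFinset T := fun n hn => by
    rw [Fintype.mem_piFinset]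
    exact fun i => Finset.mem_image_of_mem _ hn
  calc ∑ n ∈ S, ∏ i, g (n i) ≤ ∑ n ∈ Fintype.piFinset T, ∏ i, g (n i) :=
        Finset.sum_le_sum_of_subset_of_nonneg hST fun n _ _ => Finset.prod_nonneg fun i _ => hg _
    _ = ∏ i, ∑ a ∈ T i, g a := (Finset.prod_univ_sum T fun _ a => g a).symm
    _ ≤ _ := Finset.prod_le_prod (fun i _ => Finset.sum_nonneg fun a _ => hg a)
        fun i _ => hs.sum_le_tsum _ fun a _ => hg a

lemma summable_exp_neg_mul_sq_int {c : ℝ} (hc : 0 < c) :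
    Summable fun n : ℤ => exp (-(c * (n : ℝ) ^ 2)) := by
  have hn : Summable fun n : ℕ => exp (-(c * (n : ℝ) ^ 2)) := by
    have hg : Summable fun n : ℕ => exp (-c) ^ n :=
      summable_geometric_of_lt_one (exp_pos _).le (by simpa using hc)
    refine .of_nonneg_of_le (fun n => (exp_pos _).le) (fun n => ?_) hg
    rw [← exp_nat_mul]
    refine exp_le_exp.2 ?_
    have h1 : (n : ℝ) ≤ (n : ℝ) ^ 2 := by exact_mod_cast Nat.le_self_pow two_ne_zero n
    nlinarith
  exact Summable.of_nat_of_neg (by simpa using hn) (by simpa using hn)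

/-- Convergence of Gaussian sums, with polynomial factors, of positive definite forms. -/
theorem summable_gauss_of_pos_def {ι : Type*} [Fintype ι] {Q : (ι → ℝ) → ℝ} (hQ : Continuous Q)
    (hhom : ∀ (t : ℝ) a, Q (t • a) = t ^ 2 * Q a) (hpos : ∀ a, a ≠ 0 → 0 < Q a)
    {A c : ℝ} (hA : 0 ≤ A) (hc : 0 < c) :
    Summable fun n : ι → ℤ => (1 + A * ‖fun i => (n i : ℝ)‖ ^ 2) *
      exp (-(c * Q fun i => (n i : ℝ))) := by
  classical
  rcases isEmpty_or_nonempty ι with hι | hι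
  · exact .of_finite
  -- The minimum of `Q` on the compact unit sphere is positive, and homogeneity gives `m ‖a‖² ≤ Q
  -- a`. Nonemptiness of the sphere is the reason for treating empty `ι` apart.
  obtain ⟨a₀, ha₀, hmin⟩ := (isCompact_sphere (0 : ι → ℝ) 1).exists_isMinOn
    (NormedSpace.sphere_nonempty.2 zero_le_one) hQ.continuousOn
  set m := Q a₀
  have hm : 0 < m := hpos _ (by rintro rfl; simp at ha₀)
  have hQm : ∀ a, m * ‖a‖ ^ 2 ≤ Q a := by
    intro a
    rcases eq_or_ne a 0 with rfl | ha
    · have := hhom 0 0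
      simp at this
      simp [this]
    · have hn : 0 < ‖a‖ := norm_pos_iff.2 ha
      have h1 : m ≤ Q (‖a‖⁻¹ • a) := hmin (by simp [norm_smul, hn.ne'])
      rw [hhom, inv_pow, ← div_eq_inv_mul, le_div_iff₀ (by positivity)] at h1
      exact h1
  have hsq : ∀ a : ι → ℝ, ∑ i, a i ^ 2 ≤ Fintype.card ι * ‖a‖ ^ 2 := by
    intro a
    calc ∑ i, a i ^ 2 ≤ ∑ _i : ι, ‖a‖ ^ 2 := Finset.sum_le_sum fun i _ => by
          rw [← sq_abs]
          exact pow_le_pow_left₀ (abs_nonneg _) (norm_le_pi_norm a i) 2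
      _ = _ := by simp
  set d : ℝ := c * m with hd
  have hd0 : 0 < d := mul_pos hc hm
  have hcard : (0 : ℝ) < Fintype.card ι := by exact_mod_cast Fintype.card_pos
  -- Half of the decay rate `d` absorbs the polynomial factor. The other half bounds a product of
  -- one-dimensional Gaussians; dividing by `card ι` compares the sup norm with the sum of squares.
  have hprod := summable_prod_of_nonneg (ι := ι) (fun n => (exp_pos _).le)
    (summable_exp_neg_mul_sq_int (c := d / 2 / Fintype.card ι) (by positivity))
  refine .of_nonneg_of_le (fun n => by positivity) (fun n => ?_) (hprod.mul_left (1 + 2 * A / d))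
  rw [← exp_sum]
  set a : ι → ℝ := fun i => (n i : ℝ)
  have hy : 0 ≤ ‖a‖ ^ 2 := by positivity
  set y := ‖a‖ ^ 2
  have h1 : 1 + A * y ≤ (1 + 2 * A / d) * exp (d / 2 * y) := by
    have h2 := add_one_le_exp (d / 2 * y)
    have h3 : 1 + A * y ≤ (1 + 2 * A / d) * (d / 2 * y + 1) := by
      have : (1 + 2 * A / d) * (d / 2 * y + 1) = 1 + A * y + d / 2 * y + 2 * A / d := by
        field_simp; ring
      rw [this]
      have : 0 ≤ d / 2 * y := by positivity
      have : 0 ≤ 2 * A / d := by positivity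
      linarith
    exact h3.trans (mul_le_mul_of_nonneg_left h2 (by positivity))
  have h2 : exp (-(c * Q a)) ≤ exp (-(d * y)) := by
    refine exp_le_exp.2 ?_
    have := mul_le_mul_of_nonneg_left (hQm a) hc.le
    rw [hd]
    linarith
  calc (1 + A * y) * exp (-(c * Q a))
      ≤ ((1 + 2 * A / d) * exp (d / 2 * y)) * exp (-(d * y)) :=
        mul_le_mul h1 h2 (exp_pos _).le (by positivity)
    _ = (1 + 2 * A / d) * exp (-(d / 2 * y)) := by
        rw [mul_assoc, ← exp_add]; congr 2; ring
    _ ≤ _ := by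
        refine mul_le_mul_of_nonneg_left (exp_le_exp.2 ?_) (by positivity)
        rw [Finset.sum_neg_distrib, ← Finset.mul_sum, neg_le_neg_iff]
        have := mul_le_mul_of_nonneg_left (hsq a)
          (show 0 ≤ d / 2 / Fintype.card ι by positivity)
        refine this.trans_eq ?_
        field_simp
        rfl

end LatticeSums

end

/-! ### Complex points in affine charts -/

section

namespace ComplexPoints

open Filter Topology

variable {X : Scheme.{0}}

lemma value_of_mem {U : X.Opens} (f : Γ(X, U)) {x : ComplexPoints X} (h : x.pt ∈ U) :
    value f x = x.ev (X.presheaf.germ U x.pt h f) := dif_pos h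

/-- Evaluation of regular functions on `U` at a complex point of `U`. -/
def evalAt {U : X.Opens} {x : ComplexPoints X} (h : x.pt ∈ U) : Γ(X, U) →+* ℂ :=
  x.ev.comp (X.presheaf.germ U x.pt h).hom

lemma evalAt_apply {U : X.Opens} {x : ComplexPoints X} (h : x.pt ∈ U) (f : Γ(X, U)) :
    evalAt h f = value f x := (value_of_mem f h).symm

lemma value_res {U V : X.Opens} (hVU : V ≤ U) (f : Γ(X, U)) {x : ComplexPoints X}
    (hx : x.pt ∈ V) : value (X.presheaf.map (homOfLE hVU).op f) x = value f x := by
  rw [value_of_mem _ hx, value_of_mem _ (hVU hx), TopCat.Presheaf.germ_res_apply]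

lemma value_add {U : X.Opens} (f g : Γ(X, U)) {x : ComplexPoints X} (hx : x.pt ∈ U) :
    value (f + g) x = value f x + value g x := by
  simp only [← evalAt_apply hx, map_add]

lemma value_mul {U : X.Opens} (f g : Γ(X, U)) {x : ComplexPoints X} (hx : x.pt ∈ U) :
    value (f * g) x = value f x * value g x := by
  simp only [← evalAt_apply hx, map_mul]

/-- Evaluation at a complex point is a local homomorphism, so a germ is a unit exactly when its
value is nonzero. -/
lemma pt_mem_basicOpen {U : X.Opens} (f : Γ(X, U)) {x : ComplexPoints X} :
    x.pt ∈ X.basicOpen f ↔ x.pt ∈ U ∧ value f x ≠ 0 := by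
  constructor
  · intro h
    have hU := X.basicOpen_le f h
    refine ⟨hU, ?_⟩
    rw [value_of_mem f hU]
    exact ((X.mem_basicOpen f _ hU).1 h).map x.ev |>.ne_zero
  · rintro ⟨hU, h⟩
    rw [X.mem_basicOpen f _ hU]
    rw [value_of_mem f hU] at h
    have : IsLocalHom x.ev := Scheme.isLocalHom_stalkClosedPointTo' (R := ℂ) _
    exact isUnit_of_map_unit x.ev _ (isUnit_iff_ne_zero.2 h)

/-- The complex point of an affine open defined by a ring homomorphism. -/
def ofHom {V : X.Opens} (hV : IsAffineOpen V) (χ : Γ(X, V) →+* ℂ) : ComplexPoints X :=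
  (Spec.map (CommRingCat.ofHom χ) ≫ hV.fromSpec : Spec (.of ℂ) ⟶ X)

lemma pt_ofHom_mem {V : X.Opens} (hV : IsAffineOpen V) (χ : Γ(X, V) →+* ℂ) :
    (ofHom hV χ).pt ∈ V := by
  have : (ofHom hV χ).pt ∈ (Set.range hV.fromSpec) := ⟨_, rfl⟩
  rwa [hV.range_fromSpec] at this

/-- Together with `pt_ofHom_mem`, this makes every character of an affine coordinate ring a complex
point with prescribed values. -/
lemma value_ofHom {V : X.Opens} (hV : IsAffineOpen V) (χ : Γ(X, V) →+* ℂ) (f : Γ(X, V)) :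
    value f (ofHom hV χ) = χ f := by
  rw [value_of_mem f (pt_ofHom_mem hV χ)]
  let φ : Γ(X, V) ⟶ CommRingCat.of ℂ := CommRingCat.ofHom χ
  have hmem : hV.fromSpec (Spec.map φ (IsLocalRing.closedPoint ℂ)) ∈ V := pt_ofHom_mem hV χ
  have h1 : ∀ (q : Spec Γ(X, V)) (hq : hV.fromSpec q ∈ V),
      X.presheaf.germ V _ hq ≫ hV.fromSpec.stalkMap q =
      (Scheme.ΓSpecIso Γ(X, V)).inv ≫ (Spec Γ(X, V)).presheaf.germ ⊤ q trivial := by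
    intro q hq
    rw [Scheme.Hom.germ_stalkMap, hV.fromSpec_app_self, Category.assoc]
    congr 1
    exact TopCat.Presheaf.germ_res _ _ _ _
  have h2 : X.presheaf.germ V _ hmem ≫ Scheme.stalkClosedPointTo (Spec.map φ ≫ hV.fromSpec) = φ := by
    rw [Scheme.stalkClosedPointTo_comp]
    refine (Category.assoc _ _ _).symm.trans ?_
    refine (congrArg (· ≫ Scheme.stalkClosedPointTo (Spec.map φ)) (h1 _ hmem)).trans ?_
    refine (Category.assoc _ _ _).trans ?_
    rw [Scheme.germ_stalkClosedPointTo_Spec, Iso.inv_hom_id_assoc]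
  exact congrArg (fun e => CommRingCat.Hom.hom e f) h2

lemma isOpen_setOf_pt_mem (U : X.Opens) : IsOpen {x : ComplexPoints X | x.pt ∈ U} := by
  refine TopologicalSpace.isOpen_generateFrom_of_mem ⟨U, 0, Set.univ, isOpen_univ, ?_⟩
  simp

lemma continuousOn_value {U : X.Opens} (f : Γ(X, U)) :
    ContinuousOn (value f) {x : ComplexPoints X | x.pt ∈ U} := by
  rw [continuousOn_open_iff (isOpen_setOf_pt_mem U)]
  intro W hW
  exact TopologicalSpace.isOpen_generateFrom_of_mem ⟨U, f, W, hW, rfl⟩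

/-- Convergence in `X(ℂ)` is convergence of the values of the regular functions on an affine
neighbourhood. -/
lemma tendsto_nhds_of_affine {V : X.Opens} (hV : IsAffineOpen V) {α : Type*} {l : Filter α}
    {g : α → ComplexPoints X} {x : ComplexPoints X} (hx : x.pt ∈ V)
    (hg : ∀ᶠ a in l, (g a).pt ∈ V)
    (h : ∀ f : Γ(X, V), Tendsto (fun a => value f (g a)) l (𝓝 (value f x))) :
    Tendsto g l (𝓝 x) := by
  rw [TopologicalSpace.tendsto_nhds_generateFrom_iff]
  rintro _ ⟨U, f, W, hW, rfl⟩ ⟨hxU, hxW⟩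
  -- The topology also tests functions on smaller opens. Near `x` such a function is a fraction `a /
  -- b ^ n` of functions on `V`, with `b` nonzero at `x`.
  obtain ⟨b, hb, hxb⟩ := hV.exists_basicOpen_le ⟨x.pt, hxU⟩ hx
  have hbV : X.basicOpen b ≤ V := X.basicOpen_le b
  have hloc := hV.isLocalization_basicOpen b
  obtain ⟨⟨a, ⟨_, n, rfl⟩⟩, hab⟩ := IsLocalization.surj (Submonoid.powers b)
    (X.presheaf.map (homOfLE hb).op f)
  simp only [RingHom.algebraMap_toAlgebra] at hab
  have key : ∀ z : ComplexPoints X, z.pt ∈ X.basicOpen b →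
      value f z = value a z / value b z ^ n := by
    intro z hz
    have hz0 := ((pt_mem_basicOpen b).1 hz).2
    have := congrArg (evalAt hz) hab
    rw [map_mul, evalAt_apply, evalAt_apply, evalAt_apply, value_res hb _ hz] at this
    rw [eq_div_iff (pow_ne_zero _ hz0)]
    have e1 : value (X.presheaf.map (homOfLE hbV).op (b ^ n)) z = value b z ^ n := by
      rw [value_res hbV _ hz, ← evalAt_apply (hbV hz), map_pow, evalAt_apply]
    have e2 : value (X.presheaf.map (homOfLE hbV).op a) z = value a z := value_res hbV _ hz
    exact (congrArg _ e1.symm).trans (this.trans e2)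
  have hxb0 := ((pt_mem_basicOpen b).1 hxb).2
  have hgb : ∀ᶠ z in l, (g z).pt ∈ X.basicOpen b := by
    filter_upwards [hg, (h b).eventually_ne hxb0] with z h1 h2
    exact (pt_mem_basicOpen b).2 ⟨h1, h2⟩
  have hlim : Tendsto (fun z => value f (g z)) l (𝓝 (value f x)) := by
    rw [key x hxb]
    refine (((h a).div ((h b).pow n) (pow_ne_zero _ hxb0))).congr' ?_
    filter_upwards [hgb] with z hz
    exact (key _ hz).symm
  filter_upwards [hgb, hlim (hW.mem_nhds hxW)] with z h1 h2
  exact ⟨hb h1, h2⟩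

end ComplexPoints

end

/-! ### Standard charts of projective space and of its closed subschemes -/

section

open HomogeneousLocalization

/-- Homogeneity extracts the common scalar `u` from each monomial exactly `d` times. -/
lemma pow_mul_ringHom_of_isHomogeneous {ι R : Type*} [CommRing R] (θ η : MvPolynomial ι ℤ →+* R)
    {u : R} (h : ∀ i, u * θ (.X i) = η (.X i)) {p : MvPolynomial ι ℤ} {d : ℕ}
    (hp : p.IsHomogeneous d) : u ^ d * θ p = η p := by
  classical
  conv_lhs => rw [p.as_sum]
  conv_rhs => rw [p.as_sum]
  rw [map_sum, map_sum, Finset.mul_sum]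
  refine Finset.sum_congr rfl fun m hm => ?_
  have hd : ∑ i ∈ m.support, m i = d := by
    have := hp (MvPolynomial.mem_support_iff.1 hm)
    simpa [Finsupp.weight_apply, Finsupp.sum] using this
  rw [MvPolynomial.monomial_eq, map_mul, map_mul, ← RingHom.comp_apply θ, ← RingHom.comp_apply η,
    eq_intCast, eq_intCast, Finsupp.prod, map_prod, map_prod, ← hd, ← Finset.prod_pow_eq_pow_sum,
    mul_left_comm, ← Finset.prod_mul_distrib]
  congr 1
  refine Finset.prod_congr rfl fun i _ => ?_
  rw [map_pow, map_pow, ← mul_pow, h]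

section ProjectiveSpace

variable {n : ℕ}

attribute [local instance] MvPolynomial.gradedAlgebra

local notation "𝒜" => MvPolynomial.homogeneousSubmodule (Fin (n + 1)) ℤ

lemma X_mem_homogeneousSubmodule (j : Fin (n + 1)) : (MvPolynomial.X j : MvPolynomial _ ℤ) ∈ 𝒜 1 :=
  MvPolynomial.isHomogeneous_X ℤ j

/-- The fraction `x_i / x_j` in the degree zero part of `ℤ[x₀, …, xₙ]_{x_j}`. -/
def coordFraction (i j : Fin (n + 1)) : Away 𝒜 (MvPolynomial.X j) :=
  Away.mk 𝒜 (X_mem_homogeneousSubmodule j) 1 (MvPolynomial.X i)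
    (by simpa using X_mem_homogeneousSubmodule i)

lemma val_coordFraction (i j : Fin (n + 1)) :
    (coordFraction i j).val = IsLocalization.mk'
      (Localization.Away (MvPolynomial.X j : MvPolynomial (Fin (n + 1)) ℤ)) (MvPolynomial.X i)
      (⟨MvPolynomial.X j, 1, pow_one _⟩ :
        Submonoid.powers (MvPolynomial.X j : MvPolynomial (Fin (n + 1)) ℤ)) := by
  rw [← Localization.mk_eq_mk']
  exact congrArg (Localization.mk _) (Subtype.ext (pow_one _))

lemma aeval_coordFraction (j : Fin (n + 1)) {d : ℕ} {p : MvPolynomial (Fin (n + 1)) ℤ}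
    (hp : p ∈ 𝒜 (d • 1)) :
    MvPolynomial.aeval (fun i => coordFraction i j) p =
      Away.mk 𝒜 (X_mem_homogeneousSubmodule j) d p hp := by
  apply HomogeneousLocalization.val_injective
  have h := pow_mul_ringHom_of_isHomogeneous
    ((algebraMap (Away 𝒜 (MvPolynomial.X j))
      (Localization.Away (MvPolynomial.X j : MvPolynomial (Fin (n + 1)) ℤ))).comp
      (MvPolynomial.aeval (fun i => coordFraction i j)).toRingHom)
    (algebraMap _ (Localization.Away (MvPolynomial.X j : MvPolynomial (Fin (n + 1)) ℤ)))
    (u := algebraMap (MvPolynomial (Fin (n + 1)) ℤ) _ (MvPolynomial.X j)) (p := p) (d := d)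
    (fun i => by
      have : (MvPolynomial.aeval (R := ℤ) (fun i => coordFraction (n := n) i j)).toRingHom
          (MvPolynomial.X i) = coordFraction i j := MvPolynomial.aeval_X _ i
      rw [RingHom.comp_apply, this]
      change _ * (coordFraction i j).val = _
      rw [val_coordFraction]
      exact IsLocalization.mk'_spec'
        (Localization.Away (MvPolynomial.X j : MvPolynomial (Fin (n + 1)) ℤ)) _ _)
    (by simpa using hp)
  rw [Away.val_mk, Localization.mk_eq_mk']
  rw [IsLocalization.eq_mk'_iff_mul_eq, ← h, mul_comm]
  rw [map_pow]
  rfl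

/-- Every degree zero fraction `p / x_j ^ d` is the value of the form `p` at the fractions `x_i /
x_j`. -/
lemma adjoin_coordFraction (j : Fin (n + 1)) :
    Algebra.adjoin ℤ (Set.range fun i => coordFraction (n := n) i j) = ⊤ := by
  rw [eq_top_iff]
  rintro x -
  obtain ⟨d, p, hp, rfl⟩ := Away.mk_surjective 𝒜 (X_mem_homogeneousSubmodule j) x
  rw [← aeval_coordFraction, Algebra.adjoin_range_eq_range_aeval]
  exact ⟨p, rfl⟩

lemma coordFraction_self (j : Fin (n + 1)) : coordFraction j j = 1 := by
  apply HomogeneousLocalization.val_injective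
  simp [coordFraction, HomogeneousLocalization.val_one]

/-- The section `x_i / x_j` of the structure sheaf of projective space over `x_j ≠ 0`. -/
def coordSection (i j : Fin (n + 1)) : Γ(Proj 𝒜, Proj.basicOpen 𝒜 (MvPolynomial.X j)) :=
  (Proj.awayToSection 𝒜 (MvPolynomial.X j)).hom (coordFraction i j)

lemma stalkIso_germ_coordSection (i j : Fin (n + 1)) (p : ProjectiveSpectrum 𝒜)
    (hp : p ∈ Proj.basicOpen 𝒜 (MvPolynomial.X j)) :
    (AlgebraicGeometry.Proj.stalkIso' 𝒜 p
      ((Proj 𝒜).presheaf.germ _ p hp (coordSection i j))).val =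
      Localization.mk (MvPolynomial.X i) (⟨MvPolynomial.X j, hp⟩ : p.1.toIdeal.primeCompl) := by
  have h := (AlgebraicGeometry.Proj.stalkIso'_germ 𝒜 (Proj.basicOpen 𝒜 (MvPolynomial.X j)) p hp
    (coordSection i j))
  refine (congrArg HomogeneousLocalization.val h).trans ?_
  refine (ProjectiveSpectrum.Proj.awayToSection_apply 𝒜 _ _ _).trans ?_
  rw [val_coordFraction, IsLocalization.map_mk', Localization.mk_eq_mk']
  rfl

lemma adjoin_coordSection (j : Fin (n + 1)) :
    Algebra.adjoin ℤ (Set.range fun i => coordSection (n := n) i j) = ⊤ := by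
  have hs : Function.Surjective (Proj.awayToSection 𝒜 (MvPolynomial.X j)).hom :=
    (Proj.basicOpenIsoAway 𝒜 _ (X_mem_homogeneousSubmodule j) one_pos).commRingCatIsoToRingEquiv.surjective
  have := congrArg (Subalgebra.map (Proj.awayToSection 𝒜 (MvPolynomial.X j)).hom.toIntAlgHom)
    (adjoin_coordFraction j)
  rw [AlgHom.map_adjoin, Algebra.map_top, ← Set.range_comp] at this
  refine this.trans ?_
  exact AlgHom.range_eq_top _ |>.2 hs

lemma coordSection_self (j : Fin (n + 1)) : coordSection j j = 1 := by
  rw [coordSection, coordFraction_self, map_one]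

/-- In the local ring at `p`, the fraction `x_i / x_j` is a unit only if `x_i` lies outside the
prime. -/
lemma basicOpen_coordSection_le (i j : Fin (n + 1)) :
    (Proj 𝒜).basicOpen (coordSection i j) ≤ Proj.basicOpen 𝒜 (MvPolynomial.X i) := by
  intro (p : ProjectiveSpectrum 𝒜) hp
  have hpj := (Proj 𝒜).basicOpen_le _ hp
  have h := ((Proj 𝒜).mem_basicOpen _ p hpj).1 hp
  have h' := ((h.map (AlgebraicGeometry.Proj.stalkIso' 𝒜 p)).map (algebraMap _
    (Localization p.1.toIdeal.primeCompl)))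
  change IsUnit (AlgebraicGeometry.Proj.stalkIso' 𝒜 p _).val at h'
  rw [stalkIso_germ_coordSection, Localization.mk_eq_mk',
    IsLocalization.AtPrime.isUnit_mk'_iff (Localization p.1.toIdeal.primeCompl) p.1.toIdeal] at h'
  exact h'

/-- The cocycle relation `(x_l / x_i)(x_i / x_j) = x_l / x_j`, checked in the stalk, where sections
are actual fractions. -/
lemma germ_coordSection_mul (i j l : Fin (n + 1)) (p : ProjectiveSpectrum 𝒜)
    (hi : p ∈ Proj.basicOpen 𝒜 (MvPolynomial.X i)) (hj : p ∈ Proj.basicOpen 𝒜 (MvPolynomial.X j)) :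
    (Proj 𝒜).presheaf.germ _ p hi (coordSection l i) *
      (Proj 𝒜).presheaf.germ _ p hj (coordSection i j) =
    (Proj 𝒜).presheaf.germ _ p hj (coordSection l j) := by
  apply (AlgebraicGeometry.Proj.stalkIso' 𝒜 p).injective
  apply HomogeneousLocalization.val_injective
  refine (congrArg HomogeneousLocalization.val (map_mul _ _ _)).trans ?_
  rw [HomogeneousLocalization.val_mul]
  refine (congrArg₂ _ (stalkIso_germ_coordSection l i p hi)
    (stalkIso_germ_coordSection i j p hj)).trans
    (Eq.trans ?_ (stalkIso_germ_coordSection l j p hj).symm)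
  rw [Localization.mk_mul, Localization.mk_eq_mk_iff, Localization.r_iff_exists]
  exact ⟨1, by simp; ring⟩

lemma iSup_basicOpen_X : ⨆ j : Fin (n + 1), Proj.basicOpen 𝒜 (MvPolynomial.X j) = ⊤ := by
  refine Proj.iSup_basicOpen_eq_top' 𝒜 _ (fun i => ⟨1, X_mem_homogeneousSubmodule i⟩) ?_
  rw [eq_top_iff]
  rintro p -
  have : p ∈ Algebra.adjoin ℤ (Set.range (MvPolynomial.X (R := ℤ) (σ := Fin (n + 1)))) := by
    rw [MvPolynomial.adjoin_range_X]; trivial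
  induction this using Algebra.adjoin_induction with
  | mem x hx => exact Algebra.subset_adjoin hx
  | algebraMap r => exact intCast_mem _ r
  | add x y _ _ hx hy => exact add_mem hx hy
  | mul x y _ _ hx hy => exact mul_mem hx hy

end ProjectiveSpace

/-- A covering of a scheme by affine charts with coordinates `x_i / x_j`, as for a closed subscheme
of projective space. -/
structure ProjectiveCharts (X : Scheme.{0}) (n : ℕ) where
  U : Fin (n + 1) → X.Opens
  isAffineOpen : ∀ j, IsAffineOpen (U j)
  iSup_eq_top : ⨆ j, U j = ⊤
  r : Fin (n + 1) → ∀ j : Fin (n + 1), Γ(X, U j)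
  r_self : ∀ j, r j j = 1
  adjoin_eq_top : ∀ j, Algebra.adjoin ℤ (Set.range fun i => r i j) = ⊤
  basicOpen_le : ∀ i j, X.basicOpen (r i j) ≤ U i
  germ_mul : ∀ i j l (p : X) (hi : p ∈ U i) (hj : p ∈ U j),
    X.presheaf.germ (U i) p hi (r l i) * X.presheaf.germ (U j) p hj (r i j) =
      X.presheaf.germ (U j) p hj (r l j)

attribute [local instance] MvPolynomial.gradedAlgebra in
/-- The standard charts of projective space. -/
def projectiveSpaceCharts (n : ℕ) : ProjectiveCharts (ProjectiveSpaceZ n) n where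
  U j := Proj.basicOpen _ (MvPolynomial.X j)
  isAffineOpen j := Proj.isAffineOpen_basicOpen _ _ (X_mem_homogeneousSubmodule j) one_pos
  iSup_eq_top := iSup_basicOpen_X
  r i j := coordSection i j
  r_self := coordSection_self
  adjoin_eq_top := adjoin_coordSection
  basicOpen_le := basicOpen_coordSection_le
  germ_mul := germ_coordSection_mul

/-- The restriction of charts to a closed subscheme. -/
def ProjectiveCharts.pullback {X Y : Scheme.{0}} {n : ℕ} (c : ProjectiveCharts Y n) (f : X ⟶ Y)
    [IsClosedImmersion f] : ProjectiveCharts X n where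
  U j := f ⁻¹ᵁ c.U j
  isAffineOpen j := (c.isAffineOpen j).preimage f
  iSup_eq_top := by
    rw [← Scheme.Hom.preimage_iSup, c.iSup_eq_top]
    rfl
  r i j := f.app _ (c.r i j)
  r_self j := by rw [c.r_self, map_one]
  adjoin_eq_top j := by
    have hs : Function.Surjective (f.app (c.U j)).hom := f.app_surjective _ (c.isAffineOpen j)
    have := congrArg (Subalgebra.map (f.app (c.U j)).hom.toIntAlgHom) (c.adjoin_eq_top j)
    rw [AlgHom.map_adjoin, Algebra.map_top, ← Set.range_comp] at this
    refine this.trans ?_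
    exact AlgHom.range_eq_top _ |>.2 hs
  basicOpen_le i j := by
    rw [← Scheme.preimage_basicOpen]
    exact fun x hx => c.basicOpen_le i j hx
  germ_mul i j l p hi hj := by
    have h := congrArg (f.stalkMap p).hom (c.germ_mul i j l (f p) hi hj)
    rw [map_mul] at h
    have key : ∀ a b (hb : p ∈ f ⁻¹ᵁ c.U b),
        X.presheaf.germ _ p hb (f.app _ (c.r a b)) =
          (f.stalkMap p).hom (Y.presheaf.germ _ (f p) hb (c.r a b)) := fun a b hb =>
      (Scheme.Hom.germ_stalkMap_apply f _ p hb _).symm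
    rw [key, key, key]
    exact h

end

/-! ### Compactness of the space of complex points -/

section

open Filter Topology

namespace ComplexPoints

variable {X : Scheme.{0}}

/-- Normalize by the homogeneous coordinate of largest absolute value; the space is covered by
finitely many polydisc-like pieces. -/
lemma exists_norm_value_le_one {n : ℕ} (c : ProjectiveCharts X n) (x : ComplexPoints X) :
    ∃ j, x.pt ∈ c.U j ∧ ∀ i, ‖value (c.r i j) x‖ ≤ 1 := by
  have hx : x.pt ∈ ⨆ j, c.U j := by rw [c.iSup_eq_top]; trivial
  obtain ⟨a, ha⟩ := Opens.mem_iSup.1 hx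
  obtain ⟨j, hj⟩ := Finite.exists_max fun i => ‖value (c.r i a) x‖
  have h1 : value (c.r a a) x = 1 := by rw [c.r_self, ← evalAt_apply ha, map_one]
  have hpos : 0 < ‖value (c.r j a) x‖ := by
    refine one_pos.trans_le ?_
    simpa [h1] using hj a
  have hxj : x.pt ∈ c.U j :=
    c.basicOpen_le j a ((pt_mem_basicOpen _).2 ⟨ha, norm_pos_iff.1 hpos⟩)
  refine ⟨j, hxj, fun i => ?_⟩
  have h2 : value (c.r i j) x * value (c.r j a) x = value (c.r i a) x := by
    rw [value_of_mem _ hxj, value_of_mem _ ha, value_of_mem _ ha, ← map_mul, c.germ_mul]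
  have h3 := hj i
  rw [← h2, norm_mul] at h3
  exact le_of_mul_le_mul_right (by simpa using h3) hpos

/-- The complex points of a closed subscheme of projective space are compact. -/
lemma compactSpace {n : ℕ} (c : ProjectiveCharts X n) : CompactSpace (ComplexPoints X) := by
  refine ⟨isCompact_iff_ultrafilter_le_nhds.2 fun F _ => ?_⟩
  obtain ⟨j, hj⟩ : ∃ j, {x : ComplexPoints X | x.pt ∈ c.U j ∧ ∀ i, ‖value (c.r i j) x‖ ≤ 1} ∈ F := by
    have h : ∀ᶠ x in (F : Filter (ComplexPoints X)),
        ∃ j, x.pt ∈ c.U j ∧ ∀ i, ‖value (c.r i j) x‖ ≤ 1 :=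
      Eventually.of_forall (exists_norm_value_le_one c)
    exact Ultrafilter.eventually_exists_iff.1 h
  set S := {x : ComplexPoints X | x.pt ∈ c.U j ∧ ∀ i, ‖value (c.r i j) x‖ ≤ 1}
  -- The chart coordinates generate the ring of functions over `ℤ`, so a bound on the coordinates
  -- bounds every function on `S`.
  have hbound : ∀ f : Γ(X, c.U j), ∃ B : ℝ, ∀ x ∈ S, ‖value f x‖ ≤ B := by
    intro f
    have hf : f ∈ Algebra.adjoin ℤ (Set.range fun i => c.r i j) := by
      rw [c.adjoin_eq_top]; trivial
    induction hf using Algebra.adjoin_induction with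
    | mem f hf =>
      obtain ⟨i, rfl⟩ := hf
      exact ⟨1, fun x hx => hx.2 i⟩
    | algebraMap m =>
      refine ⟨‖(m : ℂ)‖, fun x hx => ?_⟩
      rw [← evalAt_apply hx.1]
      simp
    | add f g _ _ hf hg =>
      obtain ⟨B, hB⟩ := hf
      obtain ⟨B', hB'⟩ := hg
      refine ⟨B + B', fun x hx => ?_⟩
      rw [value_add _ _ hx.1]
      exact (norm_add_le _ _).trans (add_le_add (hB x hx) (hB' x hx))
    | mul f g _ _ hf hg =>
      obtain ⟨B, hB⟩ := hf
      obtain ⟨B', hB'⟩ := hg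
      refine ⟨B * B', fun x hx => ?_⟩
      rw [value_mul _ _ hx.1, norm_mul]
      exact mul_le_mul (hB x hx) (hB' x hx) (norm_nonneg _) ((norm_nonneg _).trans (hB x hx))
  have hlim : ∀ f : Γ(X, c.U j), ∃ z, Tendsto (value f) F (𝓝 z) := by
    intro f
    obtain ⟨B, hB⟩ := hbound f
    obtain ⟨z, -, hz⟩ := (isCompact_closedBall (0 : ℂ) B).ultrafilter_le_nhds (F.map (value f)) (by
      rw [le_principal_iff]
      change value f ⁻¹' _ ∈ F
      refine mem_of_superset hj fun x hx => ?_
      simpa using hB x hx)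
    exact ⟨z, hz⟩
  choose z hz using hlim
  have hS : ∀ᶠ x in (F : Filter (ComplexPoints X)), x.pt ∈ c.U j := mem_of_superset hj fun x hx => hx.1
  -- Limits of values along the ultrafilter respect sums and products, so they define a character;
  -- its complex point is the limit of the ultrafilter.
  let χ : Γ(X, c.U j) →+* ℂ :=
    { toFun := z
      map_one' := tendsto_nhds_unique (hz 1) (tendsto_const_nhds.congr' (by
        filter_upwards [hS] with x hx
        rw [← evalAt_apply hx, map_one]))
      map_zero' := tendsto_nhds_unique (hz 0) (tendsto_const_nhds.congr' (by
        filter_upwards [hS] with x hx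
        rw [← evalAt_apply hx, map_zero]))
      map_add' := fun f g => tendsto_nhds_unique (hz _) (((hz f).add (hz g)).congr' (by
        filter_upwards [hS] with x hx
        rw [value_add _ _ hx]))
      map_mul' := fun f g => tendsto_nhds_unique (hz _) (((hz f).mul (hz g)).congr' (by
        filter_upwards [hS] with x hx
        rw [value_mul _ _ hx])) }
  refine ⟨ofHom (c.isAffineOpen j) χ, trivial, ?_⟩
  have := tendsto_nhds_of_affine (c.isAffineOpen j) (l := (F : Filter (ComplexPoints X)))
    (g := id) (x := ofHom (c.isAffineOpen j) χ) (pt_ofHom_mem _ _) hS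
    (fun f => by rw [value_ofHom]; exact hz f)
  exact this

end ComplexPoints

end

/-! ### Local frames, dual frames and norms of sections -/

section

open Filter Topology

variable {X : Scheme.{0}}

namespace LocalFrame

variable {M : X.Modules} (F : LocalFrame M)

/-- The isomorphism `𝒪_{X,p} ≃ M_p` defined by a local frame. -/
def stalkEquiv {p : X} (hp : p ∈ F.U) :
    X.presheaf.stalk p ≃ₗ[X.presheaf.stalk p] M.presheaf.stalk p :=
  LinearEquiv.ofBijective (LinearMap.toSpanSingleton (X.presheaf.stalk p) (M.presheaf.stalk p)
      (M.presheaf.germ F.U p hp F.e)) (F.stalk_bijective p hp)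

lemma stalkEquiv_apply {p : X} (hp : p ∈ F.U) (r : X.presheaf.stalk p) :
    F.stalkEquiv hp r = r • M.presheaf.germ F.U p hp F.e := rfl

lemma stalkEquiv_symm_frame {p : X} (hp : p ∈ F.U) :
    (F.stalkEquiv hp).symm (M.presheaf.germ F.U p hp F.e) = 1 := by
  rw [LinearEquiv.symm_apply_eq, stalkEquiv_apply, one_smul]

lemma exists_eq_smul {p : X} (hp : p ∈ F.U) (m : M.presheaf.stalk p) :
    ∃ r : X.presheaf.stalk p, m = r • M.presheaf.germ F.U p hp F.e :=
  ⟨(F.stalkEquiv hp).symm m, ((F.stalkEquiv hp).apply_symm_apply m).symm⟩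

/-- The coordinate on the `k`-th tensor power of a stalk defined by a local frame. -/
def tensorCoord {p : X} (hp : p ∈ F.U) (k : ℕ) :
    (⨂[X.presheaf.stalk p]^k (M.presheaf.stalk p)) →ₗ[X.presheaf.stalk p] X.presheaf.stalk p :=
  PiTensorProduct.lift
    ((MultilinearMap.mkPiAlgebra (X.presheaf.stalk p) (Fin k) (X.presheaf.stalk p)).compLinearMap
      fun _ => (F.stalkEquiv hp).symm.toLinearMap)

lemma tensorCoord_tprod {p : X} (hp : p ∈ F.U) (k : ℕ) :
    F.tensorCoord hp k (PiTensorProduct.tprod (X.presheaf.stalk p)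
      fun _ : Fin k => M.presheaf.germ F.U p hp F.e) = 1 := by
  rw [tensorCoord, PiTensorProduct.lift.tprod]
  simp [stalkEquiv_symm_frame]

end LocalFrame

namespace DualPoint

variable {L : LineBundle X}

lemma pow_tprod (w : DualPoint L) (k : ℕ) (m : L.stalk w.x.pt) :
    w.pow k (PiTensorProduct.tprod (X.presheaf.stalk w.x.pt) fun _ : Fin k => m) = w.v m ^ k := by
  let : Algebra (X.presheaf.stalk w.x.pt) ℂ := w.x.ev.toAlgebra
  rw [pow]
  refine (PiTensorProduct.lift.tprod _).trans ?_
  simp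

lemma pow_smul (w : DualPoint L) (k : ℕ) (r : X.presheaf.stalk w.x.pt)
    (t : ⨂[X.presheaf.stalk w.x.pt]^k (L.stalk w.x.pt)) :
    w.pow k (r • t) = w.x.ev r * w.pow k t := by
  let : Algebra (X.presheaf.stalk w.x.pt) ℂ := w.x.ev.toAlgebra
  exact (map_smul _ r t)

lemma v_smul (w : DualPoint L) (r : X.presheaf.stalk w.x.pt) (m : L.stalk w.x.pt) :
    w.v (r • m) = w.x.ev r * w.v m := w.v.map_smulₛₗ r m

lemma v_frame_ne_zero (w : DualPoint L) (F : LocalFrame L.sheaf) (hp : w.x.pt ∈ F.U) :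
    w.pair hp F.e ≠ 0 := by
  intro h
  refine w.ne_zero (LinearMap.ext fun m => ?_)
  obtain ⟨r, rfl⟩ := F.exists_eq_smul hp m
  refine (w.v_smul r _).trans ?_
  change _ * w.pair hp F.e = _
  rw [h, mul_zero]
  rfl

/-- Non-zero linear forms on the same fibre are proportional. -/
lemma exists_scale_eq (x : ComplexPoints X) (w w' : DualPoint L) (hw : w.x = x) (hw' : w'.x = x) :
    ∃ c hc, w' = w.scale c hc := by
  obtain ⟨y, v, hv⟩ := w
  obtain ⟨y', v', hv'⟩ := w'
  obtain rfl : y = x := hw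
  obtain rfl : y' = y := hw'
  obtain ⟨F, hF⟩ := L.exists_frame y'.pt
  have h := v_frame_ne_zero ⟨y', v, hv⟩ F hF
  have h' := v_frame_ne_zero ⟨y', v', hv'⟩ F hF
  refine ⟨_, div_ne_zero h' h, ?_⟩
  rw [scale]
  congr 1
  ext m
  obtain ⟨r, rfl⟩ := F.exists_eq_smul hF m
  refine (v_smul ⟨y', v', hv'⟩ r _).trans ?_
  refine Eq.trans ?_ (congrArg (_ * ·) (v_smul ⟨y', v, hv⟩ r _)).symm
  change _ * pair ⟨y', v', hv'⟩ hF F.e = _ * (_ * pair ⟨y', v, hv⟩ hF F.e)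
  field_simp

end DualPoint

namespace LocalFrame

variable {L : LineBundle X} (F : LocalFrame L.sheaf)

open Classical in
/-- The dual frame: the linear form on the fibre at `x` taking the value `1` on the frame. -/
def dualFrame (x : ComplexPoints X) : DualPoint L :=
  if h : x.pt ∈ F.U then
    { x := x
      v := { toFun := fun s => x.ev ((F.stalkEquiv h).symm s)
             map_add' := fun s t => by rw [map_add, map_add]
             map_smul' := fun r s => by rw [map_smul, smul_eq_mul, map_mul, smul_eq_mul] }
      ne_zero := fun h' => by
        have := DFunLike.congr_fun h' (L.sheaf.presheaf.germ F.U x.pt h F.e)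
        change x.ev ((F.stalkEquiv h).symm _) = 0 at this
        rw [stalkEquiv_symm_frame, map_one] at this
        exact one_ne_zero this }
  else DualPoint.above L x

lemma dualFrame_x (x : ComplexPoints X) : (F.dualFrame x).x = x := by
  rw [dualFrame]
  split
  · rfl
  · exact DualPoint.above_x L x

lemma pair_dualFrame {x : ComplexPoints X} (hx : x.pt ∈ F.U) {V : X.Opens} (hVU : V ≤ F.U)
    (h : (F.dualFrame x).x.pt ∈ V) (g : Γ(X, V)) :
    (F.dualFrame x).pair h (g • L.sheaf.presheaf.map (homOfLE hVU).op F.e) =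
      ComplexPoints.value g x := by
  have e : F.dualFrame x = _ := dif_pos hx
  revert h
  rw [e]
  intro h
  rw [ComplexPoints.value_of_mem g h]
  change x.ev ((F.stalkEquiv hx).symm (L.sheaf.presheaf.germ V x.pt h _)) = _
  congr 1
  rw [germ_smul, TopCat.Presheaf.germ_res_apply, map_smul, stalkEquiv_symm_frame, smul_eq_mul,
    mul_one]

lemma pair_dualFrame_self {x : ComplexPoints X} (h : (F.dualFrame x).x.pt ∈ F.U) :
    (F.dualFrame x).pair h F.e = 1 := by
  have hx : x.pt ∈ F.U := by rwa [dualFrame_x] at h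
  have := F.pair_dualFrame hx le_rfl h 1
  rw [one_smul] at this
  rw [← ComplexPoints.evalAt_apply hx, map_one] at this
  simpa using this

/-- Composing a continuous weight with this local section of the dual bundle gives a continuous
function on `X(ℂ)`, which a pointwise chosen vector `above` need not give. -/
lemma continuousOn_dualFrame : ContinuousOn F.dualFrame {x | x.pt ∈ F.U} := by
  rw [continuousOn_iff_continuous_domRestrict]
  refine continuous_generateFrom_iff.2 ?_
  rintro _ (⟨O, hO, rfl⟩ | ⟨V, s, W, hW, rfl⟩)
  · convert hO.preimage continuous_subtype_val using 1
    ext ⟨x, hx⟩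
    change (F.dualFrame x).x ∈ O ↔ x ∈ O
    rw [dualFrame_x]
  · obtain ⟨g, hg⟩ := (F.bijective (V ⊓ F.U) inf_le_right).2
      (L.sheaf.presheaf.map (homOfLE (inf_le_left : V ⊓ F.U ≤ V)).op s)
    have hS : IsOpen {x : ComplexPoints X | x.pt ∈ V ⊓ F.U ∧ ComplexPoints.value g x ∈ W} :=
      TopologicalSpace.isOpen_generateFrom_of_mem ⟨V ⊓ F.U, g, W, hW, rfl⟩
    convert hS.preimage continuous_subtype_val using 1
    ext ⟨x, hx⟩
    change (∃ h : (F.dualFrame x).x.pt ∈ V, (F.dualFrame x).pair h s ∈ W) ↔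
      x.pt ∈ V ⊓ F.U ∧ ComplexPoints.value g x ∈ W
    have key : ∀ (hV : (F.dualFrame x).x.pt ∈ V),
        (F.dualFrame x).pair hV s = ComplexPoints.value g x := by
      intro hV
      have hVF : (F.dualFrame x).x.pt ∈ V ⊓ F.U := ⟨hV, by rw [dualFrame_x]; exact hx⟩
      rw [← F.pair_dualFrame hx inf_le_right hVF g]
      refine Eq.trans ?_ (congrArg ((F.dualFrame x).pair hVF) hg).symm
      simp only [DualPoint.pair]
      rw [TopCat.Presheaf.germ_res_apply]
    constructor
    · rintro ⟨h, h'⟩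
      rw [key h] at h'
      rw [dualFrame_x] at h
      exact ⟨⟨h, hx⟩, h'⟩
    · rintro ⟨h, h'⟩
      have hV : (F.dualFrame x).x.pt ∈ V := by rw [dualFrame_x]; exact h.1
      exact ⟨hV, by rw [key hV]; exact h'⟩

/-- The coefficient of a section of `kℒ` with respect to the `k`-th power of a local frame. -/
def coeff {k : ℕ} (s : H0 L k) : Γ(X, F.U) := (s.2 F).choose

lemma apply_eq_germ_coeff_smul {k : ℕ} (s : H0 L k) {p : X} (hp : p ∈ F.U) :
    s.1 p = X.presheaf.germ F.U p hp (F.coeff s) •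
      PiTensorProduct.tprod (X.presheaf.stalk p)
        (fun _ : Fin k => (L.sheaf.presheaf.germ F.U p hp F.e : L.stalk p)) :=
  (s.2 F).choose_spec p hp

/-- The coefficient was obtained by choice; its germs are given by a linear formula, hence it is
unique and additive in the section. -/
lemma germ_coeff {k : ℕ} (s : H0 L k) {p : X} (hp : p ∈ F.U) :
    X.presheaf.germ F.U p hp (F.coeff s) = F.tensorCoord hp k (s.1 p) := by
  rw [F.apply_eq_germ_coeff_smul s hp, map_smul]
  refine Eq.trans ?_ (congrArg (_ • ·) (F.tensorCoord_tprod hp k)).symm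
  simp

lemma coeff_add {k : ℕ} (s s' : H0 L k) : F.coeff (s + s') = F.coeff s + F.coeff s' := by
  refine TopCat.Presheaf.section_ext X.sheaf F.U _ _ fun p hp => ?_
  change X.presheaf.germ F.U p hp _ = X.presheaf.germ F.U p hp _
  rw [map_add, germ_coeff, germ_coeff, germ_coeff, ← map_add]
  rfl

lemma pow_eq {k : ℕ} (s : H0 L k) (w : DualPoint L) (hp : w.x.pt ∈ F.U) :
    w.pow k (s.1 w.x.pt) = ComplexPoints.value (F.coeff s) w.x * w.pair hp F.e ^ k := by
  rw [F.apply_eq_germ_coeff_smul s hp, DualPoint.pow_smul, DualPoint.pow_tprod,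
    ComplexPoints.value_of_mem _ hp]
  rfl

lemma genericPoint_mem [IrreducibleSpace X] {U : X.Opens} {p : X} (hp : p ∈ U) :
    genericPoint X ∈ U :=
  (genericPoint_spec X).mem_open_set_iff U.isOpen |>.2 ⟨p, trivial, hp⟩

/-- A section of `kℒ` on an integral scheme is determined by its value at the generic point. -/
lemma apply_genericPoint_injective [IsIntegral X] (L : LineBundle X) (k : ℕ) :
    Function.Injective (fun s : H0 L k => s.1 (genericPoint X)) := by
  intro s s' h
  refine Subtype.ext (funext fun p => ?_)
  obtain ⟨F, hF⟩ := L.exists_frame p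
  have hη := genericPoint_mem hF
  have : F.coeff s = F.coeff s' := by
    refine germ_injective_of_isIntegral X _ hη ?_
    rw [germ_coeff, germ_coeff]
    exact congrArg _ h
  rw [F.apply_eq_germ_coeff_smul s hF, F.apply_eq_germ_coeff_smul s' hF, this]

/-- Two sections of `kℒ` on an integral scheme are equal if their coefficients with respect to a
frame over a non-empty open set are equal. -/
lemma coeff_injective [IsIntegral X] {p₀ : X} (hp₀ : p₀ ∈ F.U) (k : ℕ) :
    Function.Injective (fun s : H0 L k => F.coeff s) := by
  intro s s' h
  have hη := genericPoint_mem hp₀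
  refine apply_genericPoint_injective L k ?_
  have h' : F.coeff s = F.coeff s' := h
  change s.1 _ = s'.1 _
  rw [F.apply_eq_germ_coeff_smul s hη, F.apply_eq_germ_coeff_smul s' hη, h']

end LocalFrame

namespace Weight

variable {L : LineBundle X} (φ ψ : Weight L)

lemma diff_eq {x : ComplexPoints X} (w : DualPoint L) (hw : w.x = x) :
    φ.diff ψ x = φ.toFun w - ψ.toFun w := by
  obtain ⟨c, hc, h⟩ := DualPoint.exists_scale_eq x w (DualPoint.above L x) hw
    (DualPoint.above_x L x)
  rw [diff, h, φ.log_homogeneous, ψ.log_homogeneous]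
  ring

lemma segment_one : φ.segment ψ 1 = φ := by
  simp [segment]

lemma segment_zero : φ.segment ψ 0 = ψ := by
  simp [segment]

lemma continuous_diff (hφ : Continuous φ.toFun) (hψ : Continuous ψ.toFun) :
    Continuous (φ.diff ψ) := by
  rw [continuous_iff_continuousAt]
  intro x
  obtain ⟨F, hF⟩ := L.exists_frame x.pt
  have h := F.continuousOn_dualFrame.continuousAt
    ((ComplexPoints.isOpen_setOf_pt_mem F.U).mem_nhds hF)
  have := (hφ.continuousAt.comp h).sub (hψ.continuousAt.comp h)
  refine this.congr (Eventually.of_forall fun y => ?_)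
  exact (φ.diff_eq ψ _ (F.dualFrame_x y)).symm

end Weight

variable {L : LineBundle X}

/-- Log-homogeneity makes `|v(e)|^k exp(-kφ(v))` independent of `v`, and the dual frame pairs to 1
with `e`. -/
lemma norm_pair_pow_mul_exp (φ : Weight L) (k : ℕ) (F : LocalFrame L.sheaf)
    {x : ComplexPoints X} (hd : (DualPoint.above L x).x.pt ∈ F.U) :
    ‖(DualPoint.above L x).pair hd F.e‖ ^ k *
      Real.exp (-(k * φ.toFun (DualPoint.above L x))) =
        Real.exp (-(k * φ.toFun (F.dualFrame x))) := by
  obtain ⟨c, hc, h⟩ := DualPoint.exists_scale_eq x (F.dualFrame x) (DualPoint.above L x)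
    (F.dualFrame_x x) (DualPoint.above_x L x)
  revert hd
  rw [h]
  intro hd
  have hpair : ((F.dualFrame x).scale c hc).pair hd F.e = c := by
    change c * (F.dualFrame x).pair hd F.e = c
    rw [F.pair_dualFrame_self hd, mul_one]
  rw [hpair, φ.log_homogeneous, mul_add, neg_add, Real.exp_add, Real.exp_neg, Real.exp_nat_mul,
    Real.exp_log (norm_pos_iff.2 hc)]
  have : ‖c‖ ^ k ≠ 0 := pow_ne_zero _ (norm_ne_zero_iff.2 hc)
  field_simp

lemma pointNorm_eq (φ : Weight L) {k : ℕ} (s : H0 L k) (F : LocalFrame L.sheaf)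
    {x : ComplexPoints X} (hx : x.pt ∈ F.U) :
    pointNorm φ s x =
      ‖ComplexPoints.value (F.coeff s) x‖ * Real.exp (-(k * φ.toFun (F.dualFrame x))) := by
  have hd : (DualPoint.above L x).x.pt ∈ F.U := by rw [DualPoint.above_x]; exact hx
  rw [pointNorm, F.pow_eq s _ hd, norm_mul, norm_pow, mul_assoc,
    norm_pair_pow_mul_exp φ k F hd, DualPoint.above_x]

lemma continuous_pointNorm (φ : Weight L) (hφ : Continuous φ.toFun) {k : ℕ} (s : H0 L k) :
    Continuous (pointNorm φ s) := by
  rw [continuous_iff_continuousAt]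
  intro x
  obtain ⟨F, hF⟩ := L.exists_frame x.pt
  have hU := (ComplexPoints.isOpen_setOf_pt_mem F.U).mem_nhds (x := x) hF
  have h := F.continuousOn_dualFrame.continuousAt hU
  have h' := (ComplexPoints.continuousOn_value (F.coeff s)).continuousAt hU
  refine (h'.norm.mul (Real.continuous_exp.continuousAt.comp
    ((hφ.continuousAt.comp h).const_mul (k : ℝ)).neg)).congr ?_
  filter_upwards [hU] with y hy
  exact (pointNorm_eq φ s F hy).symm

/-- Moving the weight along the segment multiplies all norms at `x` by the same exponential; this
puts the problem in the form of `GaussianFamily.deform`. -/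
lemma pointNorm_segment (φ ψ : Weight L) (t : ℝ) {k : ℕ} (s : H0 L k) (x : ComplexPoints X) :
    pointNorm (φ.segment ψ t) s x = pointNorm ψ s x * Real.exp (-(k * t * φ.diff ψ x)) := by
  rw [pointNorm, pointNorm, mul_assoc, ← Real.exp_add]
  congr 2
  simp only [Weight.segment, Weight.diff]
  ring

end

/-! ### Finite generation and torsion-freeness of the group of sections -/

section

variable {X : Scheme.{0}}

section FiniteGeneration

variable [IsIntegral X] {L : LineBundle X}

/-- The coefficients of all sections of `kℒ` at the generic point have a common denominator on an
affine open set. -/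
lemma exists_common_denominator {U : X.Opens} (hU : IsAffineOpen U) (hη : genericPoint X ∈ U)
    (F₀ : LocalFrame L.sheaf) (hF₀ : genericPoint X ∈ F₀.U) (k : ℕ) :
    ∃ d : Γ(X, U), d ≠ 0 ∧ ∀ s : H0 L k, ∃ g : Γ(X, U),
      X.presheaf.germ U _ hη d * F₀.tensorCoord hF₀ k (s.1 (genericPoint X)) =
        X.presheaf.germ U _ hη g := by
  classical
  let ι : Γ(X, U) →+* X.functionField := (X.presheaf.germ U _ hη).hom
  let κ : H0 L k → X.functionField := fun s => F₀.tensorCoord hF₀ k (s.1 (genericPoint X))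
  have hι : Function.Injective ι := germ_injective_of_isIntegral X _ hη
  -- Here `d` does not depend on the section, while the exponent `N` may. A frame near each point of
  -- `U` supplies such a `b`: `d` clears the transition factor to `F₀` and `b ^ N` clears the
  -- coefficient.
  let S : Set Γ(X, U) := {b | ∃ d : Γ(X, U), d ≠ 0 ∧
    ∀ s : H0 L k, ∃ (N : ℕ) (g : Γ(X, U)), ι b ^ N * (ι d * κ s) = ι g}
  have hS : Ideal.span S = ⊤ := by
    rw [← hU.self_le_iSup_basicOpen_iff]
    intro p hp
    obtain ⟨F, hF⟩ := L.exists_frame p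
    obtain ⟨b, hb, hpb⟩ := hU.exists_basicOpen_le ⟨p, hF⟩ hp
    refine Opens.mem_iSup.2 ⟨⟨b, ?_⟩, hpb⟩
    have hηb := LocalFrame.genericPoint_mem hpb
    have hηF := hb hηb
    have : Nonempty U := ⟨⟨p, hp⟩⟩
    have := functionField_isFractionRing_of_isAffineOpen X U hU
    obtain ⟨⟨a', d'⟩, had⟩ := IsLocalization.surj (nonZeroDivisors Γ(X, U))
      (F₀.tensorCoord hF₀ k (PiTensorProduct.tprod (X.presheaf.stalk (genericPoint X))
        (fun _ : Fin k => (L.sheaf.presheaf.germ F.U _ hηF F.e : L.stalk _))))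
    refine ⟨d', nonZeroDivisors.ne_zero d'.2, fun s => ?_⟩
    have hloc := hU.isLocalization_basicOpen b
    obtain ⟨⟨a, ⟨_, N, rfl⟩⟩, hab⟩ := IsLocalization.surj (Submonoid.powers b)
      (X.presheaf.map (homOfLE hb).op (F.coeff s))
    simp only [RingHom.algebraMap_toAlgebra] at hab
    have h1 := congrArg (X.presheaf.germ _ _ hηb) hab
    rw [map_mul] at h1
    erw [TopCat.Presheaf.germ_res_apply, TopCat.Presheaf.germ_res_apply,
      TopCat.Presheaf.germ_res_apply] at h1
    have h2 : κ s = X.presheaf.germ F.U _ hηF (F.coeff s) * F₀.tensorCoord hF₀ k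
        (PiTensorProduct.tprod (X.presheaf.stalk (genericPoint X))
        (fun _ : Fin k => (L.sheaf.presheaf.germ F.U _ hηF F.e : L.stalk _))) := by
      simp only [κ]
      rw [F.apply_eq_germ_coeff_smul s hηF, map_smul, smul_eq_mul]
    have h3 : X.presheaf.germ F.U _ hηF (F.coeff s) * ι (b ^ N) = ι a := h1
    have h4 : F₀.tensorCoord hF₀ k
        (PiTensorProduct.tprod (X.presheaf.stalk (genericPoint X))
        (fun _ : Fin k => (L.sheaf.presheaf.germ F.U _ hηF F.e : L.stalk _))) * ι d' = ι a' := had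
    refine ⟨N, a * a', ?_⟩
    rw [h2, map_mul, ← h3, ← h4, map_pow]
    ring
  obtain ⟨S', hS'S, hS'⟩ := (Ideal.span_eq_top_iff_finite S).1 hS
  choose! d hd0 hd using fun b (hb : b ∈ S') => hS'S hb
  have : IsDomain Γ(X, U) := hι.isDomain ι
  refine ⟨∏ b ∈ S', d b, Finset.prod_ne_zero_iff.2 hd0, fun s => ?_⟩
  -- The multipliers making the product of the denominators times `κ s` regular. A power of each
  -- generator of the unit ideal lies in `I`, so `1 ∈ I` and the exponents depending on `s`
  -- disappear.
  let I : Ideal Γ(X, U) := 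
    { carrier := {a | ∃ g, ι a * (ι (∏ b ∈ S', d b) * κ s) = ι g}
      zero_mem' := ⟨0, by simp⟩
      add_mem' := by
        rintro a a' ⟨g, hg⟩ ⟨g', hg'⟩
        exact ⟨g + g', by rw [map_add, map_add, add_mul, hg, hg']⟩
      smul_mem' := by
        rintro c a ⟨g, hg⟩
        exact ⟨c * g, by rw [smul_eq_mul, map_mul, mul_assoc, hg, map_mul]⟩ }
  have hI : I.radical = ⊤ := by
    rw [eq_top_iff, ← hS', Ideal.span_le]
    intro b hb
    obtain ⟨N, g, hg⟩ := hd b hb s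
    refine ⟨N, (∏ b ∈ S'.erase b, d b) * g, ?_⟩
    rw [map_mul, ← hg, ← Finset.mul_prod_erase S' d hb, map_pow, map_mul]
    ring
  obtain ⟨g, hg⟩ := (Ideal.eq_top_iff_one I).1 (Ideal.radical_eq_top.1 hI)
  exact ⟨g, by rw [map_one, one_mul] at hg; exact hg⟩

/-- The group of sections of `kℒ` is finitely generated. -/
theorem finite_H0 {n : ℕ} (c : ProjectiveCharts X n) (L : LineBundle X) (k : ℕ) :
    Module.Finite ℤ (H0 L k) := by
  classical
  obtain ⟨F₀, hF₀⟩ := L.exists_frame (genericPoint X)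
  let κ : H0 L k →+ X.functionField :=
    { toFun := fun s => F₀.tensorCoord hF₀ k (s.1 (genericPoint X))
      map_zero' := map_zero (F₀.tensorCoord hF₀ k)
      map_add' := fun s s' => map_add (F₀.tensorCoord hF₀ k) _ _ }
  have hκ : Function.Injective κ := by
    intro s s' h
    refine F₀.coeff_injective hF₀ k ?_
    refine germ_injective_of_isIntegral X _ hF₀ ?_
    rw [F₀.germ_coeff, F₀.germ_coeff]
    exact h
  have hη : genericPoint X ∈ ⨆ j, c.U j := by rw [c.iSup_eq_top]; trivial
  obtain ⟨j₀, hj₀⟩ := Opens.mem_iSup.1 hη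
  let y : Fin (n + 1) → X.functionField := fun i => X.presheaf.germ _ _ hj₀ (c.r i j₀)
  have hy₀ : y j₀ = 1 := by simp only [y]; rw [c.r_self, map_one]
  -- In each chart, a fixed form value clears the denominators of all sections at once, up to a
  -- power of `y j` depending on the section.
  have hchart : ∀ j, ∃ (N : ℕ) (P : X.functionField), P ∈ formValues y N ∧ P ≠ 0 ∧
      ∀ s : H0 L k, ∃ M, y j ^ M * (P * κ s) ∈ formValues y (M + N) := by
    intro j
    by_cases hj : genericPoint X ∈ c.U j
    · let ι : Γ(X, c.U j) →+* X.functionField := (X.presheaf.germ _ _ hj).hom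
      have hι : Function.Injective ι := germ_injective_of_isIntegral X _ hj
      have hyj : ∀ i, ι (c.r i j) * y j = y i := fun i => c.germ_mul j j₀ i _ hj hj₀
      have hyj0 : y j ≠ 0 := by
        intro h
        have := hyj j₀
        rw [h, mul_zero, hy₀] at this
        exact zero_ne_one this
      have hdeg : ∀ g : Γ(X, c.U j), ∃ M, y j ^ M * ι g ∈ formValues y M := by
        intro g
        have hg : g ∈ Algebra.adjoin ℤ (Set.range fun i => c.r i j) := by
          rw [c.adjoin_eq_top]; trivial
        induction hg using Algebra.adjoin_induction with
        | mem g hg =>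
          obtain ⟨i, rfl⟩ := hg
          refine ⟨1, ?_⟩
          rw [pow_one, mul_comm, hyj]
          simpa using coord_pow_mem_formValues y i 1
        | algebraMap m =>
          refine ⟨0, mem_formValues.2 ⟨.C m, MvPolynomial.isHomogeneous_C _ _, ?_⟩⟩
          simp
        | add f g _ _ hf hg =>
          obtain ⟨M, hM⟩ := hf
          obtain ⟨M', hM'⟩ := hg
          refine ⟨M + M', ?_⟩
          have h1 := formValues_mul_mem hM (coord_pow_mem_formValues y j M')
          have h2 := formValues_mul_mem (coord_pow_mem_formValues y j M) hM'
          convert add_mem h1 h2 using 1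
          rw [map_add]
          ring
        | mul f g _ _ hf hg =>
          obtain ⟨M, hM⟩ := hf
          obtain ⟨M', hM'⟩ := hg
          refine ⟨M + M', ?_⟩
          convert formValues_mul_mem hM hM' using 1
          rw [map_mul]
          ring
      obtain ⟨d, hd0, hd⟩ := exists_common_denominator (c.isAffineOpen j) hj F₀ hF₀ k
      obtain ⟨N, hN⟩ := hdeg d
      refine ⟨N, _, hN, mul_ne_zero (pow_ne_zero _ hyj0) ((map_ne_zero_iff ι hι).2 hd0),
        fun s => ?_⟩
      obtain ⟨g, hg⟩ := hd s
      obtain ⟨M, hM⟩ := hdeg g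
      refine ⟨M, ?_⟩
      have hg' : ι d * κ s = ι g := hg
      convert formValues_mul_mem hM (coord_pow_mem_formValues y j N) using 1
      rw [← hg']
      ring
    -- A chart missing the generic point is empty of information: its coordinate is zero in the
    -- function field, so the condition at `j` is trivial.
    · have hyj : y j = 0 := by
        by_contra h
        refine hj (c.basicOpen_le j j₀ ?_)
        rw [X.mem_basicOpen _ _ hj₀]
        exact isUnit_iff_ne_zero.2 h
      refine ⟨0, 1, ?_, one_ne_zero, fun s => ⟨1, ?_⟩⟩
      · simpa using coord_pow_mem_formValues y j 0
      · rw [hyj, pow_one, zero_mul]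
        exact zero_mem _
  choose N P hPN hP0 hP using hchart
  obtain ⟨D, hD⟩ := exists_formValues_bound y hy₀ (∑ j, N j)
  have hprod : ∀ t : Finset (Fin (n + 1)), ∏ j ∈ t, P j ∈ formValues y (∑ j ∈ t, N j) := by
    intro t
    induction t using Finset.induction_on with
    | empty => simpa using coord_pow_mem_formValues y j₀ 0
    | insert a t ha ih =>
      rw [Finset.prod_insert ha, Finset.sum_insert ha]
      exact formValues_mul_mem (hPN a) ih
  -- The product of the chart multipliers satisfies the condition at every coordinate, so the degree
  -- bound applies uniformly in `s`.
  have hmem : ∀ s, (∏ j, P j) * κ s ∈ formValues y D := by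
    refine fun s => hD _ fun j => ?_
    obtain ⟨M, hM⟩ := hP j s
    refine ⟨M, ?_⟩
    have := formValues_mul_mem hM (hprod (Finset.univ.erase j))
    rw [← Finset.mul_prod_erase _ P (Finset.mem_univ j),
      ← Finset.add_sum_erase _ N (Finset.mem_univ j)]
    have e : y j ^ M * (P j * (∏ i ∈ Finset.univ.erase j, P i) * κ s) =
        y j ^ M * (P j * κ s) * ∏ i ∈ Finset.univ.erase j, P i := by ring
    rw [e, ← add_assoc]
    exact this
  have hfin : Module.Finite ℤ (formValues y D) := Module.Finite.iff_fg.2 (formValues_fg y D)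
  let T : H0 L k →ₗ[ℤ] formValues y D :=
    (LinearMap.codRestrict (formValues y D)
      ((LinearMap.mulLeft ℤ (∏ j, P j)).comp κ.toIntLinearMap) hmem)
  refine Module.Finite.of_injective T fun s s' h => hκ ?_
  exact mul_left_cancel₀ (Finset.prod_ne_zero_iff.2 fun j _ => hP0 j) (congrArg Subtype.val h)

end FiniteGeneration

/-- The function field of an integral scheme that is flat over `ℤ` has characteristic zero. -/
lemma charZero_functionField [IsIntegral X] [Flat (specZIsTerminal.from X)] :
    CharZero X.functionField := by
  obtain ⟨V, hV, hη, -⟩ := exists_isAffineOpen_mem_and_subset (X := X) (x := genericPoint X)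
    (U := ⊤) trivial
  have hflat := (specZIsTerminal.from X).flat_appLE (isAffineOpen_top (Spec (.of ℤ))) hV le_top
  set φ := ((specZIsTerminal.from X).appLE ⊤ V le_top).hom
  let e : Γ(Spec (.of ℤ), ⊤) ≃+* ℤ := (Scheme.ΓSpecIso (.of ℤ)).commRingCatIsoToRingEquiv
  have : IsDomain Γ(Spec (.of ℤ), ⊤) := e.toMulEquiv.isDomain ℤ
  let := φ.toAlgebra
  have : Module.Flat Γ(Spec (.of ℤ), ⊤) Γ(X, V) := hflat
  let ι : Γ(X, V) →+* X.functionField := (X.presheaf.germ V _ hη).hom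
  have hι : Function.Injective ι := germ_injective_of_isIntegral X _ hη
  -- Flatness makes multiplication by a nonzero integer injective on functions; applied to 1, it
  -- shows that the integer stays nonzero.
  have hφ : ∀ r, φ r = 0 → r = 0 := by
    intro r hr
    by_contra h
    have h1 := (Module.IsTorsionFree.isSMulRegular (M := Γ(X, V)) (IsRegular.of_ne_zero h))
    have h2 : r • (1 : Γ(X, V)) = r • 0 := by
      rw [Algebra.smul_def, mul_one, smul_zero]
      exact hr
    have h3 := congrArg ι (h1 h2)
    rw [map_one, map_zero] at h3
    exact one_ne_zero h3
  refine charZero_of_inj_zero fun m hm => ?_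
  rw [← map_natCast ι, map_eq_zero_iff ι hι, ← map_natCast φ] at hm
  have := congrArg e (hφ _ hm)
  rw [map_natCast, map_zero] at this
  exact_mod_cast this

lemma isTorsionFree_H0 [IsIntegral X] [CharZero X.functionField] (L : LineBundle X) (k : ℕ) :
    Module.IsTorsionFree ℤ (H0 L k) := by
  obtain ⟨F, hF⟩ := L.exists_frame (genericPoint X)
  let κ : H0 L k →+ X.functionField :=
    { toFun := fun s => X.presheaf.germ _ _ hF (F.coeff s)
      map_zero' := by
        rw [F.germ_coeff]
        exact map_zero (F.tensorCoord hF k)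
      map_add' := fun s s' => by rw [F.coeff_add, map_add] }
  have hκ : Function.Injective κ := fun s s' h =>
    F.coeff_injective hF k (germ_injective_of_isIntegral X _ hF h)
  exact Function.Injective.moduleIsTorsionFree κ hκ fun m s => map_zsmul κ m s

end

/-! ### Submersive presentations as holomorphic submersions -/

section

section Submersive

open MvPolynomial

variable {R S ι σ : Type*} [CommRing R] [CommRing S] [Algebra R S]

lemma hasFDerivAt_eval [Fintype ι] (p : MvPolynomial ι ℂ) (z : ι → ℂ) :
    HasFDerivAt (fun z : ι → ℂ => eval z p)
      (∑ i, eval z (pderiv i p) • (ContinuousLinearMap.proj i : (ι → ℂ) →L[ℂ] ℂ)) z := by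
  classical
  induction p using MvPolynomial.induction_on with
  | C a =>
    have h : HasFDerivAt (fun _ : ι → ℂ => a) (0 : (ι → ℂ) →L[ℂ] ℂ) z := hasFDerivAt_const a z
    simp only [eval_C]
    refine h.congr_fderiv ?_
    ext v
    simp
  | add p q hp hq =>
    have h := hp.add hq
    simp only [map_add]
    refine h.congr_fderiv ?_
    ext v
    simp [add_mul, Finset.sum_add_distrib]
  | mul_X p j hp =>
    have h := hp.mul (ContinuousLinearMap.proj j : (ι → ℂ) →L[ℂ] ℂ).hasFDerivAt
    simp only [map_mul, eval_X]
    refine h.congr_fderiv ?_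
    ext v
    simp [pderiv_X, Pi.single_apply, Finset.sum_add_distrib, add_mul, Finset.mul_sum,
      apply_ite (f := eval z)]
    exact Finset.sum_congr rfl fun _ _ => (mul_assoc _ _ _).symm

/-- The points of the zero locus of the relations of a presentation are the `ℂ`-points. -/
lemma exists_ringHom_of_relations (P : Algebra.Presentation R S ι σ) (ρ : R →+* ℂ) (z : ι → ℂ)
    (hz : ∀ j, eval₂ ρ z (P.relation j) = 0) :
    ∃ χ : S →+* ℂ, ∀ p : MvPolynomial ι R, χ (aeval P.val p) = eval₂ ρ z p := by
  have hker : ∀ p, aeval P.val p = 0 → eval₂ ρ z p = 0 := by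
    intro p hp
    have : p ∈ P.ker := by rw [P.ker_eq_ker_aeval_val]; exact hp
    rw [← P.span_range_relation_eq_ker] at this
    have hle : Ideal.span (Set.range P.relation) ≤ RingHom.ker (eval₂Hom ρ z) := by
      rw [Ideal.span_le]
      rintro _ ⟨j, rfl⟩
      exact hz j
    exact hle this
  have hsurj : Function.Surjective (aeval (R := R) P.val) := fun s => ⟨P.σ s, P.aeval_val_σ s⟩
  refine ⟨(aeval (R := R) P.val).toRingHom.liftOfSurjective hsurj ⟨eval₂Hom ρ z, fun p hp => hker p hp⟩,
    fun p => ?_⟩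
  exact RingHom.liftOfRightInverse_comp_apply _ _ _ _ p

/-- The relations of a submersive presentation define a submersion at the points of their zero
locus. -/
lemma exists_hasFDerivAt_surjective [Fintype ι] [Fintype σ]
    (P : Algebra.SubmersivePresentation R S ι σ) (ρ : R →+* ℂ) (z : ι → ℂ) (χ : S →+* ℂ)
    (hχ : ∀ p : MvPolynomial ι R, χ (aeval P.val p) = eval₂ ρ z p) :
    ∃ f' : (ι → ℂ) →L[ℂ] (σ → ℂ), Function.Surjective f' ∧
      HasFDerivAt (fun (z : ι → ℂ) (j : σ) => eval₂ ρ z (P.relation j)) f' z := by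
  classical
  let f' : (ι → ℂ) →L[ℂ] (σ → ℂ) := ContinuousLinearMap.pi fun j =>
    ∑ i, eval z (pderiv i (map ρ (P.relation j))) •
      (ContinuousLinearMap.proj i : (ι → ℂ) →L[ℂ] ℂ)
  refine ⟨f', ?_, ?_⟩
  -- The Jacobian minor of the presentation is a unit in `S`, so its image under `χ` is nonzero.
  -- Directions in the variables `P.map i` already span the target.
  · let J : Matrix σ σ ℂ := fun i j => eval z (pderiv (P.map i) (map ρ (P.relation j)))
    have hJ : IsUnit J.det := by
      have h := P.jacobian_isUnit.map χ
      rw [Algebra.PreSubmersivePresentation.jacobian_eq_jacobiMatrix_det, P.algebraMap_eq] at h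
      change IsUnit (χ (aeval P.val _)) at h
      rw [hχ, ← coe_eval₂Hom, RingHom.map_det] at h
      convert h using 2
      ext i j
      simp only [J, RingHom.mapMatrix_apply, Matrix.map_apply,
        Algebra.PreSubmersivePresentation.jacobiMatrix_apply, coe_eval₂Hom, pderiv_map, MvPolynomial.eval_map]
    intro w
    obtain ⟨u, hu⟩ : ∃ u, Matrix.vecMul u J = w :=
      (Matrix.vecMul_surjective_iff_isUnit.2 ((Matrix.isUnit_iff_isUnit_det J).2 hJ)) w
    refine ⟨∑ i, u i • Pi.single (P.map i) 1, ?_⟩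
    rw [map_sum, ← hu]
    ext j
    simp [f', J, Matrix.vecMul, dotProduct, Finset.sum_apply, Pi.single_apply]
  · refine hasFDerivAt_pi.2 fun j => ?_
    have h := hasFDerivAt_eval (map ρ (P.relation j)) z
    simp only [MvPolynomial.eval_map] at h
    exact h

end Submersive

end

/-! ### Identity principle on smooth `ℚ`-schemes -/

section

open Filter Topology

variable {Y : Scheme.{0}}

open MvPolynomial in
/-- Identity principle on an affine open set with a submersive presentation over a ring with a
unique homomorphism to `ℂ`. -/
lemma eventually_eq_zero_of_submersivePresentation {V : Y.Opens} (hV : IsAffineOpen V)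
    {R : Type*} [CommRing R] [Algebra R Γ(Y, V)] [Subsingleton (R →+* ℂ)] {ι σ : Type*}
    [Fintype ι] [Fintype σ] (P : Algebra.SubmersivePresentation R Γ(Y, V) ι σ)
    {κ : Type*} [Fintype κ] (f : κ → Γ(Y, V)) (a : κ → ℂ) {O : Set (ComplexPoints Y)}
    (hO : IsOpen O) (hOV : ∀ x ∈ O, x.pt ∈ V) (h0 : ∀ x ∈ O, ∑ i, a i * ComplexPoints.value (f i) x = 0)
    {y : ComplexPoints Y} (hyV : y.pt ∈ V) (hy : y ∈ closure O) :
    ∀ᶠ x in 𝓝 y, ∑ i, a i * ComplexPoints.value (f i) x = 0 := by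
  -- The base ring has a unique homomorphism to `ℂ`, so the equations `Φ` with coefficients mapped
  -- by `ρ` serve for all points of `V` at once.
  let ρ : R →+* ℂ := (ComplexPoints.evalAt hyV).comp (algebraMap R Γ(Y, V))
  let z : ComplexPoints Y → ι → ℂ := fun x i => ComplexPoints.value (P.val i) x
  let Φ : (ι → ℂ) → σ → ℂ := fun w j => eval₂ ρ w (P.relation j)
  let g : (ι → ℂ) → ℂ := fun w => ∑ i, a i * eval₂ ρ w (P.σ (f i))
  have hz : ∀ x : ComplexPoints Y, x.pt ∈ V → ∀ p : MvPolynomial ι R,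
      ComplexPoints.value (aeval P.val p) x = eval₂ ρ (z x) p := by
    intro x hx p
    rw [← ComplexPoints.evalAt_apply hx, aeval_def, ← coe_eval₂Hom, ← RingHom.comp_apply,
      ← coe_eval₂Hom]
    congr 1
    refine MvPolynomial.ringHom_ext (fun r => ?_) (fun i => ?_)
    · simpa using RingHom.congr_fun (Subsingleton.elim
        ((ComplexPoints.evalAt hx).comp (algebraMap R Γ(Y, V))) ρ) r
    · simp [z, ComplexPoints.evalAt_apply]
  have hzΦ : ∀ x : ComplexPoints Y, x.pt ∈ V → Φ (z x) = 0 := by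
    intro x hx
    ext j
    change eval₂ ρ (z x) (P.relation j) = 0
    rw [← hz x hx, P.aeval_val_relation, ← ComplexPoints.evalAt_apply hx, map_zero]
  have hzg : ∀ x : ComplexPoints Y, x.pt ∈ V →
      g (z x) = ∑ i, a i * ComplexPoints.value (f i) x := by
    intro x hx
    refine Finset.sum_congr rfl fun i _ => ?_
    rw [← hz x hx, P.aeval_val_σ]
  have hzc : ∀ x : ComplexPoints Y, x.pt ∈ V → ContinuousAt z x := fun x hx =>
    continuousAt_pi.2 fun i => (ComplexPoints.continuousOn_value (P.val i)).continuousAt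
      ((ComplexPoints.isOpen_setOf_pt_mem V).mem_nhds hx)
  have han : ∀ p : MvPolynomial ι R, AnalyticOnNhd ℂ (fun w : ι → ℂ => eval₂ ρ w p) Set.univ := by
    intro p
    have := AnalyticOnNhd.eval_mvPolynomial (map ρ p)
    simpa only [MvPolynomial.eval_map] using this
  have hcont : ∀ p : MvPolynomial ι R, Continuous (fun w : ι → ℂ => eval₂ ρ w p) := fun p =>
    continuousOn_univ.1 (han p).continuousOn
  let χ : ∀ w : ι → ℂ, Φ w = 0 → Γ(Y, V) →+* ℂ := fun w hw =>
    (exists_ringHom_of_relations P.toPresentation ρ w fun j => congrFun hw j).choose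
  have hχ : ∀ w hw p, χ w hw (aeval P.val p) = eval₂ ρ w p := fun w hw =>
    (exists_ringHom_of_relations P.toPresentation ρ w fun j => congrFun hw j).choose_spec
  classical
  -- The inverse of the coordinate map `z` on the zero locus; outside the locus the value is
  -- arbitrary.
  let q : (ι → ℂ) → ComplexPoints Y := fun w =>
    if hw : Φ w = 0 then ComplexPoints.ofHom hV (χ w hw) else y
  have hqV : ∀ w, Φ w = 0 → (q w).pt ∈ V := by
    intro w hw
    simp only [q, dif_pos hw]
    exact ComplexPoints.pt_ofHom_mem _ _
  have hqval : ∀ w, Φ w = 0 → ∀ p, ComplexPoints.value (aeval P.val p) (q w) = eval₂ ρ w p := by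
    intro w hw p
    simp only [q, dif_pos hw]
    rw [ComplexPoints.value_ofHom, hχ w hw]
  have hqz : ∀ w, Φ w = 0 → z (q w) = w := by
    intro w hw
    ext i
    simpa using hqval w hw (X i)
  have hq : ∀ x : ComplexPoints Y, x.pt ∈ V → Tendsto q (𝓝 (z x) ⊓ 𝓟 {w | Φ w = 0}) (𝓝 x) := by
    intro x hx
    have hev : ∀ᶠ w in 𝓝 (z x) ⊓ 𝓟 {w | Φ w = 0}, Φ w = 0 :=
      mem_inf_of_right (mem_principal_self _)
    refine ComplexPoints.tendsto_nhds_of_affine hV hx (hev.mono fun w hw => hqV w hw) fun s => ?_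
    rw [← P.aeval_val_σ s, hz x hx]
    refine ((hcont (P.σ s)).continuousAt.tendsto.mono_left inf_le_left).congr' ?_
    exact hev.mono fun w hw => (hqval w hw _).symm
  -- An open set of the ambient space is needed: continuity of `q` along the locus puts the image of
  -- `O` into this interior.
  let Ω : Set (ι → ℂ) := interior {w | Φ w = 0 → g w = 0}
  have hΩ : ∀ x ∈ O, z x ∈ Ω := by
    intro x hx
    rw [mem_interior_iff_mem_nhds]
    have h := (hq x (hOV x hx)).eventually (hO.mem_nhds hx)
    rw [eventually_inf_principal] at h
    filter_upwards [h] with w hw hw0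
    have h1 := hzg _ (hqV w hw0)
    rw [hqz w hw0] at h1
    rw [h1]
    exact h0 _ (hw hw0)
  obtain ⟨f', hf's, hf'⟩ := exists_hasFDerivAt_surjective P ρ (z y) (ComplexPoints.evalAt hyV)
    (fun p => by rw [ComplexPoints.evalAt_apply]; exact hz y hyV p)
  have hmem : z y ∈ closure (Ω ∩ {w | Φ w = 0}) := by
    rw [mem_closure_iff_nhds]
    intro N hN
    obtain ⟨x, hxN, hxO⟩ := mem_closure_iff_nhds.1 hy _ ((hzc y hyV).preimage_mem_nhds hN)
    exact ⟨z x, hxN, hΩ x hxO, hzΦ x (hOV x hxO)⟩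
  have hfin := eventually_eq_zero_of_mem_closure (f := Φ) (a := z y) (g := g)
    (contDiffAt_pi.2 fun j => (han (P.relation j) (z y) trivial).contDiffAt) hf' hf's
    (by
      refine Differentiable.fun_sum fun i _ => (differentiableOn_univ.1 ?_).const_mul _
      exact (han _).differentiableOn)
    isOpen_interior (fun w hw => interior_subset hw) hmem
  filter_upwards [(hzc y hyV).eventually hfin,
    (ComplexPoints.isOpen_setOf_pt_mem V).mem_nhds hyV] with x hx hxV
  rw [← hzg x hxV]
  exact hx (hzΦ x hxV)

/-- Identity principle on the complex points of a smooth `ℚ`-scheme. -/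
lemma eventually_eq_zero_of_smooth (q : Y ⟶ Spec (.of ℚ)) [Smooth q] {U : Y.Opens}
    {κ : Type*} [Fintype κ] (f : κ → Γ(Y, U)) (a : κ → ℂ) {O : Set (ComplexPoints Y)}
    (hO : IsOpen O) (h0 : ∀ x ∈ O, x.pt ∈ U → ∑ i, a i * ComplexPoints.value (f i) x = 0)
    {y : ComplexPoints Y} (hyU : y.pt ∈ U) (hy : y ∈ closure O) :
    ∀ᶠ x in 𝓝 y, ∑ i, a i * ComplexPoints.value (f i) x = 0 := by
  obtain ⟨U', hU', V, hV, hyV, hVU', hsm⟩ := Smooth.exists_isStandardSmooth q y.pt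
  have hR : Subsingleton (Γ(Spec (.of ℚ), U') →+* ℂ) := by
    -- `Spec ℚ` has one point, so the base ring of the presentation is `ℚ`.
    have : U' = ⊤ := by
      ext p
      have : p = q y.pt := Subsingleton.elim (α := PrimeSpectrum ℚ) _ _
      simpa [this] using hVU' hyV
    subst this
    let e : Γ(Spec (.of ℚ), ⊤) ≃+* ℚ := (Scheme.ΓSpecIso (.of ℚ)).commRingCatIsoToRingEquiv
    refine ⟨fun u v => ?_⟩
    have := RingHom.ext_rat (u.comp e.symm.toRingHom) (v.comp e.symm.toRingHom)
    ext r
    have h := RingHom.congr_fun this (e r)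
    change u (e.symm (e r)) = v (e.symm (e r)) at h
    rwa [e.symm_apply_apply] at h
  let := (q.appLE U' V hVU').hom.toAlgebra
  have hsm' : Algebra.IsStandardSmooth Γ(Spec (.of ℚ), U') Γ(Y, V) := hsm
  obtain ⟨ι, σ, _, _, ⟨P⟩⟩ := hsm'.out
  have := Fintype.ofFinite ι
  have := Fintype.ofFinite σ
  -- The functions live on `U`, the presentation on `V`. A common factor `b ^ N`, nonzero near `y`,
  -- extends them to `V` without changing the relation.
  obtain ⟨b, hb, hyb⟩ := hV.exists_basicOpen_le ⟨y.pt, hyU⟩ hyV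
  have hbV := Y.basicOpen_le b
  have hloc := hV.isLocalization_basicOpen b
  obtain ⟨⟨_, N, rfl⟩, hN⟩ := IsLocalization.exist_integer_multiples_of_finite
    (Submonoid.powers b) (fun i => Y.presheaf.map (homOfLE hb).op (f i))
  choose c hc using hN
  simp only [Algebra.smul_def, RingHom.algebraMap_toAlgebra] at hc
  have hval : ∀ x : ComplexPoints Y, x.pt ∈ Y.basicOpen b → ∀ i,
      ComplexPoints.value (c i) x =
        ComplexPoints.value b x ^ N * ComplexPoints.value (f i) x := by
    intro x hx i
    have h := congrArg (ComplexPoints.evalAt hx) (hc i)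
    rw [map_mul, ComplexPoints.evalAt_apply, ComplexPoints.evalAt_apply,
      ComplexPoints.evalAt_apply, ComplexPoints.value_res hb _ hx] at h
    have e1 : ComplexPoints.value (Y.presheaf.map (homOfLE hbV).op (b ^ N)) x =
        ComplexPoints.value b x ^ N := by
      rw [ComplexPoints.value_res hbV _ hx, ← ComplexPoints.evalAt_apply (hbV hx), map_pow,
        ComplexPoints.evalAt_apply]
    have e2 : ComplexPoints.value (Y.presheaf.map (homOfLE hbV).op (c i)) x =
        ComplexPoints.value (c i) x := ComplexPoints.value_res hbV _ hx
    rw [← e1, ← e2]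
    exact h
  have hsum : ∀ x : ComplexPoints Y, x.pt ∈ Y.basicOpen b →
      ∑ i, a i * ComplexPoints.value (c i) x =
        ComplexPoints.value b x ^ N * ∑ i, a i * ComplexPoints.value (f i) x := by
    intro x hx
    rw [Finset.mul_sum]
    refine Finset.sum_congr rfl fun i _ => ?_
    rw [hval x hx]
    ring
  have hbo := ComplexPoints.isOpen_setOf_pt_mem (Y.basicOpen b)
  have := eventually_eq_zero_of_submersivePresentation hV P c a
    (O := O ∩ {x | x.pt ∈ Y.basicOpen b}) (hO.inter hbo) (fun x hx => hbV hx.2)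
    (fun x hx => by rw [hsum x hx.2, h0 x hx.1 (hb hx.2), mul_zero]) hyV
    (by
      rw [mem_closure_iff_nhds] at hy ⊢
      intro N hN
      obtain ⟨x, hx, hxO⟩ := hy _ (inter_mem hN (hbo.mem_nhds hyb))
      exact ⟨x, hx.1, hxO, hx.2⟩)
  filter_upwards [this, hbo.mem_nhds hyb] with x hx hxb
  rw [hsum x hxb] at hx
  exact (mul_eq_zero.1 hx).resolve_left
    (pow_ne_zero _ ((ComplexPoints.pt_mem_basicOpen b).1 hxb).2)

end

/-! ### Passage to the generic fibre -/

section

open Filter Topology Limits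

/-- A pushout of commutative rings is generated by the images of the two rings. -/
lemma mem_subring_of_isPushout {R A B C : CommRingCat.{0}} {f : R ⟶ A} {g : R ⟶ B} {i : A ⟶ C}
    {j : B ⟶ C} (h : IsPushout f g i j) (T : Subring C) (hi : ∀ a, i.hom a ∈ T)
    (hj : ∀ b, j.hom b ∈ T) (c : C) : c ∈ T := by
  let i' : A ⟶ CommRingCat.of T := CommRingCat.ofHom (i.hom.codRestrict T hi)
  let j' : B ⟶ CommRingCat.of T := CommRingCat.ofHom (j.hom.codRestrict T hj)
  let s : CommRingCat.of T ⟶ C := CommRingCat.ofHom T.subtype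
  have hi' : i' ≫ s = i := rfl
  have hj' : j' ≫ s = j := rfl
  have : Mono s := ConcreteCategory.mono_of_injective _ Subtype.val_injective
  -- The universal property splits the inclusion of the subring, so the subring is everything.
  let d := h.desc i' j' (by
    rw [← cancel_mono s, Category.assoc, Category.assoc, hi', hj']
    exact h.w)
  have hd : d ≫ s = 𝟙 _ := by
    refine h.hom_ext ?_ ?_
    · rw [← Category.assoc, h.inl_desc, hi', Category.comp_id]
    · rw [← Category.assoc, h.inr_desc, hj', Category.comp_id]
  have hc := congrArg (fun e => CommRingCat.Hom.hom e c) hd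
  rw [← show s.hom (d.hom c) = c from hc]
  exact (d.hom c).2

namespace ComplexPoints

variable {X Y : Scheme.{0}}

/-- The map on complex points induced by a morphism of schemes. -/
def map (f : Y ⟶ X) (y : ComplexPoints Y) : ComplexPoints X :=
  ((show Spec (.of ℂ) ⟶ Y from y) ≫ f : Spec (.of ℂ) ⟶ X)

lemma value_map (f : Y ⟶ X) (y : ComplexPoints Y) {U : X.Opens} (h : Γ(X, U)) :
    value h (map f y) = value (f.app U h) y := by
  by_cases hy : y.pt ∈ f ⁻¹ᵁ U
  · rw [value_of_mem _ hy, value_of_mem (x := map f y) _ hy]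
    have h1 : (map f y).ev = y.ev.comp (f.stalkMap y.pt).hom := by
      have := Scheme.stalkClosedPointTo_comp (show Spec (.of ℂ) ⟶ Y from y) f
      exact congrArg CommRingCat.Hom.hom this
    rw [h1]
    refine congrArg y.ev ?_
    exact Scheme.Hom.germ_stalkMap_apply f U y.pt hy h
  · rw [value, value, dif_neg, dif_neg hy]
    exact hy

lemma continuous_map (f : Y ⟶ X) : Continuous (map f) := by
  refine continuous_generateFrom_iff.2 ?_
  rintro _ ⟨U, h, W, hW, rfl⟩
  refine TopologicalSpace.isOpen_generateFrom_of_mem ⟨f ⁻¹ᵁ U, f.app U h, W, hW, ?_⟩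
  ext y
  change (map f y).pt ∈ U ∧ value h (map f y) ∈ W ↔ _
  rw [value_map]
  rfl

end ComplexPoints

section GenericFibre

variable (X : Scheme.{0})

/-- The generic fibre of a scheme over `ℤ`. -/
abbrev genericFibre : Scheme.{0} :=
  pullback (specZIsTerminal.from X) (Spec.map (CommRingCat.ofHom (Int.castRingHom ℚ)))

/-- The projection of the generic fibre. -/
abbrev genericFibre.fst : genericFibre X ⟶ X := pullback.fst _ _

variable {X}

lemma genericFibre.isAffineOpen_preimage {V : X.Opens} (hV : IsAffineOpen V) :
    IsAffineOpen (genericFibre.fst X ⁻¹ᵁ V) := 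
  have : IsAffineHom (genericFibre.fst X) :=
    (isAffineHom_isStableUnderBaseChange.of_isPullback
      (IsPullback.of_hasPullback _ _).flip inferInstance)
  hV.preimage _

/-- Regular functions on the generic fibre of an affine open set are regular functions up to
denominators. -/
lemma genericFibre.exists_natCast_mul_eq {V : X.Opens} (hV : IsAffineOpen V)
    (h : Γ(genericFibre X, genericFibre.fst X ⁻¹ᵁ V)) :
    ∃ (N : ℕ) (f : Γ(X, V)), N ≠ 0 ∧ N * h = (genericFibre.fst X).app V f := by
  have H := IsPullback.of_hasPullback (specZIsTerminal.from X)
    (Spec.map (CommRingCat.ofHom (Int.castRingHom ℚ)))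
  have hiso := isIso_pushoutSection_of_isAffineOpen H (US := ⊤) (UT := ⊤) (UX := V)
    (UY := genericFibre.fst X ⁻¹ᵁ V) le_top le_top (by simp) (isAffineOpen_top _)
    (isAffineOpen_top _) hV
  have hpo := (isIso_pushoutSection_iff H (US := ⊤) (UT := ⊤) (UX := V)
    (UY := genericFibre.fst X ⁻¹ᵁ V) le_top le_top (by simp)).1 hiso
  let e : Γ(Spec (.of ℚ), ⊤) ≃+* ℚ := (Scheme.ΓSpecIso (.of ℚ)).commRingCatIsoToRingEquiv
  let T : Subring Γ(genericFibre X, genericFibre.fst X ⁻¹ᵁ V) :=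
    { carrier := {h | ∃ (N : ℕ) (f : Γ(X, V)), N ≠ 0 ∧ N * h = (genericFibre.fst X).app V f}
      zero_mem' := ⟨1, 0, one_ne_zero, by simp⟩
      one_mem' := ⟨1, 1, one_ne_zero, by simp⟩
      add_mem' := by
        rintro h h' ⟨N, f, hN, hf⟩ ⟨N', f', hN', hf'⟩
        refine ⟨N * N', N' * f + N * f', mul_ne_zero hN hN', ?_⟩
        rw [map_add, map_mul, map_mul, ← hf, ← hf', map_natCast, map_natCast]
        push_cast
        ring
      neg_mem' := by
        rintro h ⟨N, f, hN, hf⟩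
        exact ⟨N, -f, hN, by rw [map_neg, ← hf, mul_neg]⟩
      mul_mem' := by
        rintro h h' ⟨N, f, hN, hf⟩ ⟨N', f', hN', hf'⟩
        refine ⟨N * N', f * f', mul_ne_zero hN hN', ?_⟩
        rw [map_mul, ← hf, ← hf']
        push_cast
        ring }
  suffices h ∈ T from this
  let i₁ := (genericFibre.fst X).appLE V (genericFibre.fst X ⁻¹ᵁ V) (by simp)
  let i₂ := (pullback.snd (specZIsTerminal.from X)
    (Spec.map (CommRingCat.ofHom (Int.castRingHom ℚ)))).appLE ⊤ (genericFibre.fst X ⁻¹ᵁ V) (by simp)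
  have h₁ : ∀ f, i₁.hom f ∈ T := by
    intro f
    refine ⟨1, f, one_ne_zero, ?_⟩
    rw [Nat.cast_one, one_mul]
    simp only [i₁, Scheme.Hom.appLE]
    simp
  have h₂ : ∀ r, i₂.hom r ∈ T := by
    intro r
    have hr : ((e r).den : Γ(Spec (.of ℚ), ⊤)) * r = ((e r).num : Γ(Spec (.of ℚ), ⊤)) := by
      apply e.injective
      rw [map_mul, map_natCast, map_intCast, Rat.den_mul_eq_num]
    refine ⟨(e r).den, (e r).num, (e r).den_nz, ?_⟩
    have := congrArg i₂.hom hr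
    rw [map_mul, map_natCast, map_intCast] at this
    rw [this, map_intCast]
  exact mem_subring_of_isPushout hpo T h₁ h₂ h

/-- A complex point of a scheme, as a complex point of the generic fibre. -/
def genericFibre.lift (x : ComplexPoints X) : ComplexPoints (genericFibre X) :=
  pullback.lift (show Spec (.of ℂ) ⟶ X from x)
    (Spec.map (CommRingCat.ofHom (algebraMap ℚ ℂ))) (specZIsTerminal.hom_ext _ _)

lemma genericFibre.map_lift (x : ComplexPoints X) :
    ComplexPoints.map (genericFibre.fst X) (genericFibre.lift x) = x :=
  pullback.lift_fst _ _ _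

/-- Functions on the generic fibre are functions on `X` divided by integers, so they impose no finer
topology. Thus local statements transfer between the two spaces of complex points. -/
lemma genericFibre.continuous_lift : Continuous (genericFibre.lift (X := X)) := by
  rw [continuous_iff_continuousAt]
  intro x
  obtain ⟨V, hV, hx, -⟩ := exists_isAffineOpen_mem_and_subset (X := X) (x := x.pt)
    (U := ⊤) trivial
  have hpt : ∀ z : ComplexPoints X, z.pt ∈ V → (genericFibre.lift z).pt ∈ genericFibre.fst X ⁻¹ᵁ V := by
    intro z hz
    rw [← genericFibre.map_lift z] at hz
    exact hz
  have hVn := (ComplexPoints.isOpen_setOf_pt_mem V).mem_nhds hx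
  refine ComplexPoints.tendsto_nhds_of_affine (genericFibre.isAffineOpen_preimage hV) (hpt x hx)
    (mem_of_superset hVn hpt) fun h => ?_
  obtain ⟨N, f, hN, hf⟩ := genericFibre.exists_natCast_mul_eq hV h
  have key : ∀ z : ComplexPoints X, z.pt ∈ V →
      ComplexPoints.value h (genericFibre.lift z) = ComplexPoints.value f z / N := by
    intro z hz
    have h1 := congrArg (ComplexPoints.evalAt (hpt z hz)) hf
    rw [map_mul, map_natCast, ComplexPoints.evalAt_apply, ComplexPoints.evalAt_apply,
      ← ComplexPoints.value_map, genericFibre.map_lift] at h1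
    rw [eq_div_iff (by exact_mod_cast hN), mul_comm, h1]
  rw [key x hx]
  refine (((ComplexPoints.continuousOn_value f).continuousAt hVn).tendsto.div_const (N : ℂ)).congr' ?_
  exact mem_of_superset hVn fun z hz => (key z hz).symm

/-- Identity principle on the complex points of a scheme with smooth generic fibre. -/
lemma eventually_eq_zero_of_smooth_genericFibre
    [Smooth (pullback.snd (specZIsTerminal.from X)
      (Spec.map (CommRingCat.ofHom (Int.castRingHom ℚ))))] {U : X.Opens}
    {κ : Type*} [Fintype κ] (f : κ → Γ(X, U)) (a : κ → ℂ) {O : Set (ComplexPoints X)}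
    (hO : IsOpen O) (h0 : ∀ x ∈ O, x.pt ∈ U → ∑ i, a i * ComplexPoints.value (f i) x = 0)
    {x : ComplexPoints X} (hxU : x.pt ∈ U) (hx : x ∈ closure O) :
    ∀ᶠ z in 𝓝 x, ∑ i, a i * ComplexPoints.value (f i) z = 0 := by
  let π := genericFibre.fst X
  have hc := ComplexPoints.continuous_map π
  have hl := genericFibre.continuous_lift (X := X)
  have hpt : (genericFibre.lift x).pt ∈ π ⁻¹ᵁ U := by
    rw [← genericFibre.map_lift x] at hxU
    exact hxU
  have := eventually_eq_zero_of_smooth (pullback.snd (specZIsTerminal.from X)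
      (Spec.map (CommRingCat.ofHom (Int.castRingHom ℚ)))) (fun i => π.app U (f i)) a
    (hO.preimage hc) (fun y hy hyU => by
      simp only [← ComplexPoints.value_map]
      exact h0 _ hy hyU) hpt (by
      rw [mem_closure_iff_nhds] at hx ⊢
      intro N hN
      obtain ⟨z, hzN, hzO⟩ := hx _ (hl.continuousAt.preimage_mem_nhds hN)
      refine ⟨_, hzN, ?_⟩
      change ComplexPoints.map _ (genericFibre.lift z) ∈ O
      rwa [genericFibre.map_lift])
  filter_upwards [hl.continuousAt.eventually this] with z hz
  simpa only [← ComplexPoints.value_map, π, genericFibre.map_lift] using hz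

end GenericFibre

end

/-! ### Vanishing of complex combinations of sections -/

section

open Filter Topology

variable {X : Scheme.{0}} {L : LineBundle X} {k : ℕ} {κ : Type*} [Fintype κ]

/-- The value at `x` of the linear combination `∑ aᵢ sᵢ` with complex coefficients, in the
trivialization of the fibre of `kℒ` given by a chosen vector of the dual. -/
def combination (a : κ → ℂ) (s : κ → H0 L k) (x : ComplexPoints X) : ℂ :=
  ∑ i, a i * (DualPoint.above L x).pow k ((s i).1 (DualPoint.above L x).x.pt)

lemma combination_eq (a : κ → ℂ) (s : κ → H0 L k) (F : LocalFrame L.sheaf)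
    {x : ComplexPoints X} (hd : (DualPoint.above L x).x.pt ∈ F.U) :
    combination a s x = (∑ i, a i * ComplexPoints.value (F.coeff (s i)) x) *
      (DualPoint.above L x).pair hd F.e ^ k := by
  rw [combination, Finset.sum_mul]
  refine Finset.sum_congr rfl fun i _ => ?_
  rw [F.pow_eq (s i) _ hd, DualPoint.above_x, mul_assoc]

/-- A frame pairs nontrivially with every nonzero dual vector, so vanishing can be tested on the
regular coefficients. -/
lemma combination_eq_zero_iff (a : κ → ℂ) (s : κ → H0 L k) (F : LocalFrame L.sheaf)
    {x : ComplexPoints X} (hx : x.pt ∈ F.U) :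
    combination a s x = 0 ↔ ∑ i, a i * ComplexPoints.value (F.coeff (s i)) x = 0 := by
  have hd : (DualPoint.above L x).x.pt ∈ F.U := by rw [DualPoint.above_x]; exact hx
  rw [combination_eq a s F hd, mul_eq_zero,
    or_iff_left (pow_ne_zero _ (DualPoint.v_frame_ne_zero _ F hd))]

/-- The logarithm of the absolute value of a holomorphic function is plurisubharmonic. -/
lemma isPSH_log_enorm {U : X.Opens} (f : κ → Γ(X, U)) (a : κ → ℂ) {W : Set (ComplexPoints X)}
    (hW : ∀ x ∈ W, x.pt ∈ U) :
    IsPSH W (fun x => ENNReal.log ‖∑ i, a i * ComplexPoints.value (f i) x‖ₑ) := by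
  have hc : ContinuousOn (fun x => ∑ i, a i * ComplexPoints.value (f i) x) {x | x.pt ∈ U} :=
    continuousOn_finsetSum _ fun i _ => (ComplexPoints.continuousOn_value (f i)).const_mul _
  refine ⟨?_, fun x _ => ?_, ?_⟩
  · exact ((ENNReal.continuous_log.comp_continuousOn hc.enorm).mono hW).upperSemicontinuousOn
  · simp [ENNReal.log_lt_top_iff]
  · intro γ D hD hDb hγ hγW h hh hle
    have hD' : IsOpen (D ∩ {z | (γ z).pt ∈ U}) :=
      hγ.1.isOpen_inter_preimage hD (ComplexPoints.isOpen_setOf_pt_mem U)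
    refine log_enorm_le_circleAverage (D := D ∩ {z | (γ z).pt ∈ U})
      (g := fun z => ∑ i, a i * ComplexPoints.value (f i) (γ z)) hD'
      (fun z hz => ⟨hDb hz, hW _ (hγW z hz)⟩) ?_ hh hle
    exact DifferentiableOn.fun_sum fun i _ => (hγ.2 U (f i)).const_mul _

section

variable [Smooth (Limits.pullback.snd (specZIsTerminal.from X)
      (Spec.map (CommRingCat.ofHom (Int.castRingHom ℚ))))]

/-- The interior of the zero set of a section of `kℒ` is closed. -/
lemma isClosed_interior_combination (a : κ → ℂ) (s : κ → H0 L k) :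
    IsClosed (interior {x | combination a s x = 0}) := by
  refine isClosed_of_closure_subset fun x hx => ?_
  obtain ⟨F, hF⟩ := L.exists_frame x.pt
  rw [mem_interior_iff_mem_nhds]
  have := eventually_eq_zero_of_smooth_genericFibre (fun i => F.coeff (s i)) a isOpen_interior
    (fun y hy hyU => (combination_eq_zero_iff a s F hyU).1
      (show y ∈ {x | combination a s x = 0} from interior_subset hy)) hF hx
  filter_upwards [this, (ComplexPoints.isOpen_setOf_pt_mem F.U).mem_nhds hF] with y hy hyF
  exact (combination_eq_zero_iff a s F hyF).2 hy

/-- A section of `kℒ` that vanishes on a set meeting every connected component in a non-pluripolar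
set vanishes identically. -/
lemma combination_eq_zero_of_not_isPluripolar (a : κ → ℂ) (s : κ → H0 L k)
    {E : Set (ComplexPoints X)} (hE : ∀ x, ¬ IsPluripolar (E ∩ connectedComponent x))
    (h0 : ∀ x ∈ E, combination a s x = 0) (x : ComplexPoints X) : combination a s x = 0 := by
  set G := interior {x | combination a s x = 0}
  have hG : IsClosed G := isClosed_interior_combination a s
  -- If the component misses `G`, then off `G` the function `log |∑ aᵢ fᵢ|` is plurisubharmonic, is
  -- not `-∞` on any nonempty open set, and equals `-∞` on `E`; so `E` would be pluripolar in this
  -- component.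
  obtain ⟨y, hyx, hyG⟩ : (connectedComponent x ∩ G).Nonempty := by
    by_contra hne
    refine hE x fun z hz => ?_
    obtain ⟨F, hF⟩ := L.exists_frame z.pt
    refine ⟨{y | y.pt ∈ F.U} ∩ Gᶜ,
      (ComplexPoints.isOpen_setOf_pt_mem F.U).inter hG.isOpen_compl,
      ⟨hF, fun hzG => hne ⟨z, hz.2, hzG⟩⟩, _,
      isPSH_log_enorm (fun i => F.coeff (s i)) a fun y hy => hy.1, ?_, ?_⟩
    · intro V hV hVW ⟨v, hv⟩
      by_contra! hbot
      refine (hVW hv).2 (mem_interior.2 ⟨V, fun y hy => ?_, hV, hv⟩)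
      have := hbot y hy
      rw [ENNReal.log_eq_bot_iff, enorm_eq_zero] at this
      exact (combination_eq_zero_iff a s F (hVW hy).1).2 this
    · rintro y ⟨⟨hyE, -⟩, hyU, -⟩
      rw [ENNReal.log_eq_bot_iff, enorm_eq_zero]
      exact (combination_eq_zero_iff a s F hyU).1 (h0 y hyE)
  have hsub := IsClopen.connectedComponent_subset ⟨hG, isOpen_interior⟩ hyG
  rw [← connectedComponent_eq hyx] at hsub
  exact show x ∈ {x | combination a s x = 0} from interior_subset (hsub mem_connectedComponent)

end

/-- Sections of `kℒ` that are linearly independent over `ℤ` define linearly independent functions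
on the set of complex points. -/
lemma eq_zero_of_combination_eq_zero [IsIntegral X] [CharZero X.functionField] {n : ℕ}
    (c : ProjectiveCharts X n) {s : κ → H0 L k} (hs : LinearIndependent ℤ s) {a : κ → ℂ}
    (h0 : ∀ x, combination a s x = 0) : a = 0 := by
  classical
  obtain ⟨F, hF⟩ := L.exists_frame (genericPoint X)
  have hη : genericPoint X ∈ ⨆ j, c.U j := by rw [c.iSup_eq_top]; trivial
  obtain ⟨j, hj⟩ := Opens.mem_iSup.1 hη
  obtain ⟨b, hb, hηb⟩ := (c.isAffineOpen j).exists_basicOpen_le ⟨_, hF⟩ hj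
  have hloc := (c.isAffineOpen j).isLocalization_basicOpen b
  let ι : Γ(X, X.basicOpen b) →+* X.functionField := (X.presheaf.germ _ _ hηb).hom
  let res : Γ(X, c.U j) →+* Γ(X, X.basicOpen b) :=
    (X.presheaf.map (homOfLE (X.basicOpen_le b)).op).hom
  have hres : ∀ g, ∃ (f : Γ(X, c.U j)) (N : ℕ), g * res b ^ N = res f := by
    intro g
    obtain ⟨⟨f, ⟨_, N, rfl⟩⟩, hf⟩ := IsLocalization.surj (Submonoid.powers b) g
    refine ⟨f, N, ?_⟩
    rw [← map_pow]
    exact hf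
  -- These elements generate over `ℚ` an algebra of finite type containing all functions on the
  -- chosen basic open set. Its homomorphisms to `ℂ` are complex points, at which the combination
  -- vanishes.
  let T : Set X.functionField :=
    Set.range (fun i => ι (res (c.r i j))) ∪ {(ι (res b))⁻¹}
  have hT : T.Finite := (Set.finite_range _).union (Set.finite_singleton _)
  let B : Subalgebra ℚ X.functionField := Algebra.adjoin ℚ T
  have hBft : Algebra.FiniteType ℚ B :=
    B.fg_iff_finiteType.1 ⟨hT.toFinset, by rw [hT.coe_toFinset]⟩
  have hb0 : ι (res b) ≠ 0 := by
    have := (X.mem_basicOpen b _ hj).1 hηb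
    have e : ι (res b) = X.presheaf.germ _ _ hj b := TopCat.Presheaf.germ_res_apply _ _ _ _ _
    rw [e]
    exact this.ne_zero
  have hresB : ∀ f, ι (res f) ∈ B := by
    intro f
    have hf : f ∈ Algebra.adjoin ℤ (Set.range fun i => c.r i j) := by
      rw [c.adjoin_eq_top]; trivial
    induction hf using Algebra.adjoin_induction with
    | mem f hf =>
      obtain ⟨i, rfl⟩ := hf
      exact Algebra.subset_adjoin (Or.inl ⟨i, rfl⟩)
    | algebraMap m => simp
    | add f g _ _ hf hg => rw [map_add, map_add]; exact add_mem hf hg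
    | mul f g _ _ hf hg => rw [map_mul, map_mul]; exact mul_mem hf hg
  have hιB : ∀ g, ι g ∈ B := by
    intro g
    obtain ⟨f, N, hf⟩ := hres g
    have h1 : ι g = ι (res f) * (ι (res b))⁻¹ ^ N := by
      rw [← hf, map_mul, map_pow, inv_pow, mul_assoc, mul_inv_cancel₀ (pow_ne_zero _ hb0), mul_one]
    rw [h1]
    have h2 : (ι (res b))⁻¹ ∈ B := Algebra.subset_adjoin (Or.inr rfl)
    exact mul_mem (hresB f) (pow_mem h2 N)
  let ιB : Γ(X, X.basicOpen b) →+* B := ι.codRestrict B hιB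
  let f : κ → Γ(X, X.basicOpen b) := fun i => X.presheaf.map (homOfLE hb).op (F.coeff (s i))
  have hf : LinearIndependent ℚ (fun i => ιB (f i)) := by
    refine LinearIndependent.of_comp B.val.toLinearMap ?_
    let T₀ : H0 L k →+ X.functionField :=
      { toFun := fun s => X.presheaf.germ _ _ hF (F.coeff s)
        map_zero' := by
          rw [F.germ_coeff]
          exact map_zero (F.tensorCoord hF k)
        map_add' := fun s s' => by rw [F.coeff_add, map_add] }
    have hT₀ : Function.Injective T₀.toIntLinearMap := fun s s' h =>
      F.coeff_injective hF k (germ_injective_of_isIntegral X _ hF h)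
    have h1 := hs.map' T₀.toIntLinearMap (LinearMap.ker_eq_bot.2 hT₀)
    rw [LinearIndependent.iff_fractionRing ℤ ℚ] at h1
    have e : B.val.toLinearMap ∘ (fun i => ιB (f i)) = T₀.toIntLinearMap ∘ s := funext fun i =>
      TopCat.Presheaf.germ_res_apply X.presheaf (homOfLE hb) _ hηb (F.coeff (s i))
    rw [e]
    exact h1
  refine eq_zero_of_forall_algHom_complex hf fun σ => ?_
  have hV := (c.isAffineOpen j).basicOpen b
  let x := ComplexPoints.ofHom hV ((σ : B →+* ℂ).comp ιB)
  have hx : x.pt ∈ X.basicOpen b := ComplexPoints.pt_ofHom_mem _ _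
  have h := (combination_eq_zero_iff a s F (hb hx)).1 (h0 x)
  rw [← h]
  refine Finset.sum_congr rfl fun i _ => ?_
  rw [← ComplexPoints.value_res hb (F.coeff (s i)) hx]
  exact congrArg _ (ComplexPoints.value_ofHom hV ((σ : B →+* ℂ).comp ιB) (f i)).symm

end

/-! ### Positive definiteness and the Gaussian family of sections -/

section

open Filter Topology

variable {X : Scheme.{0}} {L : LineBundle X} {k : ℕ} {κ : Type*} [Fintype κ]

lemma DualPoint.pow_add (w : DualPoint L) (k : ℕ)
    (t t' : ⨂[X.presheaf.stalk w.x.pt]^k (L.stalk w.x.pt)) :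
    w.pow k (t + t') = w.pow k t + w.pow k t' := by
  let : Algebra (X.presheaf.stalk w.x.pt) ℂ := w.x.ev.toAlgebra
  exact map_add _ t t'

/-- The evaluation of sections of `kℒ` at a non-zero vector of the dual. -/
def DualPoint.evalSection (w : DualPoint L) (k : ℕ) : H0 L k →+ ℂ :=
  AddMonoidHom.mk' (fun s => w.pow k (s.1 w.x.pt)) fun _ _ => w.pow_add k _ _

lemma evalSection_sum (w : DualPoint L) (n : κ → ℤ) (s : κ → H0 L k) :
    w.pow k ((∑ i, n i • s i : H0 L k).1 w.x.pt) = ∑ i, (n i : ℂ) * w.pow k ((s i).1 w.x.pt) := by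
  change w.evalSection k (∑ i, n i • s i) = _
  rw [map_sum]
  refine Finset.sum_congr rfl fun i _ => ?_
  rw [map_zsmul, zsmul_eq_mul]
  rfl

/-- The norm at `x` of the linear combination `∑ aᵢ sᵢ` with real coefficients. -/
def combinationNorm (φ : Weight L) (s : κ → H0 L k) (a : κ → ℝ) (x : ComplexPoints X) : ℝ :=
  ‖combination (fun i => (a i : ℂ)) s x‖ * Real.exp (-(k * φ.toFun (DualPoint.above L x)))

lemma pointNorm_sum (φ : Weight L) (s : κ → H0 L k) (n : κ → ℤ) (x : ComplexPoints X) :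
    pointNorm φ (∑ i, n i • s i) x = combinationNorm φ s (fun i => (n i : ℝ)) x := by
  rw [pointNorm, combinationNorm, combination, evalSection_sum]
  simp

lemma combinationNorm_nonneg (φ : Weight L) (s : κ → H0 L k) (a : κ → ℝ) (x : ComplexPoints X) :
    0 ≤ combinationNorm φ s a x := mul_nonneg (norm_nonneg _) (Real.exp_pos _).le

lemma combinationNorm_smul (φ : Weight L) (s : κ → H0 L k) (t : ℝ) (a : κ → ℝ)
    (x : ComplexPoints X) :
    combinationNorm φ s (t • a) x = |t| * combinationNorm φ s a x := by
  have : combination (fun i => ((t • a) i : ℂ)) s x = t * combination (fun i => (a i : ℂ)) s x := by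
    simp [combination, Finset.mul_sum, mul_assoc]
  rw [combinationNorm, combinationNorm, this, norm_mul, Complex.norm_real, Real.norm_eq_abs,
    mul_assoc]

lemma combinationNorm_le (φ : Weight L) (s : κ → H0 L k) (a : κ → ℝ) (x : ComplexPoints X) :
    combinationNorm φ s a x ≤ ∑ i, |a i| * pointNorm φ (s i) x := by
  rw [combinationNorm, combination]
  refine (mul_le_mul_of_nonneg_right (norm_sum_le _ _) (Real.exp_pos _).le).trans_eq ?_
  rw [Finset.sum_mul]
  refine Finset.sum_congr rfl fun i _ => ?_
  rw [norm_mul, Complex.norm_real, Real.norm_eq_abs, mul_assoc, pointNorm]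

lemma continuous_combinationNorm_left (φ : Weight L) (s : κ → H0 L k) (x : ComplexPoints X) :
    Continuous fun a => combinationNorm φ s a x := by
  unfold combinationNorm combination
  fun_prop

lemma continuous_combinationNorm (φ : Weight L) (hφ : Continuous φ.toFun) (s : κ → H0 L k)
    (a : κ → ℝ) : Continuous (combinationNorm φ s a) := by
  rw [continuous_iff_continuousAt]
  intro x
  obtain ⟨F, hF⟩ := L.exists_frame x.pt
  have hU := (ComplexPoints.isOpen_setOf_pt_mem F.U).mem_nhds (x := x) hF
  have h := F.continuousOn_dualFrame.continuousAt hU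
  have h' : ContinuousAt (fun x => ∑ i, (a i : ℂ) * ComplexPoints.value (F.coeff (s i)) x) x :=
    tendsto_finsetSum _ fun i _ =>
      ((ComplexPoints.continuousOn_value (F.coeff (s i))).continuousAt hU).const_mul _
  refine (h'.norm.mul (Real.continuous_exp.continuousAt.comp
    ((hφ.continuousAt.comp h).const_mul (k : ℝ)).neg)).congr ?_
  filter_upwards [hU] with y hy
  have hd : (DualPoint.above L y).x.pt ∈ F.U := by rw [DualPoint.above_x]; exact hy
  rw [combinationNorm, combination_eq _ s F hd, norm_mul, norm_pow, mul_assoc,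
    norm_pair_pow_mul_exp φ k F hd]
  rfl

variable (μ : Measure (ComplexPoints X)) [IsProbabilityMeasure μ]

lemma exists_combinationNorm_le [CompactSpace (ComplexPoints X)] (φ : Weight L)
    (hφ : Continuous φ.toFun) (s : κ → H0 L k) :
    ∃ B, 0 ≤ B ∧ ∀ a x, combinationNorm φ s a x ≤ B * ‖a‖ := by
  have h : ∀ i, ∃ B, ∀ x, pointNorm φ (s i) x ≤ B := fun i => by
    obtain ⟨B, hB⟩ := isCompact_univ.exists_bound_of_continuousOn
      (continuous_pointNorm φ hφ (s i)).continuousOn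
    exact ⟨B, fun x => (Real.le_norm_self _).trans (hB x trivial)⟩
  choose B hB using h
  refine ⟨∑ i, |B i|, Finset.sum_nonneg fun i _ => abs_nonneg _, fun a x => ?_⟩
  refine (combinationNorm_le φ s a x).trans ?_
  rw [Finset.sum_mul]
  refine Finset.sum_le_sum fun i _ => ?_
  rw [mul_comm]
  exact mul_le_mul ((hB i x).trans (le_abs_self _)) (norm_le_pi_norm a i) (abs_nonneg _)
    (abs_nonneg _)

/-- The squared `L²`-norm is positive definite. -/
lemma integral_combinationNorm_sq_pos (hX : IsArithmeticVariety X)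
    (hμ : ∀ x : ComplexPoints X, ¬ IsPluripolar (μ.support ∩ connectedComponent x))
    (φ : Weight L) (hφ : Continuous φ.toFun) {s : κ → H0 L k} (hs : LinearIndependent ℤ s)
    {a : κ → ℝ} (ha : a ≠ 0) : 0 < ∫ x, combinationNorm φ s a x ^ 2 ∂μ := by
  have := hX.isIntegral
  have := hX.flat
  have := hX.smooth_generic
  have := charZero_functionField (X := X)
  obtain ⟨n, i, hi⟩ := hX.projective
  let c := (projectiveSpaceCharts n).pullback i
  have := ComplexPoints.compactSpace c
  have hc := (continuous_combinationNorm φ hφ s a).pow 2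
  have hint : Integrable (fun x => combinationNorm φ s a x ^ 2) μ := by
    obtain ⟨B, hB⟩ := isCompact_univ.exists_bound_of_continuousOn hc.continuousOn
    exact Integrable.of_bound hc.measurable.aestronglyMeasurable B
      (ae_of_all _ fun x => hB x trivial)
  refine (integral_nonneg fun x => sq_nonneg _).lt_of_ne fun h => ha ?_
  have h0 := (integral_eq_zero_iff_of_nonneg (fun x => sq_nonneg _) hint).1 h.symm
  -- The zero set of the continuous integrand is closed and of full measure, hence contains the
  -- support.
  have hsupp : μ.support ⊆ {x | combinationNorm φ s a x ^ 2 = 0} :=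
    Measure.support_subset_of_isClosed (isClosed_eq hc continuous_const) h0
  have hz : ∀ x ∈ μ.support, combination (fun i => (a i : ℂ)) s x = 0 := by
    intro x hx
    have : combinationNorm φ s a x ^ 2 = 0 := hsupp hx
    rw [sq_eq_zero_iff, combinationNorm, mul_eq_zero, norm_eq_zero] at this
    exact this.resolve_right (Real.exp_pos _).ne'
  have := eq_zero_of_combination_eq_zero c hs (combination_eq_zero_of_not_isPluripolar _ s hμ hz)
  ext i
  exact Complex.ofReal_eq_zero.1 (congrFun this i)

/-- The squared norms of the sections of `kℒ` form a Gaussian family. -/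
theorem exists_gaussianFamily (hX : IsArithmeticVariety X)
    (hμ : ∀ x : ComplexPoints X, ¬ IsPluripolar (μ.support ∩ connectedComponent x))
    (φ ψ : Weight L) (hφ : Continuous φ.toFun) (hψ : Continuous ψ.toFun) (k : ℕ) :
    Countable (H0 L k) ∧ ∃ M C, GaussianFamily μ (fun (s : H0 L k) x => pointNorm ψ s x ^ 2)
      (φ.diff ψ) M C := by
  have := hX.isIntegral
  have := hX.flat
  have := charZero_functionField (X := X)
  obtain ⟨n, i, hi⟩ := hX.projective
  let c := (projectiveSpaceCharts n).pullback i
  have := ComplexPoints.compactSpace c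
  have := finite_H0 c L k
  have := isTorsionFree_H0 L k
  have : Module.Free ℤ (H0 L k) := inferInstance
  let b := Module.finBasis ℤ (H0 L k)
  let e := b.equivFun
  have hsum : ∀ s x, pointNorm ψ s x = combinationNorm ψ b (fun i => (e s i : ℝ)) x := by
    intro s x
    rw [← pointNorm_sum, b.sum_equivFun]
  obtain ⟨B, hB0, hB⟩ := exists_combinationNorm_le ψ hψ b
  have hcd := φ.continuous_diff ψ hφ hψ
  obtain ⟨C, hC⟩ := isCompact_univ.exists_bound_of_continuousOn hcd.continuousOn
  have hsq : ∀ a x, combinationNorm ψ b a x ^ 2 ≤ B ^ 2 * ‖a‖ ^ 2 := fun a x => by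
    rw [← mul_pow]
    exact pow_le_pow_left₀ (combinationNorm_nonneg _ _ _ _) (hB a x) 2
  -- The squared `L²`-norm extended from the lattice to real coefficient vectors; definiteness on
  -- integral vectors alone would not give convergence.
  let Q : (Fin (Module.finrank ℤ (H0 L k)) → ℝ) → ℝ := fun a => ∫ x, combinationNorm ψ b a x ^ 2 ∂μ
  have hQ : Continuous Q := by
    rw [continuous_iff_continuousAt]
    intro a₀
    refine continuousAt_of_dominated (bound := fun _ => B ^ 2 * (‖a₀‖ + 1) ^ 2)
      (Eventually.of_forall fun a =>
        ((continuous_combinationNorm ψ hψ b a).pow 2).measurable.aestronglyMeasurable) ?_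
      (integrable_const _) (ae_of_all _ fun x =>
        ((continuous_combinationNorm_left ψ b x).pow 2).continuousAt)
    filter_upwards [Metric.ball_mem_nhds a₀ one_pos] with a ha
    refine ae_of_all _ fun x => ?_
    rw [Real.norm_of_nonneg (sq_nonneg _)]
    refine (hsq a x).trans ?_
    have : ‖a‖ ≤ ‖a₀‖ + 1 := by
      have h1 := norm_sub_norm_le a a₀
      rw [mem_ball_iff_norm] at ha
      linarith
    gcongr
  have hhom : ∀ t a, Q (t • a) = t ^ 2 * Q a := by
    intro t a
    simp only [Q, combinationNorm_smul, mul_pow, sq_abs, integral_const_mul]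
  have hpos : ∀ a ≠ 0, 0 < Q a := fun a ha =>
    integral_combinationNorm_sq_pos μ hX hμ ψ hψ b.linearIndependent ha
  refine ⟨e.toEquiv.countable_iff.2 inferInstance,
    fun s => B ^ 2 * ‖fun i => (e s i : ℝ)‖ ^ 2, |C|, ?_⟩
  refine ⟨fun s x => sq_nonneg _, fun s => ((continuous_pointNorm ψ hψ s).pow 2).measurable,
    fun s x => ?_, hcd.measurable, fun x => (hC x trivial).trans (le_abs_self C),
    fun s => by positivity, abs_nonneg C, ⟨0, ?_⟩, fun t ht => ?_⟩
  · rw [hsum]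
    exact hsq _ x
  · ext x
    have : (DualPoint.above L x).evalSection k 0 = 0 := map_zero _
    change (DualPoint.above L x).pow k ((0 : H0 L k).1 (DualPoint.above L x).x.pt) = 0 at this
    simp only [pointNorm]
    rw [this]
    simp
  · have h := summable_gauss_of_pos_def hQ hhom hpos (sq_nonneg B) ht
    rw [← e.toEquiv.summable_iff] at h
    refine h.congr fun s => ?_
    simp only [Function.comp_apply, Q, hsum]
    rfl

end

end ArithTheta

end

/-! ### The theta formula as an instance of the Gaussian family -/

theorem mainTheorem9 (X : Scheme.{0}) (hX : ArithTheta.IsArithmeticVariety X)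
    (L : ArithTheta.LineBundle X)
    (μ : Measure (ArithTheta.ComplexPoints X)) [IsProbabilityMeasure μ]
    (hμ : ∀ x : ArithTheta.ComplexPoints X,
      ¬ ArithTheta.IsPluripolar (μ.support ∩ connectedComponent x))
    (φ ψ : ArithTheta.Weight L) (hφ : Continuous φ.toFun) (hψ : Continuous ψ.toFun) (k : ℕ) :
    -- the Gaussian sums, the sums defining `Θ(μ, kφ_t)`, and the integrals converge
    (∀ t ∈ Set.Icc (0 : ℝ) 1,
      (∀ s : ArithTheta.H0 L k,
        Integrable (fun x => ArithTheta.pointNorm (φ.segment ψ t) s x ^ 2) μ) ∧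
      Summable (fun s : ArithTheta.H0 L k =>
        Real.exp (-Real.pi * ArithTheta.normSq μ (φ.segment ψ t) s)) ∧
      ∀ x : ArithTheta.ComplexPoints X, Summable (fun s : ArithTheta.H0 L k =>
        ArithTheta.pointNorm (φ.segment ψ t) s x ^ 2 *
          Real.exp (-Real.pi * ArithTheta.normSq μ (φ.segment ψ t) s))) ∧
    (∀ x : ArithTheta.ComplexPoints X,
      IntervalIntegrable (fun t => ArithTheta.Theta μ (φ.segment ψ t) k 1 x) volume 0 1) ∧
    Integrable (fun x =>
      φ.diff ψ x * (∫ t in (0 : ℝ)..1, ArithTheta.Theta μ (φ.segment ψ t) k 1 x)) μ ∧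
    -- the formula
    ArithTheta.hTheta μ φ k - ArithTheta.hTheta μ ψ k =
      k * ∫ x, φ.diff ψ x *
        (∫ t in (0 : ℝ)..1, ArithTheta.Theta μ (φ.segment ψ t) k 1 x) ∂μ := by
  open ArithTheta in
  obtain ⟨_, M, C, h⟩ := exists_gaussianFamily μ hX hμ φ ψ hφ hψ k
  -- The parameter is `κ = 2 k` because the norms are squared; the factor `κ / 2` in the general
  -- formula then becomes `k`.
  have hd : ∀ (t : ℝ) (s : H0 L k) x, GaussianFamily.deform
      (fun (s : H0 L k) x => pointNorm ψ s x ^ 2) (φ.diff ψ) (2 * k) t s x =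
      pointNorm (φ.segment ψ t) s x ^ 2 := by
    intro t s x
    rw [pointNorm_segment, mul_pow, ← Real.exp_nat_mul, GaussianFamily.deform]
    congr 2
    push_cast
    ring
  have hg : ∀ (t : ℝ) (s : H0 L k), GaussianFamily.gauss μ
      (fun (s : H0 L k) x => pointNorm ψ s x ^ 2) (φ.diff ψ) (2 * k) t s =
      Real.exp (-Real.pi * normSq μ (φ.segment ψ t) s) := by
    intro t s
    simp only [GaussianFamily.gauss, hd, normSq]
  have ht : ∀ (t : ℝ) x, GaussianFamily.theta μ
      (fun (s : H0 L k) x => pointNorm ψ s x ^ 2) (φ.diff ψ) (2 * k) t x =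
      Theta μ (φ.segment ψ t) k 1 x := by
    intro t x
    simp only [GaussianFamily.theta, hg, hd, Theta, mul_one]
  have key := h.log_tsum_gauss_sub (2 * k)
  simp only [ht, hg, Weight.segment_one, Weight.segment_zero] at key
  refine ⟨fun t _ => ⟨fun s => ?_, ?_, fun x => ?_⟩, fun x => ?_, key.1, ?_⟩
  · exact (h.integrable_deform (2 * k) t s).congr (ae_of_all _ (hd t s))
  · exact (h.summable_gauss (2 * k) t).congr (hg t)
  · exact (h.summable_deform_mul_gauss (2 * k) t x).congr fun s => by rw [hd, hg]
  · have := h.continuous_theta (2 * k) x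
    simp only [ht] at this
    exact this.intervalIntegrable 0 1
  · rw [hTheta, hTheta, key.2, mul_div_cancel_left₀ _ two_ne_zero]
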